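/- **Setting.** Let $\mathcal C_0\subset\mathbb R^3$ be a nonempty open convex set (the cavity) and $\mathscr B_0\subset\mathbb R^3$ (the rigid body) with $\partial\mathcal C_0\subset\mathscr B_0$, $\mathcal C_0\cap\mathscr B_0=\emptyset$ and $\mathcal S_0:=\mathcal C_0\cup\mathscr B_0$ open and bounded. The body has an integrable density $\varrho_{\mathscr B}\ge 0$ and mass $m=\int_{\mathscr B_0}\varrho_{\mathscr B}\,dx$, and $\int_{\mathscr B_0}\varrho_{\mathscr B}(x)\,x_3\,dx=0$ (the origin $O$ is the orthogonal projection of the center of mass of the body onto the rotation axis, which is spanned by $e_3$). Let $a>0$, $\gamma>3/2$, $\mu>0$, $\lambda\ge 0$, $g>0$, $M>0$; put $p(\varrho)=a\varrho^\gamma$ and $\mathbb S(u)=2\mu\,\mathbb D(u)+(\lambda-\tfrac23\mu)(\operatorname{div}u)\,\mathbb I$, where $\mathbb D(u)$ is the symmetric part of $\nabla u$. **Steady renormalized weak solutions.** A quadruple $(\varrho,u,\omega,\mathbf g)$, with $\varrho:\mathcal C_0\to\mathbb R$, $u:\mathcal C_0\to\mathbb R^3$, $\omega\in\mathbb R$,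 $\mathbf g\in\mathbb R^3$ and $v:=u-\omega e_3\times x$, is a *steady renormalized weak solution* if $\varrho\ge 0$ a.e., $\varrho\in L^\gamma(\mathcal C_0)$, $v\in W^{1,2}_0(\mathcal C_0)$ (so that $u=\omega e_3\times x$ on $\partial\mathcal C_0$), and * $\operatorname{div}(\varrho v\otimes u)+\varrho\,\omega e_3\times u+\nabla p(\varrho)-\operatorname{div}\mathbb S(u)=\varrho\,\mathbf g$ in the sense of distributions in $\mathcal C_0$; * for every $b\in C^1(\mathbb R)$ the functions $b(\varrho)v$ and $(\varrho b'(\varrho)-b(\varrho))\operatorname{div}v$ are integrable on $\mathcal C_0$ and $\operatorname{div}(b(\varrho)v)+(\varrho b'(\varrho)-b(\varrho))\operatorname{div}v=0$ in the weak sense, with test functions that are smooth up to the boundary, that is, $\int_{\mathcal C_0}b(\varrho)\,v\cdot\nabla\psi\,dx=\int_{\mathcal C_0}(\varrho b'(\varrho)-b(\varrho))\operatorname{div}v\,\psi\,dx$ for all $\psi\in C^\infty(\mathbb R^3)$ (the case $b(z)=z$ is $\operatorname{div}(\varrho v)=0$); * $e_3\cdot\big[\big(\int_{\mathcal S_0}\hat\varrho\,x\,dx\big)\times\mathbf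 g\big]=0$, where $\hat\varrho=\varrho$ in $\mathcal C_0$ and $\hat\varrho=\varrho_{\mathscr B}$ in $\mathscr B_0$; * $\omega\,e_3\times\mathbf g=0$; * $\int_{\mathcal C_0}\varrho\,dx=M$, $|\mathbf g|=g$ and $\mathbf g\cdot e_3=0$. **Notation.** For $\vartheta\in\mathbb R$ let $\mathbb Q_0=\mathbb Q_0(\vartheta)$ be the rotation by the angle $\vartheta$ about $e_3$, $y=\mathbb Q_0 x$, $\mathcal C_{eq}=\mathbb Q_0\mathcal C_0$, $\mathscr B_{eq}=\mathbb Q_0\mathscr B_0$, $r_{\mathscr B}(y)=\varrho_{\mathscr B}(\mathbb Q_0^\top y)$, $\mathcal M=M+m$, and for $c\in\mathbb R$ $$r_s(y_1)=\Big[\Big(\frac{\gamma-1}{a\gamma}\,g\,y_1+c\Big)_+\Big]^{\frac1{\gamma-1}} .$$ **Theorem 3.1.** A quadruple $(\varrho_s,u_s,\omega_s,\mathbf g_s)$ is a steady renormalized weak solution if and only if 1. $\omega_s=0$ and $u_s=0$ a.e. in $\mathcal C_0$, and there are $\vartheta\in[0,2\pi)$ and $c\in\mathbb R$ such that, with $\mathbb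 Q_0=\mathbb Q_0(\vartheta)$, 2. $\mathbb Q_0\,\mathbf g_s=g\,e_1$ and $\varrho_s(x)=r_s(y_1)$, $y=\mathbb Q_0x$, for a.e. $x\in\mathcal C_0$; 3. the center of mass $y_C=\frac1{\mathcal M}\Big(\int_{\mathcal C_{eq}}\varrho_s(\mathbb Q_0^\top y)\,y\,dy+\int_{\mathscr B_{eq}}r_{\mathscr B}(y)\,y\,dy\Big)$ of the whole system lies in the vertical plane $\{y_2=0\}$ containing the rotation axis, precisely at $$y_C=\frac1{\mathcal M}\Big[\Big(\int_{\mathcal C_{eq}}r_s(y_1)\,y_1\,dy+\int_{\mathscr B_{eq}}r_{\mathscr B}(y)\,y_1\,dy\Big)e_1+\Big(\int_{\mathcal C_{eq}}r_s(y_1)\,y_3\,dy\Big)e_3\Big];$$ 4. $\int_{\mathcal C_{eq}}r_s(y_1)\,dy=M$. Moreover, for every $\vartheta\in\mathbb R$ there is exactly one $c\in\mathbb R$ that satisfies the mass condition 4. -/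

import Mathlib

open Set Filter Topology MeasureTheory
open scoped Matrix

noncomputable section

namespace Pendulum

/-- Euclidean three-space.  The coordinates `0`, `1`, `2` are the first, second and third
coordinates in the usual one-based numbering. -/
abbrev E3 : Type := EuclideanSpace ℝ (Fin 3)

/-- The canonical basis vectors; `e 2` spans the rotation axis, `e 0` is the downward vertical of
the inertial frame. -/
def e (i : Fin 3) : E3 := EuclideanSpace.single i 1

/-- The vector product of Euclidean three-space. -/
def cross (x y : E3) : E3 := WithLp.toLp 2 (crossProduct x.ofLp y.ofLp)

/-- The action of a `3 × 3` matrix on Euclidean three-space. -/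
def act (A : Matrix (Fin 3) (Fin 3) ℝ) (x : E3) : E3 := WithLp.toLp 2 (A *ᵥ x.ofLp)

/-- The rotation by the angle `θ` about the third axis. -/
def rotation (θ : ℝ) : Matrix (Fin 3) (Fin 3) ℝ :=
  !![Real.cos θ, -Real.sin θ, 0;
     Real.sin θ, Real.cos θ, 0;
     0, 0, 1]

/-- The matrix of a linear map of Euclidean three-space; applied to the derivative of a vector field
`w` it has the entries `∂ⱼ wᵢ`. -/
def gradMatrix (L : E3 →L[ℝ] E3) : Matrix (Fin 3) (Fin 3) ℝ :=
  Matrix.of fun i j => L (e j) i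

/-- The divergence of a vector field in terms of its derivative. -/
def divOf (L : E3 →L[ℝ] E3) : ℝ := (gradMatrix L).trace

/-- The double contraction `A : B`. -/
def contract (A B : Matrix (Fin 3) (Fin 3) ℝ) : ℝ := ∑ i, ∑ j, A i j * B i j

/-- The derivative of the rigid velocity field `x ↦ ω e₃ × x`. -/
def rigidGrad (ω : ℝ) : E3 →L[ℝ] E3 :=
  LinearMap.toContinuousLinearMap
    { toFun := fun x => ω • cross (e 2) x
      map_add' := by
        intro x y
        ext i
        fin_cases i <;> simp [cross, crossProduct, e, mul_add, add_comm]
      map_smul' := by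
        intro r x
        ext i
        fin_cases i <;> simp [cross, crossProduct, e, mul_left_comm] }

/-- Viscous stress `2 μ D + (λ - 2 μ / 3) (div) I`, where `D` is the symmetric part of the
velocity gradient. -/
def stress (μ lam : ℝ) (L : E3 →L[ℝ] E3) : Matrix (Fin 3) (Fin 3) ℝ :=
  (2 * μ) • ((1 / 2 : ℝ) • (gradMatrix L + (gradMatrix L)ᵀ))
    + ((lam - 2 / 3 * μ) * divOf L) • (1 : Matrix (Fin 3) (Fin 3) ℝ)

/-- `φ` is a smooth vector field with compact support in the open set `C`. -/
def IsTestField (C : Set E3) (φ : E3 → E3) : Prop :=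
  ContDiff ℝ (⊤ : ℕ∞) φ ∧ HasCompactSupport φ ∧ tsupport φ ⊆ C

/-- `v` belongs to the Sobolev space `W₀^{1,2}(C)`, the closure of the test fields in `W^{1,2}(C)`,
and `Dv` is its weak derivative (which is unique almost everywhere in `C`). -/
def IsSobolevZero (C : Set E3) (v : E3 → E3) (Dv : E3 → E3 →L[ℝ] E3) : Prop :=
  MemLp v 2 (volume.restrict C) ∧ MemLp Dv 2 (volume.restrict C) ∧
    ∃ φ : ℕ → E3 → E3, (∀ n, IsTestField C (φ n)) ∧
      Tendsto (fun n => eLpNorm (fun x => φ n x - v x) 2 (volume.restrict C)) atTop (𝓝 0) ∧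
      Tendsto (fun n => eLpNorm (fun x => fderiv ℝ (φ n) x - Dv x) 2 (volume.restrict C))
        atTop (𝓝 0)

/-- The physical pendulum with a convex cavity filled with a viscous barotropic fluid: reference
configurations, material constants, and the standing assumptions on them. -/
structure System where
  /-- reference configuration of the cavity -/
  C : Set E3
  /-- reference configuration of the rigid body -/
  B : Set E3
  /-- density of the rigid body -/
  ρB : E3 → ℝ
  /-- coefficient of the pressure law -/
  a : ℝ
  /-- adiabatic exponent of the pressure law -/
  γ : ℝ
  /-- shear viscosity -/
  μ : ℝ
  /-- bulk viscosity -/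
  lam : ℝ
  /-- magnitude of the acceleration of gravity -/
  grav : ℝ
  /-- total mass of the fluid -/
  M : ℝ
  isOpen_C : IsOpen C
  convex_C : Convex ℝ C
  nonempty_C : C.Nonempty
  frontier_subset : frontier C ⊆ B
  disjoint : Disjoint C B
  isOpen_union : IsOpen (C ∪ B)
  isBounded_union : Bornology.IsBounded (C ∪ B)
  ρB_nonneg : ∀ x ∈ B, 0 ≤ ρB x
  ρB_integrable : IntegrableOn ρB B
  /-- The origin is the orthogonal projection of the center of mass of the body on the axis. -/
  axial_moment : ∫ x in B, ρB x * x 2 = 0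
  a_pos : 0 < a
  γ_gt : 3 / 2 < γ
  μ_pos : 0 < μ
  lam_nonneg : 0 ≤ lam
  grav_pos : 0 < grav
  M_pos : 0 < M

namespace System

variable (S : System)

/-- The pressure law `p(ρ) = a ρ^γ`. -/
def pressure (r : ℝ) : ℝ := S.a * r ^ S.γ

/-- The density of the whole system: `ρ` in the cavity, the given density in the body. -/
def totalDensity (ρ : E3 → ℝ) (x : E3) : ℝ :=
  open Classical in if x ∈ S.C then ρ x else S.ρB x

/-- The mass of the rigid body. -/
def bodyMass : ℝ := ∫ x in S.B, S.ρB x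

/-- Weak form of the steady momentum equation
`div (ρ v ⊗ u) + ρ ω e₃ × u + ∇ p(ρ) - div 𝕊(u) = ρ g`, where `v = u - ω e₃ × x` and `Dv` is the
weak derivative of `v`. -/
def WeakMomentum (ρ : E3 → ℝ) (u : E3 → E3) (ω : ℝ) (g : E3) (v : E3 → E3)
    (Dv : E3 → E3 →L[ℝ] E3) : Prop :=
  ∀ φ : E3 → E3, IsTestField S.C φ →
    (∫ x in S.C, ρ x * inner ℝ (u x) (fderiv ℝ φ x (v x)))
      - (∫ x in S.C, ρ x * inner ℝ (ω • cross (e 2) (u x)) (φ x))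
      + (∫ x in S.C, S.pressure (ρ x) * divOf (fderiv ℝ φ x))
      - (∫ x in S.C,
          contract (stress S.μ S.lam (Dv x + rigidGrad ω)) (gradMatrix (fderiv ℝ φ x)))
      = -∫ x in S.C, ρ x * inner ℝ g (φ x)

/-- Renormalized continuity equation `div (b(ρ) v) + (ρ b'(ρ) - b(ρ)) div v = 0` for every
`b ∈ C¹(ℝ)`, in the weak sense with test functions smooth up to the boundary of the cavity; both
terms are required to be integrable. -/
def RenormalizedContinuity (ρ : E3 → ℝ) (v : E3 → E3) (Dv : E3 → E3 →L[ℝ] E3) : Prop :=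
  ∀ b : ℝ → ℝ, ContDiff ℝ 1 b →
    IntegrableOn (fun x => b (ρ x) • v x) S.C ∧
    IntegrableOn (fun x => (ρ x * deriv b (ρ x) - b (ρ x)) * divOf (Dv x)) S.C ∧
    ∀ ψ : E3 → ℝ, ContDiff ℝ (⊤ : ℕ∞) ψ →
      (∫ x in S.C, b (ρ x) * fderiv ℝ ψ x (v x))
        - (∫ x in S.C, (ρ x * deriv b (ρ x) - b (ρ x)) * divOf (Dv x) * ψ x) = 0

/-- `(ρ, u, ω, g)` is a steady renormalized weak solution: `ρ` is the density, `u` the absolute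
velocity of the fluid in the body frame, `ω` the angular velocity and `g` the gravity vector in the
body frame.  The boundary condition `u = ω e₃ × x` is the membership of the relative velocity in
`W₀^{1,2}`.  The continuity equation itself is the case `b(z) = z` of the renormalized one. -/
structure IsSteadySolution (ρ : E3 → ℝ) (u : E3 → E3) (ω : ℝ) (g : E3) : Prop where
  density_memLp : MemLp ρ (ENNReal.ofReal S.γ) (volume.restrict S.C)
  density_nonneg : ∀ᵐ x ∂volume.restrict S.C, 0 ≤ ρ x
  equations : ∃ Dv : E3 → E3 →L[ℝ] E3,
    IsSobolevZero S.C (fun x => u x - ω • cross (e 2) x) Dv ∧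
    S.WeakMomentum ρ u ω g (fun x => u x - ω • cross (e 2) x) Dv ∧
    S.RenormalizedContinuity ρ (fun x => u x - ω • cross (e 2) x) Dv
  torque : inner ℝ (e 2) (cross (∫ x in S.C ∪ S.B, S.totalDensity ρ x • x) g) = 0
  gravity_steady : ω • cross (e 2) g = 0
  mass : ∫ x in S.C, ρ x = S.M
  gravity_norm : ‖g‖ = S.grav
  gravity_horizontal_axis : inner ℝ g (e 2) = 0

/-- The hydrostatic profile
`r_s(s) = ([((γ - 1) / (a γ)) g s + c]₊) ^ (1 / (γ - 1))`. -/
def profile (c s : ℝ) : ℝ :=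
  (max ((S.γ - 1) / (S.a * S.γ) * S.grav * s + c) 0) ^ (1 / (S.γ - 1))

/-- The cavity in the inertial frame, for the orientation of angle `θ`. -/
def cavityEq (θ : ℝ) : Set E3 := act (rotation θ) '' S.C

/-- The body in the inertial frame, for the orientation of angle `θ`. -/
def bodyEq (θ : ℝ) : Set E3 := act (rotation θ) '' S.B

/-- The density of the body in the inertial frame, for the orientation of angle `θ`. -/
def bodyDensityEq (θ : ℝ) (y : E3) : ℝ := S.ρB (act (rotation θ)ᵀ y)

/-- The center of mass, in the inertial frame, of the whole system with the orientation of angle `θ`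
and the fluid density `ρ` (given in the body frame). -/
def centerOfMass (θ : ℝ) (ρ : E3 → ℝ) : E3 :=
  (S.M + S.bodyMass)⁻¹ •
    ((∫ y in S.cavityEq θ, ρ (act (rotation θ)ᵀ y) • y)
      + ∫ y in S.bodyEq θ, S.bodyDensityEq θ y • y)

/-- The explicit position of the center of mass in the plane spanned by the vertical and the
axis, for the orientation of angle `θ` and the constant `c` in the profile. -/
def equilibriumPoint (θ c : ℝ) : E3 :=
  (S.M + S.bodyMass)⁻¹ •
    (((∫ y in S.cavityEq θ, S.profile c (y 0) * y 0)
        + ∫ y in S.bodyEq θ, S.bodyDensityEq θ y * y 0) • e 0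
      + (∫ y in S.cavityEq θ, S.profile c (y 0) * y 2) • e 2)

end System

end Pendulum

end

/-! Since `g` is nonzero and orthogonal to the axis, `ω e₃ × g = 0` forces `ω = 0`, and then `u`
itself lies in `W₀^{1,2}`. Formally, testing the momentum equation with `u` leaves only the
dissipation. The convective term is `ρ u · ∇(|u|²/2)` and the gravity term is `ρ u · ∇(g · x)`, so
both vanish by the continuity equation. The work of the pressure `∫ p div u` vanishes by the
renormalized equation for `b(z) = a z^γ / (γ - 1)`, tested with `ψ = 1`. Korn's inequality then
gives `∇u = 0`, hence `u = 0`.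

The difficulty is that `u` is not an admissible test field, because `p(ρ)` is only integrable. Three
facts repair this. The renormalized equation is assumed for every `C¹` function `b`, however fast it
grows, and this bounds `ρ` where `u ≠ 0` (`exists_bound_of_integrable_smul`), so `ρ u` is as
integrable as `u`. The momentum equation then bounds `∇p` in the dual of `W₀^{1,2}`. Testing with
cut-off gradients of Newtonian potentials makes `p` locally square integrable
(`memLp_two_interior`), so that `η u` may be used for a cut-off `η` (`WeakMomentum.cutoff_eq`).
Finally the error `∇η ⊗ u` lives in a layer of width of order `1/k` with `|∇η| ≤ k`, and it tends to
zero in `L²` by a Hardy-type estimate in convex sets (`IsSobolevZero.tendsto_boundary_layer`).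

At rest, the momentum equation is `∇p = ρ g` in the weak sense. Mollified pressures increase in the
direction of `g`, which yields local bounds. As `ρ` is a continuous function of `p`, a
differentiable representative follows (`IsHydrostatic.exists_regular`). Where positive, `ρ^(γ-1)`
has the constant gradient `(γ-1)/(aγ) g`, and following segments in the convex cavity gives one
constant `c` for the whole of it (`exists_eq_max_inner`). After the rotation taking `g` to a
multiple of `e₁`, the torque condition says that the second coordinate of the center of mass
vanishes.

Conversely, the profile solves `∇p = ρ g` classically. Its mass is continuous in `c`, and strictly
increasing once positive, so the prescribed mass is attained exactly once. -/

namespace Pendulum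

open scoped ENNReal NNReal

/-! ### Hölder's inequality and convergence of bilinear integrals. -/

section Holder

variable {α : Type*} {m : MeasurableSpace α} {ν : Measure α}
  {E F G : Type*} [NormedAddCommGroup E] [NormedSpace ℝ E] [NormedAddCommGroup F] [NormedSpace ℝ F]
  [NormedAddCommGroup G] [NormedSpace ℝ G]

/-- Hölder's inequality for a continuous bilinear map. -/
theorem eLpNorm_bilin_le {p q r : ℝ≥0∞} [p.HolderTriple q r] (b : E →L[ℝ] F →L[ℝ] G)
    {f : α → E} {g : α → F} (hf : AEStronglyMeasurable f ν) (hg : AEStronglyMeasurable g ν) :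
    eLpNorm (fun x => b (f x) (g x)) r ν ≤ ‖b‖₊ * eLpNorm f p ν * eLpNorm g q ν :=
  eLpNorm_le_eLpNorm_mul_eLpNorm'_of_norm hf hg (fun x y => b x y) ‖b‖₊
    (Eventually.of_forall fun x => by simpa using b.le_opNorm₂ (f x) (g x))

theorem memLp_bilin {p q r : ℝ≥0∞} [p.HolderTriple q r] (b : E →L[ℝ] F →L[ℝ] G)
    {f : α → E} {g : α → F} (hf : MemLp f p ν) (hg : MemLp g q ν) :
    MemLp (fun x => b (f x) (g x)) r ν :=
  hf.of_bilin (fun x y => b x y) ‖b‖₊ hg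
    (b.aestronglyMeasurable_comp₂ hf.1 hg.1)
    (Eventually.of_forall fun x => by
      have := b.le_opNorm₂ (f x) (g x)
      exact_mod_cast this)

/-- Bilinear maps are continuous along norm-convergent sequences in Lebesgue spaces. -/
theorem tendsto_eLpNorm_bilin {p q r : ℝ≥0∞} [p.HolderTriple q r] (hr : 1 ≤ r)
    (b : E →L[ℝ] F →L[ℝ] G)
    {f : ℕ → α → E} {f₀ : α → E} {g : ℕ → α → F} {g₀ : α → F}
    (hf : ∀ n, AEStronglyMeasurable (f n) ν) (hg : ∀ n, AEStronglyMeasurable (g n) ν)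
    (hf₀ : MemLp f₀ p ν) (hg₀ : MemLp g₀ q ν)
    (hfl : Tendsto (fun n => eLpNorm (fun x => f n x - f₀ x) p ν) atTop (𝓝 0))
    (hgl : Tendsto (fun n => eLpNorm (fun x => g n x - g₀ x) q ν) atTop (𝓝 0)) :
    Tendsto (fun n => eLpNorm (fun x => b (f n x) (g n x) - b (f₀ x) (g₀ x)) r ν)
      atTop (𝓝 0) := by
  have key : ∀ n, eLpNorm (fun x => b (f n x) (g n x) - b (f₀ x) (g₀ x)) r ν ≤
      ‖b‖₊ * eLpNorm (fun x => f n x - f₀ x) p ν * eLpNorm (fun x => g n x - g₀ x) q ν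
      + ‖b‖₊ * eLpNorm (fun x => f n x - f₀ x) p ν * eLpNorm g₀ q ν
      + ‖b‖₊ * eLpNorm f₀ p ν * eLpNorm (fun x => g n x - g₀ x) q ν := by
    intro n
    have hfn : AEStronglyMeasurable (fun x => f n x - f₀ x) ν := (hf n).sub hf₀.1
    have hgn : AEStronglyMeasurable (fun x => g n x - g₀ x) ν := (hg n).sub hg₀.1
    have e1 : (fun x => b (f n x) (g n x) - b (f₀ x) (g₀ x)) =
        ((fun x => b (f n x - f₀ x) (g n x - g₀ x)) + fun x => b (f n x - f₀ x) (g₀ x))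
        + fun x => b (f₀ x) (g n x - g₀ x) := by
      ext x; simp; abel
    rw [e1]
    refine (eLpNorm_add_le ((b.aestronglyMeasurable_comp₂ hfn hgn).add
      (b.aestronglyMeasurable_comp₂ hfn hg₀.1)) (b.aestronglyMeasurable_comp₂ hf₀.1 hgn) hr).trans ?_
    gcongr
    · refine (eLpNorm_add_le (b.aestronglyMeasurable_comp₂ hfn hgn)
        (b.aestronglyMeasurable_comp₂ hfn hg₀.1) hr).trans ?_
      gcongr
      · exact eLpNorm_bilin_le b hfn hgn
      · exact eLpNorm_bilin_le b hfn hg₀.1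
    · exact eLpNorm_bilin_le b hf₀.1 hgn
  refine tendsto_of_tendsto_of_tendsto_of_le_of_le tendsto_const_nhds ?_ (fun _ => zero_le) key
  have h1 : Tendsto (fun n => (‖b‖₊ : ℝ≥0∞) * eLpNorm (fun x => f n x - f₀ x) p ν) atTop (𝓝 0) := by
    simpa using ENNReal.Tendsto.const_mul hfl (Or.inr ENNReal.coe_ne_top)
  have h2 := ENNReal.Tendsto.mul h1 (Or.inr ENNReal.zero_ne_top) hgl (Or.inr ENNReal.zero_ne_top)
  have h3 := ENNReal.Tendsto.mul_const h1 (b := eLpNorm g₀ q ν) (Or.inr hg₀.2.ne)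
  have h4 := ENNReal.Tendsto.const_mul hgl (a := (‖b‖₊ : ℝ≥0∞) * eLpNorm f₀ p ν)
    (Or.inr (ENNReal.mul_ne_top ENNReal.coe_ne_top hf₀.2.ne))
  simpa using (h2.add h3).add h4

/-- Integrals of bilinear expressions converge along sequences converging in dual Lebesgue
spaces. -/
theorem tendsto_integral_bilin {p q : ℝ≥0∞} [p.HolderTriple q 1]
    (b : E →L[ℝ] F →L[ℝ] G)
    {f : ℕ → α → E} {f₀ : α → E} {g : ℕ → α → F} {g₀ : α → F}
    (hf : ∀ n, MemLp (f n) p ν) (hg : ∀ n, MemLp (g n) q ν)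
    (hf₀ : MemLp f₀ p ν) (hg₀ : MemLp g₀ q ν)
    (hfl : Tendsto (fun n => eLpNorm (fun x => f n x - f₀ x) p ν) atTop (𝓝 0))
    (hgl : Tendsto (fun n => eLpNorm (fun x => g n x - g₀ x) q ν) atTop (𝓝 0)) :
    Tendsto (fun n => ∫ x, b (f n x) (g n x) ∂ν) atTop (𝓝 (∫ x, b (f₀ x) (g₀ x) ∂ν)) := by
  refine tendsto_integral_of_L1' _ (memLp_one_iff_integrable.1 (memLp_bilin b hf₀ hg₀)).1
    (Eventually.of_forall fun n => memLp_one_iff_integrable.1 (memLp_bilin b (hf n) (hg n))) ?_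
  exact tendsto_eLpNorm_bilin le_rfl b (fun n => (hf n).1) (fun n => (hg n).1) hf₀ hg₀ hfl hgl

/-- One fixed factor. -/
theorem tendsto_integral_bilin_left {p q : ℝ≥0∞} [p.HolderTriple q 1]
    (b : E →L[ℝ] F →L[ℝ] G)
    {f₀ : α → E} {g : ℕ → α → F} {g₀ : α → F}
    (hg : ∀ n, MemLp (g n) q ν) (hf₀ : MemLp f₀ p ν) (hg₀ : MemLp g₀ q ν)
    (hgl : Tendsto (fun n => eLpNorm (fun x => g n x - g₀ x) q ν) atTop (𝓝 0)) :
    Tendsto (fun n => ∫ x, b (f₀ x) (g n x) ∂ν) atTop (𝓝 (∫ x, b (f₀ x) (g₀ x) ∂ν)) :=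
  tendsto_integral_bilin b (fun _ => hf₀) hg hf₀ hg₀ (by simp) hgl

theorem abs_integral_bilin_le {p q : ℝ≥0∞} [p.HolderTriple q 1]
    (b : E →L[ℝ] F →L[ℝ] G) {f : α → E} {g : α → F} (hf : MemLp f p ν) (hg : MemLp g q ν) :
    ‖∫ x, b (f x) (g x) ∂ν‖ ≤ ‖b‖ * (eLpNorm f p ν).toReal * (eLpNorm g q ν).toReal := by
  refine (norm_integral_le_lintegral_norm _).trans ?_
  simp only [ofReal_norm]
  rw [← eLpNorm_one_eq_lintegral_enorm]
  have := eLpNorm_bilin_le (r := 1) (p := p) (q := q) b hf.1 hg.1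
  have h2 := ENNReal.toReal_mono (by
    exact ENNReal.mul_ne_top (ENNReal.mul_ne_top ENNReal.coe_ne_top hf.2.ne) hg.2.ne) this
  simpa using h2

end Holder

instance holderTriple_two_two_one : (2 : ℝ≥0∞).HolderTriple 2 1 :=
  ⟨by rw [ENNReal.inv_two_add_inv_two]; simp⟩

instance holderTriple_four_four_two : (4 : ℝ≥0∞).HolderTriple 4 2 :=
  ⟨by
    have : (4 : ℝ≥0∞) = 2 * 2 := by norm_num
    rw [this, ENNReal.mul_inv (by simp) (by simp), ← mul_add, ENNReal.inv_two_add_inv_two, mul_one]⟩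

/-! ### Test fields and the Sobolev inequality. -/

section Test

variable {C : Set E3} {φ ψ : E3 → E3}

theorem IsTestField.contDiff (h : IsTestField C φ) : ContDiff ℝ (⊤ : ℕ∞) φ := h.1

theorem IsTestField.hasCompactSupport (h : IsTestField C φ) : HasCompactSupport φ := h.2.1

theorem IsTestField.continuous_fderiv (h : IsTestField C φ) : Continuous (fderiv ℝ φ) :=
  h.1.continuous_fderiv (by simp)

theorem IsTestField.differentiable (h : IsTestField C φ) : Differentiable ℝ φ :=
  h.1.differentiable (by simp)

theorem IsTestField.sub (h : IsTestField C φ) (h' : IsTestField C ψ) :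
    IsTestField C (φ - ψ) :=
  ⟨h.1.sub h'.1, h.2.1.sub h'.2.1, (tsupport_sub φ ψ).trans (union_subset h.2.2 h'.2.2)⟩

theorem IsTestField.memLp (h : IsTestField C φ) (p : ℝ≥0∞) (ν : Measure E3)
    [IsFiniteMeasureOnCompacts ν] : MemLp φ p ν :=
  h.1.continuous.memLp_of_hasCompactSupport h.2.1

theorem IsTestField.fderiv_memLp (h : IsTestField C φ) (p : ℝ≥0∞) (ν : Measure E3)
    [IsFiniteMeasureOnCompacts ν] : MemLp (fderiv ℝ φ) p ν :=
  h.continuous_fderiv.memLp_of_hasCompactSupport (h.2.1.fderiv (𝕜 := ℝ))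

theorem IsTestField.support_subset (h : IsTestField C φ) : Function.support φ ⊆ C :=
  subset_closure.trans h.2.2

theorem IsTestField.support_fderiv_subset (h : IsTestField C φ) :
    Function.support (fderiv ℝ φ) ⊆ C :=
  (_root_.support_fderiv_subset ℝ).trans h.2.2

theorem IsTestField.eq_zero (h : IsTestField C φ) {x : E3} (hx : x ∉ C) : φ x = 0 := by
  by_contra h0; exact hx (h.support_subset h0)

theorem IsTestField.fderiv_eq_zero (h : IsTestField C φ) {x : E3} (hx : x ∉ C) :
    fderiv ℝ φ x = 0 := by
  by_contra h0; exact hx (h.support_fderiv_subset h0)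

/-- The Gagliardo–Nirenberg–Sobolev inequality in dimension 3 reaches the exponent 6, and
boundedness of the set allows every smaller one. The exponent 4 serves the convective and gravity
terms, and the exponent 2 gives Poincaré's inequality. -/
theorem sobolev_test (hC : Bornology.IsBounded C) {q : ℝ≥0} (hq : (1 / 6 : ℝ) ≤ (q : ℝ)⁻¹) :
    ∃ K : ℝ≥0, ∀ φ : E3 → E3, IsTestField C φ →
      eLpNorm φ q (volume.restrict C) ≤ K * eLpNorm (fderiv ℝ φ) 2 (volume.restrict C) := by
  refine ⟨eLpNormLESNormFDerivOfLeConst E3 volume C 2 q, fun φ h => ?_⟩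
  rw [eLpNorm_restrict_eq_of_support_subset h.support_subset,
    eLpNorm_restrict_eq_of_support_subset (f := fderiv ℝ φ) h.support_fderiv_subset]
  have := eLpNorm_le_eLpNorm_fderiv_of_le (volume : Measure E3) (F := E3) (u := φ) (s := C)
    (p := 2) (q := q) (h.1.of_le (by simp)) h.support_subset (by norm_num)
    (by rw [finrank_euclideanSpace]; simp; norm_num) (by
      rw [finrank_euclideanSpace]; simp; norm_num at hq ⊢; linarith) hC
  exact_mod_cast this

end Test

end Pendulum

namespace Pendulum

open scoped ENNReal NNReal

/-! ### Quadratic forms of a velocity gradient. -/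

section Algebra

/-- The full contraction `L : L'` of the matrices of two linear maps. -/
noncomputable def frobForm (L L' : E3 →L[ℝ] E3) : ℝ := contract (gradMatrix L) (gradMatrix L')

/-- The contraction `L : L'ᵀ`. -/
noncomputable def transposeForm (L L' : E3 →L[ℝ] E3) : ℝ := contract (gradMatrix L) (gradMatrix L')ᵀ

theorem divOf_eq (L : E3 →L[ℝ] E3) : divOf L = L (e 0) 0 + L (e 1) 1 + L (e 2) 2 := by
  simp [divOf, Matrix.trace_fin_three, gradMatrix]

theorem frobForm_self (L : E3 →L[ℝ] E3) : frobForm L L = ∑ i, ∑ j, (L (e j) i) ^ 2 := by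
  simp [frobForm, contract, gradMatrix, sq]

theorem transposeForm_self (L : E3 →L[ℝ] E3) :
    transposeForm L L = ∑ i, ∑ j, L (e j) i * L (e i) j := by
  simp [transposeForm, contract, gradMatrix]

theorem frobForm_self_nonneg (L : E3 →L[ℝ] E3) : 0 ≤ frobForm L L := by
  rw [frobForm_self]; positivity

theorem isBilinearMap_frobForm : IsBilinearMap ℝ frobForm where
  add_left _ _ _ := by simp [frobForm, contract, gradMatrix, Fin.sum_univ_three]; ring
  smul_left _ _ _ := by simp [frobForm, contract, gradMatrix, Fin.sum_univ_three]; ring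
  add_right _ _ _ := by simp [frobForm, contract, gradMatrix, Fin.sum_univ_three]; ring
  smul_right _ _ _ := by simp [frobForm, contract, gradMatrix, Fin.sum_univ_three]; ring

theorem isBilinearMap_transposeForm : IsBilinearMap ℝ transposeForm where
  add_left _ _ _ := by simp [transposeForm, contract, gradMatrix, Fin.sum_univ_three]; ring
  smul_left _ _ _ := by simp [transposeForm, contract, gradMatrix, Fin.sum_univ_three]; ring
  add_right _ _ _ := by simp [transposeForm, contract, gradMatrix, Fin.sum_univ_three]; ring
  smul_right _ _ _ := by simp [transposeForm, contract, gradMatrix, Fin.sum_univ_three]; ring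

theorem isBilinearMap_divOf : IsBilinearMap ℝ fun L L' : E3 →L[ℝ] E3 => divOf L * divOf L' where
  add_left _ _ _ := by simp [divOf_eq]; ring
  smul_left _ _ _ := by simp [divOf_eq]; ring
  add_right _ _ _ := by simp [divOf_eq]; ring
  smul_right _ _ _ := by simp [divOf_eq]; ring

theorem isBilinearMap_stress (μ lam : ℝ) :
    IsBilinearMap ℝ fun L L' : E3 →L[ℝ] E3 => contract (stress μ lam L) (gradMatrix L') where
  add_left _ _ _ := by
    simp [stress, divOf_eq, contract, gradMatrix, Fin.sum_univ_three, Matrix.one_apply]; ring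
  smul_left _ _ _ := by
    simp [stress, divOf_eq, contract, gradMatrix, Fin.sum_univ_three, Matrix.one_apply]; ring
  add_right _ _ _ := by
    simp [contract, gradMatrix, Fin.sum_univ_three]; ring
  smul_right _ _ _ := by
    simp [contract, gradMatrix, Fin.sum_univ_three]; ring

/-- The three forms are kept apart because `transposeForm` has no pointwise sign; it is exchanged
for the squared divergence only after integration. -/
theorem contract_stress_self (μ lam : ℝ) (L : E3 →L[ℝ] E3) :
    contract (stress μ lam L) (gradMatrix L) =
      μ * frobForm L L + (μ * transposeForm L L + (lam - 2 / 3 * μ) * (divOf L * divOf L)) := by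
  simp [stress, divOf_eq, contract, gradMatrix, frobForm, transposeForm, Fin.sum_univ_three,
    Matrix.one_apply]
  ring

theorem sum_smul_e (x : E3) : x = ∑ j, x j • e j := by
  ext i
  fin_cases i <;> simp [e, Fin.sum_univ_three]

/-- Cauchy–Schwarz in each row. Lebesgue norms of gradients are built on the operator norm, whereas
Korn's inequality controls the Frobenius norm. -/
theorem norm_sq_le_frobForm (L : E3 →L[ℝ] E3) : ‖L‖ ^ 2 ≤ frobForm L L := by
  have h : ‖L‖ ≤ √(frobForm L L) := by
    refine L.opNorm_le_bound (Real.sqrt_nonneg _) fun x => ?_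
    refine le_of_sq_le_sq ?_ (by positivity)
    rw [mul_pow, Real.sq_sqrt (frobForm_self_nonneg L), EuclideanSpace.norm_sq_eq,
      EuclideanSpace.norm_sq_eq, frobForm_self, Finset.sum_mul]
    refine Finset.sum_le_sum fun i _ => ?_
    have hx : L x i = ∑ j, L (e j) i * x j := by
      conv_lhs => rw [sum_smul_e x]
      simp [Fin.sum_univ_three]; ring
    simp only [Real.norm_eq_abs, sq_abs]
    rw [hx]
    exact Finset.sum_mul_sq_le_sq_mul_sq _ _ _
  calc ‖L‖ ^ 2 ≤ √(frobForm L L) ^ 2 := by gcongr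
    _ = _ := Real.sq_sqrt (frobForm_self_nonneg L)

theorem norm_e (i : Fin 3) : ‖e i‖ = 1 := by simp [e]

theorem divOf_abs_le (L : E3 →L[ℝ] E3) : |divOf L| ≤ 3 * ‖L‖ := by
  have h : ∀ i, |L (e i) i| ≤ ‖L‖ := fun i => by
    refine (PiLp.norm_apply_le (L (e i)) i).trans ?_
    simpa [norm_e] using L.le_opNorm (e i)
  rw [divOf_eq]
  have h0 := abs_le.1 (h 0)
  have h1 := abs_le.1 (h 1)
  have h2 := abs_le.1 (h 2)
  exact abs_le.2 ⟨by linarith, by linarith⟩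

/-- The coordinates as continuous linear forms. -/
noncomputable def coordL (i : Fin 3) : E3 →L[ℝ] ℝ := EuclideanSpace.proj i

@[simp] theorem coordL_apply (i : Fin 3) (x : E3) : coordL i x = x i := rfl

/-- The divergence as a continuous linear form. -/
noncomputable def divL : (E3 →L[ℝ] E3) →L[ℝ] ℝ :=
  LinearMap.mkContinuous
    { toFun := divOf
      map_add' := fun _ _ => by simp [divOf_eq]; ring
      map_smul' := fun _ _ => by simp [divOf_eq]; ring } 3 divOf_abs_le

@[simp] theorem divL_apply (L : E3 →L[ℝ] E3) : divL L = divOf L := rfl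

/-- The algebra of the product rule `div (η w) = η div w + ∇η · w`, with `r = η`, `L = ∇w` and `l =
∇η` at a point. -/
theorem divOf_smul_add_smulRight (r : ℝ) (L : E3 →L[ℝ] E3) (l : E3 →L[ℝ] ℝ) (w : E3) :
    divOf (r • L + l.smulRight w) = r * divOf L + l w := by
  have : l w = w 0 * l (e 0) + w 1 * l (e 1) + w 2 * l (e 2) := by
    conv_lhs => rw [sum_smul_e w]
    simp [Fin.sum_univ_three]
  rw [this]
  simp [divOf_eq]; ring

end Algebra

/-! ### The null-Lagrangian identity. -/

section Korn

/-- Integration by parts puts both derivatives on `f`, where they commute; undoing it exchanges the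
two directions. -/
theorem integral_fderiv_mul_fderiv_comm {f g : E3 → ℝ} (hf : ContDiff ℝ (⊤ : ℕ∞) f)
    (hg : ContDiff ℝ (⊤ : ℕ∞) g) (hfc : HasCompactSupport f) (hgc : HasCompactSupport g)
    (a b : E3) :
    ∫ x, fderiv ℝ f x a * fderiv ℝ g x b = ∫ x, fderiv ℝ f x b * fderiv ℝ g x a := by
  have hD : ∀ c, ContDiff ℝ (⊤ : ℕ∞) fun x => fderiv ℝ f x c := fun c =>
    (hf.fderiv_right (m := (⊤ : ℕ∞)) (by simp)).clm_apply contDiff_const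
  have hDc : ∀ c, HasCompactSupport fun x => fderiv ℝ f x c := fun c =>
    hfc.fderiv_apply (𝕜 := ℝ) c
  have hcg : ∀ c, Continuous fun x => fderiv ℝ g x c := fun c =>
    (hg.continuous_fderiv (by simp)).clm_apply continuous_const
  have ibp : ∀ a b : E3, ∫ x, fderiv ℝ f x a * fderiv ℝ g x b =
      -∫ x, fderiv ℝ (fun x => fderiv ℝ f x a) x b * g x := fun a b => by
    refine integral_mul_fderiv_eq_neg_fderiv_mul_of_integrable ?_ ?_ ?_ ?_ ?_
    · refine Continuous.integrable_of_hasCompactSupport ?_ hgc.mul_left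
      exact ((hD a).continuous_fderiv (by simp)).clm_apply continuous_const |>.mul hg.continuous
    · exact Continuous.integrable_of_hasCompactSupport ((hD a).continuous.mul (hcg b))
        (hDc a).mul_right
    · exact Continuous.integrable_of_hasCompactSupport ((hD a).continuous.mul hg.continuous)
        (hDc a).mul_right
    · exact fun x _ => (hD a).differentiable (by simp) x
    · exact fun x _ => hg.differentiable (by simp) x
  have symm : ∀ x, fderiv ℝ (fun x => fderiv ℝ f x a) x b = fderiv ℝ (fun x => fderiv ℝ f x b) x a := by
    intro x
    have hd : DifferentiableAt ℝ (fderiv ℝ f) x :=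
      (hf.fderiv_right (m := (⊤ : ℕ∞)) (by simp)).differentiable (by simp) x
    have key : ∀ c d : E3, fderiv ℝ (fun x => fderiv ℝ f x c) x d = fderiv ℝ (fderiv ℝ f) x d c := by
      intro c d
      rw [fderiv_clm_apply hd (differentiableAt_const c)]
      simp
    rw [key, key]
    exact (hf.contDiffAt.isSymmSndFDerivAt (by
      simp only [minSmoothness_of_isRCLikeNormedField]
      exact WithTop.coe_le_coe.2 (le_top : (2 : ℕ∞) ≤ ⊤))).eq b a
  rw [ibp, ibp]
  simp_rw [symm]

theorem fderiv_component {φ : E3 → E3} (hφ : Differentiable ℝ φ) (x a : E3) (i : Fin 3) :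
    fderiv ℝ (fun y => φ y i) x a = fderiv ℝ φ x a i := by
  have := ((coordL i).hasFDerivAt.comp x
    (hφ x).hasFDerivAt).fderiv
  have h2 : ((coordL i) ∘ φ) = fun y => φ y i := rfl
  rw [← h2, this]; rfl

theorem integrable_bilin_fderiv {C : Set E3} {φ : E3 → E3} (hφ : IsTestField C φ)
    {B : (E3 →L[ℝ] E3) → (E3 →L[ℝ] E3) → ℝ} (hB : IsBilinearMap ℝ B) (ν : Measure E3)
    [IsFiniteMeasureOnCompacts ν] :
    Integrable (fun x => B (fderiv ℝ φ x) (fderiv ℝ φ x)) ν :=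
  memLp_one_iff_integrable.1 (memLp_bilin (p := 2) (q := 2) hB.toContinuousBilinearMap
    (hφ.fderiv_memLp 2 ν) (hφ.fderiv_memLp 2 ν))

/-- The null-Lagrangian identity behind Korn's inequality. -/
theorem integral_transposeForm_fderiv {C : Set E3} {φ : E3 → E3} (hφ : IsTestField C φ) :
    ∫ x, transposeForm (fderiv ℝ φ x) (fderiv ℝ φ x) =
      ∫ x, divOf (fderiv ℝ φ x) * divOf (fderiv ℝ φ x) := by
  have hc : ∀ i, ContDiff ℝ (⊤ : ℕ∞) fun y => φ y i := fun i =>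
    (coordL i).contDiff.comp hφ.1
  have hs : ∀ i, HasCompactSupport fun y => φ y i := fun i =>
    hφ.2.1.comp_left (g := fun z : E3 => z i) rfl
  have key : ∀ i j k l, ∫ x, fderiv ℝ φ x (e k) i * fderiv ℝ φ x (e l) j =
      ∫ x, fderiv ℝ φ x (e l) i * fderiv ℝ φ x (e k) j := fun i j k l => by
    have := integral_fderiv_mul_fderiv_comm (hc i) (hc j) (hs i) (hs j) (e k) (e l)
    simpa only [fderiv_component hφ.differentiable] using this
  have hint : ∀ i j k l, Integrable fun x => fderiv ℝ φ x (e k) i * fderiv ℝ φ x (e l) j := by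
    intro i j k l
    have hcont : ∀ i k, Continuous fun x => fderiv ℝ φ x (e k) i := fun i k =>
      (coordL i).continuous.comp
        (hφ.continuous_fderiv.clm_apply continuous_const)
    refine Continuous.integrable_of_hasCompactSupport ((hcont i k).mul (hcont j l)) ?_
    exact (((hφ.2.1.fderiv_apply (𝕜 := ℝ) (e k)).comp_left (g := fun z : E3 => z i) rfl)).mul_right
  have e1 : ∀ x, transposeForm (fderiv ℝ φ x) (fderiv ℝ φ x) =
      ∑ i, ∑ j, fderiv ℝ φ x (e j) i * fderiv ℝ φ x (e i) j := fun x => transposeForm_self _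
  have e2 : ∀ x, divOf (fderiv ℝ φ x) * divOf (fderiv ℝ φ x) =
      ∑ i, ∑ j, fderiv ℝ φ x (e i) i * fderiv ℝ φ x (e j) j := fun x => by
    rw [divOf_eq]; simp [Fin.sum_univ_three]; ring
  simp_rw [e1, e2]
  rw [integral_finsetSum _ fun i _ => integrable_finsetSum _ fun j _ => hint i j j i,
    integral_finsetSum _ fun i _ => integrable_finsetSum _ fun j _ => hint i j i j]
  refine Finset.sum_congr rfl fun i _ => ?_
  rw [integral_finsetSum _ fun j _ => hint i j j i, integral_finsetSum _ fun j _ => hint i j i j]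
  exact Finset.sum_congr rfl fun j _ => key _ _ _ _

end Korn

/-! ### The space `W₀^{1,2}`: embedding, Poincaré and Korn. -/

section Sobolev

variable {C : Set E3} {v : E3 → E3} {Dv : E3 → E3 →L[ℝ] E3}

/-- In a bounded set, the approximating test fields of a function in `W₀^{1,2}` also converge in
`L⁴`, and the Sobolev inequality holds. -/
theorem IsSobolevZero.exists_approx (hC : Bornology.IsBounded C) (h : IsSobolevZero C v Dv) :
    MemLp v 4 (volume.restrict C) ∧ ∃ φ : ℕ → E3 → E3, (∀ n, IsTestField C (φ n)) ∧
      Tendsto (fun n => eLpNorm (fun x => φ n x - v x) 2 (volume.restrict C)) atTop (𝓝 0) ∧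
      Tendsto (fun n => eLpNorm (fun x => φ n x - v x) 4 (volume.restrict C)) atTop (𝓝 0) ∧
      Tendsto (fun n => eLpNorm (fun x => fderiv ℝ (φ n) x - Dv x) 2 (volume.restrict C))
        atTop (𝓝 0) := by
  obtain ⟨hv, hDv, φ, hφ, h2, hD⟩ := h
  obtain ⟨K, hK⟩ := sobolev_test hC (q := 4) (by norm_num)
  have hm : TendstoInMeasure (volume.restrict C) φ atTop v :=
    tendstoInMeasure_of_tendsto_eLpNorm (p := 2) (by simp)
      (fun n => (hφ n).contDiff.continuous.aestronglyMeasurable) hv.1 h2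
  obtain ⟨ns, hns, hae⟩ := hm.exists_seq_tendsto_ae
  have hbound : ∀ n, eLpNorm (fun x => φ n x - v x) 4 (volume.restrict C) ≤
      K * eLpNorm (fun x => fderiv ℝ (φ n) x - Dv x) 2 (volume.restrict C) := by
    intro n
    -- The Sobolev inequality is available for differences of test fields only. The limit `v` is
    -- reached along a subsequence converging almost everywhere, by Fatou's lemma.
    have hstep : ∀ m, eLpNorm (φ n - φ (ns m)) 4 (volume.restrict C) ≤
        K * (eLpNorm (fun x => fderiv ℝ (φ n) x - Dv x) 2 (volume.restrict C) +
          eLpNorm (fun x => fderiv ℝ (φ (ns m)) x - Dv x) 2 (volume.restrict C)) := by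
      intro m
      refine (hK _ ((hφ n).sub (hφ (ns m)))).trans ?_
      gcongr
      have e1 : fderiv ℝ (φ n - φ (ns m)) =
          (fun x => fderiv ℝ (φ n) x - Dv x) - fun x => fderiv ℝ (φ (ns m)) x - Dv x := by
        ext1 x
        rw [fderiv_sub ((hφ n).differentiable x) ((hφ (ns m)).differentiable x)]
        simp
      rw [e1]
      exact eLpNorm_sub_le (((hφ n).continuous_fderiv.aestronglyMeasurable).sub hDv.1)
        (((hφ (ns m)).continuous_fderiv.aestronglyMeasurable).sub hDv.1) (by norm_num)
    have hlim : Tendsto (fun m => (K : ℝ≥0∞) *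
        (eLpNorm (fun x => fderiv ℝ (φ n) x - Dv x) 2 (volume.restrict C) +
          eLpNorm (fun x => fderiv ℝ (φ (ns m)) x - Dv x) 2 (volume.restrict C))) atTop
        (𝓝 (K * (eLpNorm (fun x => fderiv ℝ (φ n) x - Dv x) 2 (volume.restrict C) + 0))) :=
      ENNReal.Tendsto.const_mul (tendsto_const_nhds.add (hD.comp hns.tendsto_atTop))
        (Or.inr ENNReal.coe_ne_top)
    rw [add_zero] at hlim
    have hl := Lp.eLpNorm_lim_le_liminf_eLpNorm (p := 4) (μ := volume.restrict C)
      (f := fun m => φ n - φ (ns m))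
      (fun m => ((hφ n).contDiff.continuous.sub
        (hφ (ns m)).contDiff.continuous).aestronglyMeasurable)
      (fun x => φ n x - v x) (by
        filter_upwards [hae] with x hx
        exact tendsto_const_nhds.sub hx)
    refine hl.trans ?_
    rw [← hlim.liminf_eq]
    exact liminf_le_liminf (Eventually.of_forall hstep)
  have h4 : Tendsto (fun n => eLpNorm (fun x => φ n x - v x) 4 (volume.restrict C)) atTop (𝓝 0) := by
    refine tendsto_of_tendsto_of_tendsto_of_le_of_le tendsto_const_nhds ?_ (fun _ => zero_le) hbound
    simpa using ENNReal.Tendsto.const_mul hD (Or.inr ENNReal.coe_ne_top) (a := (K : ℝ≥0∞))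
  refine ⟨?_, φ, hφ, h2, h4, hD⟩
  obtain ⟨n, hn⟩ := (h4.eventually (gt_mem_nhds (ENNReal.zero_lt_top))).exists
  have h5 : MemLp (fun x => φ n x - v x) 4 (volume.restrict C) :=
    ⟨((hφ n).contDiff.continuous.aestronglyMeasurable).sub hv.1, hn⟩
  have := ((hφ n).memLp 4 (volume.restrict C)).sub h5
  refine this.ae_eq (Eventually.of_forall fun x => ?_)
  simp

/-- A function in `W₀^{1,2}` of a bounded set with vanishing derivative vanishes. -/
theorem IsSobolevZero.eq_zero (hC : Bornology.IsBounded C) (h : IsSobolevZero C v Dv)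
    (h0 : Dv =ᵐ[volume.restrict C] 0) : v =ᵐ[volume.restrict C] 0 := by
  obtain ⟨hv, hDv, φ, hφ, h2, hD⟩ := h
  obtain ⟨K, hK⟩ := sobolev_test hC (q := 2) (by norm_num)
  have hD' : Tendsto (fun n => eLpNorm (fderiv ℝ (φ n)) 2 (volume.restrict C)) atTop (𝓝 0) := by
    refine hD.congr fun n => eLpNorm_congr_ae ?_
    filter_upwards [h0] with x hx
    simp [hx]
  have hφ0 : Tendsto (fun n => eLpNorm (φ n) 2 (volume.restrict C)) atTop (𝓝 0) := by
    refine tendsto_of_tendsto_of_tendsto_of_le_of_le tendsto_const_nhds ?_ (fun _ => zero_le)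
      (fun n => hK _ (hφ n))
    simpa using ENNReal.Tendsto.const_mul hD' (Or.inr ENNReal.coe_ne_top) (a := (K : ℝ≥0∞))
  have hle : ∀ n, eLpNorm v 2 (volume.restrict C) ≤ eLpNorm (φ n) 2 (volume.restrict C) +
      eLpNorm (fun x => φ n x - v x) 2 (volume.restrict C) := fun n => by
    have e1 : v = φ n - fun x => φ n x - v x := by ext1 x; simp
    conv_lhs => rw [e1]
    exact eLpNorm_sub_le (hφ n).contDiff.continuous.aestronglyMeasurable
      (((hφ n).contDiff.continuous.aestronglyMeasurable).sub hv.1) (by norm_num)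
  have hz : eLpNorm v 2 (volume.restrict C) ≤ 0 := by
    refine ge_of_tendsto' (by simpa using hφ0.add h2) hle
  exact (eLpNorm_eq_zero_iff hv.1 (by simp)).1 (le_antisymm hz zero_le)

/-- Korn's inequality for the viscous stress. -/
theorem IsSobolevZero.integral_stress_ge {μ lam : ℝ} (hμ : 0 < μ) (hlam : 0 ≤ lam)
    (h : IsSobolevZero C v Dv) :
    μ * ∫ x in C, frobForm (Dv x) (Dv x) ≤
      ∫ x in C, contract (stress μ lam (Dv x)) (gradMatrix (Dv x)) := by
  obtain ⟨hv, hDv, φ, hφ, h2, hD⟩ := h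
  have lim : ∀ {B : (E3 →L[ℝ] E3) → (E3 →L[ℝ] E3) → ℝ}, IsBilinearMap ℝ B →
      Tendsto (fun n => ∫ x in C, B (fderiv ℝ (φ n) x) (fderiv ℝ (φ n) x)) atTop
        (𝓝 (∫ x in C, B (Dv x) (Dv x))) := fun hB =>
    tendsto_integral_bilin (p := 2) (q := 2) hB.toContinuousBilinearMap
      (fun n => (hφ n).fderiv_memLp _ _) (fun n => (hφ n).fderiv_memLp _ _) hDv hDv hD hD
  -- Both sides are continuous along the approximating sequence, so test fields suffice; for them
  -- integration by parts is available.
  refine le_of_tendsto_of_tendsto' ((lim isBilinearMap_frobForm).const_mul μ)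
    (lim (isBilinearMap_stress μ lam)) fun n => ?_
  have hφn := hφ n
  have hrestr : ∀ {B : (E3 →L[ℝ] E3) → (E3 →L[ℝ] E3) → ℝ}, IsBilinearMap ℝ B →
      ∫ x in C, B (fderiv ℝ (φ n) x) (fderiv ℝ (φ n) x) =
        ∫ x, B (fderiv ℝ (φ n) x) (fderiv ℝ (φ n) x) := fun {B} hB => by
    refine setIntegral_eq_integral_of_forall_compl_eq_zero fun x hx => ?_
    rw [hφn.fderiv_eq_zero hx]
    exact hB.toLinearMap.map_zero₂ 0
  rw [hrestr isBilinearMap_frobForm, hrestr (isBilinearMap_stress μ lam)]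
  simp_rw [contract_stress_self]
  have i1 := integrable_bilin_fderiv hφn isBilinearMap_frobForm volume
  have i2 := integrable_bilin_fderiv hφn isBilinearMap_transposeForm volume
  have i3 := integrable_bilin_fderiv hφn isBilinearMap_divOf volume
  have i23 : Integrable (fun x => μ * transposeForm (fderiv ℝ (φ n) x) (fderiv ℝ (φ n) x) +
      (lam - 2 / 3 * μ) * (divOf (fderiv ℝ (φ n) x) * divOf (fderiv ℝ (φ n) x))) volume :=
    (i2.const_mul _).add (i3.const_mul _)
  rw [integral_add (i1.const_mul _) i23,
    integral_add (i2.const_mul _) (i3.const_mul _), integral_const_mul, integral_const_mul,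
    integral_const_mul, integral_transposeForm_fderiv hφn]
  -- Once the transposed term has become a squared divergence, the total coefficient of the latter
  -- is `μ + lam - 2μ/3 = lam + μ/3 ≥ 0`.
  have h0 : 0 ≤ ∫ x, divOf (fderiv ℝ (φ n) x) * divOf (fderiv ℝ (φ n) x) :=
    integral_nonneg fun x => mul_self_nonneg _
  nlinarith [mul_nonneg hμ.le h0, mul_nonneg hlam h0]

end Sobolev

end Pendulum

/-! ### Boundedness of the density where the fluid moves. -/

namespace Pendulum

open scoped ENNReal NNReal Convolution

/-- If `b(ρ) v` is integrable for every `b` of class `C¹`, however fast it grows, then `ρ` is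
essentially bounded where `v` does not vanish. -/
theorem exists_bound_of_integrable_smul {α : Type*} {m : MeasurableSpace α} {ν : Measure α}
    {ρ : α → ℝ} {v : α → E3} (hρ : AEStronglyMeasurable ρ ν)
    (h : ∀ b : ℝ → ℝ, ContDiff ℝ 1 b → Integrable (fun x => b (ρ x) • v x) ν) :
    ∃ K : ℝ, 0 < K ∧ ∀ᵐ x ∂ν, v x ≠ 0 → ρ x ≤ K := by
  -- Otherwise `t n`, the integral of `‖v‖` over `{ρ > n}`, is positive for every `n`. A function
  -- `b` with `b ≥ n / t n` on `(n, ∞)` for all `n` would make the integral of `‖b(ρ) v‖` at least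
  -- `n` for every `n`.
  by_contra! hcon
  have hv : Integrable v ν := by simpa using h (fun _ => 1) contDiff_const
  let s : ℕ → Set α := fun n => {x | (n : ℝ) < ρ x}
  have hs : ∀ n, NullMeasurableSet (s n) ν := fun n =>
    nullMeasurableSet_lt aemeasurable_const hρ.aemeasurable
  let t : ℕ → ℝ := fun n => ∫ x, (s n).indicator (fun x => ‖v x‖) x ∂ν
  have hint : ∀ n, Integrable ((s n).indicator fun x => ‖v x‖) ν := fun n =>
    hv.norm.indicator₀ (hs n)
  have h0 : ∀ n, 0 ≤ t n := fun n =>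
    integral_nonneg fun x => indicator_nonneg (fun _ _ => norm_nonneg _) x
  have ht : ∀ n, 0 < t n := by
    intro n
    refine lt_of_le_of_ne (h0 n) fun h0 => ?_
    have hz := (integral_eq_zero_iff_of_nonneg
      (fun x => indicator_nonneg (fun _ _ => norm_nonneg _) x) (hint n)).1 h0.symm
    refine hcon (n + 1) (by positivity) ?_
    filter_upwards [hz] with x hx hvx
    obtain ⟨hvx, hlt⟩ := hvx
    have hmem : x ∈ s n := show (n : ℝ) < ρ x by linarith
    rw [indicator_of_mem hmem] at hx
    exact hvx (by simpa using hx)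
  let H : ℕ → ℝ := fun N => ∑ n ∈ Finset.range (N + 1), n / t n
  have hHmono : Monotone H := fun a b hab =>
    Finset.sum_le_sum_of_subset_of_nonneg (Finset.range_mono (by omega)) fun i _ _ =>
      div_nonneg (Nat.cast_nonneg _) (ht i).le
  have hH : ∀ n : ℕ, (n : ℝ) / t n ≤ H n := fun n =>
    Finset.single_le_sum (f := fun n : ℕ => (n : ℝ) / t n)
      (fun i _ => div_nonneg (Nat.cast_nonneg _) (ht i).le) (by simp)
  -- A partition of unity gives a `C¹` function above the step function `z ↦ H ⌈z⌉₊`. Near `x` the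
  -- constant `H ⌈x + 1⌉₊` is large enough, because `H` was made monotone by summation.
  obtain ⟨b, hb⟩ := exists_contMDiffMap_forall_mem_convex_of_local_const
    (modelWithCornersSelf ℝ ℝ) (n := 1) (t := fun x : ℝ => Ici (H ⌈x⌉₊)) (fun x => convex_Ici _)
    (fun x => ⟨H ⌈x + 1⌉₊, by
      filter_upwards [gt_mem_nhds (show x < x + 1 by linarith)] with y hy
      exact hHmono (Nat.ceil_mono hy.le)⟩)
  have hbI := (h b (by simpa using b.contMDiff.contDiff)).norm
  obtain ⟨n, hn⟩ := exists_nat_gt (∫ x, ‖b (ρ x) • v x‖ ∂ν)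
  have hle : ∫ x, (n / t n) * (s n).indicator (fun x => ‖v x‖) x ∂ν ≤
      ∫ x, ‖b (ρ x) • v x‖ ∂ν := by
    refine integral_mono ((hint n).const_mul _) hbI fun x => ?_
    by_cases hx : x ∈ s n
    · simp only [indicator_of_mem hx, norm_smul]
      gcongr
      refine (hH n).trans (le_trans (hHmono ?_) ((hb (ρ x)).trans (le_abs_self _)))
      have : (n : ℝ) < ⌈ρ x⌉₊ := lt_of_lt_of_le hx (Nat.le_ceil _)
      exact_mod_cast this.le
    · simp only [indicator_of_notMem hx, mul_zero]; positivity
  rw [integral_const_mul, div_mul_cancel₀ _ (ht n).ne'] at hle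
  linarith

/-! ### Cut-off functions of the distance from the boundary. -/

section Cutoff

variable {C : Set E3}

theorem nonempty_compl_of_isBounded (hb : Bornology.IsBounded C) : Cᶜ.Nonempty := by
  by_contra h
  rw [not_nonempty_iff_eq_empty, compl_empty_iff] at h
  exact NormedSpace.unbounded_univ ℝ E3 (h ▸ hb)

theorem mem_of_infDist_pos {x : E3} (h : 0 < Metric.infDist x Cᶜ) : x ∈ C := by
  by_contra hx
  rw [Metric.infDist_zero_of_mem (show x ∈ Cᶜ from hx)] at h
  exact lt_irrefl _ h

theorem infDist_pos_of_mem (hC : IsOpen C) (hb : Bornology.IsBounded C) {x : E3} (h : x ∈ C) :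
    0 < Metric.infDist x Cᶜ :=
  (hC.isClosed_compl.notMem_iff_infDist_pos (nonempty_compl_of_isBounded hb)).1 (by simpa using h)

/-- The convolution averages translates that share the Lipschitz constant `K`. This is how the
cut-off inherits its gradient bound from the distance function. -/
theorem lipschitzWith_convolution_normed (ζ : ContDiffBump (0 : E3)) {g : E3 → ℝ} {K : ℝ≥0}
    (hg : LipschitzWith K g) :
    LipschitzWith K (ζ.normed volume ⋆[ContinuousLinearMap.lsmul ℝ ℝ, volume] g) := by
  refine LipschitzWith.of_dist_le_mul fun x y => ?_
  have hi : ∀ x, Integrable (fun t => ζ.normed volume t • g (x - t)) volume := fun x => by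
    refine Continuous.integrable_of_hasCompactSupport ?_ ζ.hasCompactSupport_normed.smul_right
    exact ζ.continuous_normed.smul (hg.continuous.comp (by fun_prop))
  have hi' : Integrable (fun t => ζ.normed volume t * (K * dist x y)) volume :=
    (ζ.integrable_normed).mul_const _
  simp only [convolution, ContinuousLinearMap.lsmul_apply]
  rw [dist_eq_norm, ← integral_sub (hi x) (hi y)]
  calc ‖∫ t, (ζ.normed volume t • g (x - t) - ζ.normed volume t • g (y - t))‖
      ≤ ∫ t, ζ.normed volume t * (K * dist x y) := by
        refine norm_integral_le_of_norm_le hi' (Eventually.of_forall fun t => ?_)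
        rw [← smul_sub, norm_smul, Real.norm_of_nonneg (ζ.nonneg_normed t), ← dist_eq_norm]
        gcongr
        · exact ζ.nonneg_normed t
        · simpa using hg.dist_le_mul (x - t) (y - t)
    _ = K * dist x y := by rw [integral_mul_const, ζ.integral_normed, one_mul]

/-- Cut-off functions adapted to the distance from the complement of a bounded open set. -/
theorem exists_cutoff (hb : Bornology.IsBounded C) {k : ℝ} (hk : 0 < k) :
    ∃ η : E3 → ℝ, ContDiff ℝ (⊤ : ℕ∞) η ∧ (∀ x, 0 ≤ η x) ∧ (∀ x, η x ≤ 1) ∧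
      HasCompactSupport η ∧ tsupport η ⊆ {x | 1 / (2 * k) ≤ Metric.infDist x Cᶜ} ∧
      (∀ x, 3 / k < Metric.infDist x Cᶜ → η x = 1) ∧ ∀ x, ‖fderiv ℝ η x‖ ≤ k := by
  let d : E3 → ℝ := fun x => Metric.infDist x Cᶜ
  have hd : LipschitzWith 1 d := Metric.lipschitz_infDist_pt _
  -- A ramp equal to 0 for `d ≤ 1/k` and to 1 for `d ≥ 2/k`. Mollifying with radius `1/(2k)`
  -- enlarges the transition to `1/(2k) ≤ d ≤ 5/(2k)`, still below `3/k`.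
  let g : E3 → ℝ := fun x => min 1 (max 0 (k * d x - 1))
  have hg : LipschitzWith ⟨k, hk.le⟩ g := by
    have h1 : LipschitzWith ⟨k, hk.le⟩ fun x => k * d x - 1 := by
      refine LipschitzWith.of_dist_le_mul fun x y => ?_
      have := hd.dist_le_mul x y
      rw [Real.dist_eq] at this ⊢
      rw [show k * d x - 1 - (k * d y - 1) = k * (d x - d y) by ring, abs_mul, abs_of_pos hk]
      simp only [NNReal.coe_one, one_mul] at this
      exact mul_le_mul_of_nonneg_left this hk.le
    exact (h1.const_max 0).const_min 1
  have hg0 : ∀ x, 0 ≤ g x := fun x => le_min zero_le_one (le_max_left _ _)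
  have hg1 : ∀ x, g x ≤ 1 := fun x => min_le_left _ _
  let ζ : ContDiffBump (0 : E3) := ⟨1 / (4 * k), 1 / (2 * k), by positivity, by
    rw [div_lt_div_iff₀ (by positivity) (by positivity)]; linarith⟩
  let η : E3 → ℝ := ζ.normed volume ⋆[ContinuousLinearMap.lsmul ℝ ℝ, volume] g
  have hηsmooth : ContDiff ℝ (⊤ : ℕ∞) η :=
    ζ.hasCompactSupport_normed.contDiff_convolution_left _ ζ.contDiff_normed
      hg.continuous.locallyIntegrable
  have hi : ∀ x, Integrable (fun t => ζ.normed volume t * g (x - t)) volume := fun x => by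
    refine Continuous.integrable_of_hasCompactSupport ?_ ζ.hasCompactSupport_normed.mul_right
    exact ζ.continuous_normed.mul (hg.continuous.comp (by fun_prop))
  have hηdef : ∀ x, η x = ∫ t, ζ.normed volume t * g (x - t) := fun x => rfl
  have hconst : ∀ (x : E3) (c : ℝ), (∀ y ∈ Metric.ball x (1 / (2 * k)), g y = c) → η x = c := by
    intro x c hc
    have : η x = g x := ζ.normed_convolution_eq_right fun y hy => by
      rw [hc y hy, hc x (Metric.mem_ball_self (by positivity))]
    rw [this, hc x (Metric.mem_ball_self (by positivity))]
  have hdy : ∀ x y : E3, y ∈ Metric.ball x (1 / (2 * k)) → |d y - d x| < 1 / (2 * k) := by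
    intro x y hy
    have := hd.dist_le_mul y x
    simp only [NNReal.coe_one, one_mul] at this
    rw [← Real.dist_eq]
    exact this.trans_lt hy
  have hsupp : Function.support η ⊆ {x | 1 / (2 * k) ≤ d x} := by
    intro x hx
    by_contra hlt
    replace hlt : d x < 1 / (2 * k) := not_le.1 fun h => hlt h
    refine hx (hconst x 0 fun y hy => ?_)
    have h1 := (abs_lt.1 (hdy x y hy)).2
    have h2 : d y < 1 / k := by
      have : 1 / k = 1 / (2 * k) + 1 / (2 * k) := by field_simp; norm_num
      linarith
    have h3 : k * d y < 1 := by rw [lt_div_iff₀ hk] at h2; linarith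
    simp only [g]
    rw [max_eq_left (by linarith), min_eq_right zero_le_one]
  have hclosed : IsClosed {x | 1 / (2 * k) ≤ d x} := isClosed_le continuous_const hd.continuous
  refine ⟨η, hηsmooth, ?_, ?_, ?_, closure_minimal hsupp hclosed, ?_, ?_⟩
  · intro x
    rw [hηdef]
    exact integral_nonneg fun t => mul_nonneg (ζ.nonneg_normed t) (hg0 _)
  · intro x
    rw [hηdef, ← ζ.integral_normed (μ := volume)]
    exact integral_mono (hi x) ζ.integrable_normed fun t =>
      mul_le_of_le_one_right (ζ.nonneg_normed t) (hg1 _)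
  · refine HasCompactSupport.of_support_subset_isCompact hb.isCompact_closure ?_
    refine fun x hx => subset_closure (mem_of_infDist_pos ?_)
    exact lt_of_lt_of_le (by positivity) (hsupp hx)
  · intro x hx
    refine hconst x 1 fun y hy => ?_
    have h1 := (abs_lt.1 (hdy x y hy)).1
    have h2 : 2 / k ≤ d y := by
      have : 3 / k = 2 / k + 1 / (2 * k) + 1 / (2 * k) := by field_simp; norm_num
      have h5 : 0 < 1 / (2 * k) := by positivity
      simp only [d] at *
      linarith
    have h3 : 2 ≤ k * d y := by rw [div_le_iff₀ hk] at h2; linarith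
    simp only [g]
    rw [min_eq_left (le_trans (by linarith) (le_max_right _ _))]
  · intro x
    exact norm_fderiv_le_of_lipschitz ℝ (lipschitzWith_convolution_normed ζ hg)

end Cutoff

end Pendulum

/-! ### A Hardy-type estimate near the boundary of a convex set. -/

namespace Pendulum

open scoped ENNReal NNReal

theorem eLpNorm_two_sq {α E : Type*} {m : MeasurableSpace α} [NormedAddCommGroup E] (f : α → E)
    (ν : Measure α) : eLpNorm f 2 ν ^ 2 = ∫⁻ x, ‖f x‖ₑ ^ 2 ∂ν := by
  have := eLpNorm_nnreal_pow_eq_lintegral (f := f) (μ := ν) (p := 2) (by norm_num)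
  simpa using this

theorem lintegral_enorm_sq_le {E : Type*} [NormedAddCommGroup E] {a b : ℝ} {f : ℝ → E}
    (hf : Continuous f) :
    (∫⁻ s in Ioc a b, ‖f s‖ₑ) ^ 2 ≤ ENNReal.ofReal (b - a) * ∫⁻ s in Ioc a b, ‖f s‖ₑ ^ 2 := by
  have h := eLpNorm_le_eLpNorm_mul_rpow_measure_univ (μ := volume.restrict (Ioc a b)) (f := f)
    (p := 1) (q := 2) (by norm_num) hf.aestronglyMeasurable
  rw [eLpNorm_one_eq_lintegral_enorm] at h
  calc (∫⁻ s in Ioc a b, ‖f s‖ₑ) ^ 2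
      ≤ (eLpNorm f 2 (volume.restrict (Ioc a b)) * (ENNReal.ofReal (b - a)) ^ (1 / 2 : ℝ)) ^ 2 := by
        gcongr
        refine h.trans (le_of_eq ?_)
        simp only [Measure.restrict_apply_univ, Real.volume_Ioc, ENNReal.toReal_one,
          ENNReal.toReal_ofNat]
        norm_num
    _ = _ := by
        rw [mul_pow, eLpNorm_two_sq, mul_comm, ← ENNReal.rpow_natCast, ← ENNReal.rpow_mul]
        norm_num

/-- The homothety has Jacobian `s³`, so the substitution produces the factor `s⁻³ ≤ 1`. -/
theorem lintegral_comp_homothety_le {g : E3 → ℝ≥0∞} (hg : Measurable g) (x₀ : E3) {s : ℝ}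
    (hs : 1 ≤ s) : ∫⁻ x, g (x₀ + s • (x - x₀)) ≤ ∫⁻ x, g x := by
  have h1 : ∫⁻ x, g (x₀ + s • (x - x₀)) = ∫⁻ x, g (x₀ + s • x) :=
    lintegral_sub_right_eq_self (μ := (volume : Measure E3)) (fun x => g (x₀ + s • x)) x₀
  have h2 : ∫⁻ x, g (x₀ + x) ∂(Measure.map (fun x : E3 => s • x) volume) =
      ∫⁻ x, g (x₀ + s • x) :=
    lintegral_map (f := fun x => g (x₀ + x)) (hg.comp (measurable_const_add x₀))
      (measurable_const_smul s)
  rw [h1, ← h2, Measure.map_addHaar_smul volume (by positivity), lintegral_smul_measure,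
    lintegral_add_left_eq_self]
  refine mul_le_of_le_one_left zero_le ?_
  rw [ENNReal.ofReal_le_one, abs_of_nonneg (by positivity)]
  exact inv_le_one_of_one_le₀ (one_le_pow₀ hs)

section Hardy

variable {C : Set E3} {v : E3 → E3} {Dv : E3 → E3 →L[ℝ] E3}

/-- The homothety by the factor `1 + ε` pushes the layer of depth `ε r / (1 + ε)` out of a convex set
containing the ball of radius `r` about the centre. -/
theorem homothety_notMem_of_infDist_lt (hconv : Convex ℝ C) (hb : Bornology.IsBounded C)
    {x₀ : E3} {r : ℝ} (hr : 0 < r) (hball : Metric.ball x₀ r ⊆ C) {ε : ℝ} (hε : 0 < ε) {x : E3}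
    (hx : Metric.infDist x Cᶜ < ε / (1 + ε) * r) : x₀ + (1 + ε) • (x - x₀) ∉ C := by
  intro hy
  refine not_le.2 hx ((Metric.le_infDist (nonempty_compl_of_isBounded hb)).2 fun z hz => ?_)
  by_contra! hlt
  refine hz ?_
  set y := x₀ + (1 + ε) • (x - x₀)
  have h1 : (0 : ℝ) < 1 + ε := by positivity
  -- If the dilated point `y` were in `C`, then `z ∉ C` would be the combination of this point of
  -- the ball and of `y` with weights `ε/(1+ε)` and `1/(1+ε)`, against convexity.
  have hw : x₀ + ((1 + ε) / ε) • (z - x) ∈ C := by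
    refine hball ?_
    rw [mem_ball_iff_norm, add_sub_cancel_left, norm_smul, Real.norm_of_nonneg (by positivity),
      ← dist_eq_norm, dist_comm]
    calc (1 + ε) / ε * dist x z < (1 + ε) / ε * (ε / (1 + ε) * r) := by gcongr
      _ = r := by field_simp
  have := hconv hw hy (a := ε / (1 + ε)) (b := 1 / (1 + ε)) (by positivity) (by positivity)
    (by field_simp; ring)
  convert this using 1
  simp only [y, smul_add, smul_smul, smul_sub]
  have e1 : ε / (1 + ε) * ((1 + ε) / ε) = 1 := by field_simp
  have e2 : 1 / (1 + ε) * (1 + ε) = 1 := by field_simp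
  rw [e1, e2]
  have e3 : x₀ = (ε / (1 + ε)) • x₀ + (1 / (1 + ε)) • x₀ := by
    rw [← add_smul, ← add_div, add_comm, div_self h1.ne', one_smul]
  rw [one_smul, one_smul, one_smul, show (ε / (1 + ε)) • x₀ + (z - x) + ((1 / (1 + ε)) • x₀ + (x - x₀)) =
    ((ε / (1 + ε)) • x₀ + (1 / (1 + ε)) • x₀) + z - x₀ by abel, ← e3]
  abel

/-- From a point `x` of the layer in `C`, the ray from `x₀` leaves `C` before the factor `1 + ε`,
where `φ` vanishes. Hence `φ(x)` is minus the integral of `∇φ · (x - x₀)` over `s ∈ (1, 1 + ε]`.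
Cauchy–Schwarz gives one factor `ε`, and Fubini with the homothety bound gives the other. -/
theorem hardy_test (hconv : Convex ℝ C) (hb : Bornology.IsBounded C)
    {x₀ : E3} {r : ℝ} (hr : 0 < r) (hball : Metric.ball x₀ r ⊆ C) {R : ℝ}
    (hR : ∀ x ∈ C, ‖x - x₀‖ ≤ R) {ε : ℝ} (hε : 0 < ε) {φ : E3 → E3} (hφ : IsTestField C φ) :
    eLpNorm φ 2 (volume.restrict {x | Metric.infDist x Cᶜ < ε / (1 + ε) * r}) ≤
      ENNReal.ofReal (ε * R) * eLpNorm (fderiv ℝ φ) 2 (volume.restrict C) := by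
  set N := {x | Metric.infDist x Cᶜ < ε / (1 + ε) * r}
  have hR0 : 0 ≤ R := (norm_nonneg _).trans (hR x₀ (hball (Metric.mem_ball_self hr)))
  have hD := hφ.continuous_fderiv
  have hpt : ∀ x ∈ N, ‖φ x‖ₑ ^ 2 ≤ ENNReal.ofReal (ε * R ^ 2) *
      ∫⁻ s in Ioc 1 (1 + ε), ‖fderiv ℝ φ (x₀ + s • (x - x₀))‖ₑ ^ 2 := by
    intro x hx
    by_cases hxC : x ∈ C
    swap
    · simp [hφ.eq_zero hxC]
    have hout := homothety_notMem_of_infDist_lt hconv hb hr hball hε hx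
    let f' : ℝ → E3 := fun s => fderiv ℝ φ (x₀ + s • (x - x₀)) (x - x₀)
    have hf'c : Continuous f' := (hD.comp (by fun_prop)).clm_apply continuous_const
    have hder : ∀ s : ℝ, HasDerivAt (fun s : ℝ => φ (x₀ + s • (x - x₀))) (f' s) s := by
      intro s
      have h1 : HasDerivAt (fun s : ℝ => x₀ + s • (x - x₀)) (x - x₀) s := by
        simpa using ((hasDerivAt_id s).smul_const (x - x₀)).const_add x₀
      exact (hφ.differentiable _).hasFDerivAt.comp_hasDerivAt s h1
    have hftc := intervalIntegral.integral_eq_sub_of_hasDerivAt (a := 1) (b := 1 + ε)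
      (fun s _ => hder s) (hf'c.intervalIntegrable _ _)
    rw [hφ.eq_zero hout, intervalIntegral.integral_of_le (by linarith)] at hftc
    simp only [one_smul, add_sub_cancel, zero_sub] at hftc
    have hle : ‖φ x‖ₑ ≤ ∫⁻ s in Ioc 1 (1 + ε), ‖f' s‖ₑ := by
      rw [← enorm_neg, ← hftc]
      exact enorm_integral_le_lintegral_enorm _
    calc ‖φ x‖ₑ ^ 2 ≤ (∫⁻ s in Ioc 1 (1 + ε), ‖f' s‖ₑ) ^ 2 := by gcongr
      _ ≤ ENNReal.ofReal (1 + ε - 1) * ∫⁻ s in Ioc 1 (1 + ε), ‖f' s‖ₑ ^ 2 :=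
        lintegral_enorm_sq_le hf'c
      _ ≤ ENNReal.ofReal ε * ∫⁻ s in Ioc 1 (1 + ε),
          ENNReal.ofReal (R ^ 2) * ‖fderiv ℝ φ (x₀ + s • (x - x₀))‖ₑ ^ 2 := by
        rw [add_sub_cancel_left]
        gcongr with s
        have h3 : ‖f' s‖ₑ ≤ ‖fderiv ℝ φ (x₀ + s • (x - x₀))‖ₑ * ENNReal.ofReal R := by
          refine (ContinuousLinearMap.le_opENorm _ _).trans ?_
          gcongr
          rw [← ofReal_norm]
          exact ENNReal.ofReal_le_ofReal (hR x hxC)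
        calc ‖f' s‖ₑ ^ 2 ≤ (‖fderiv ℝ φ (x₀ + s • (x - x₀))‖ₑ * ENNReal.ofReal R) ^ 2 := by gcongr
          _ = _ := by rw [mul_pow, mul_comm, ENNReal.ofReal_pow hR0]
      _ = _ := by
        rw [lintegral_const_mul' _ _ ENNReal.ofReal_ne_top, ← mul_assoc,
          ← ENNReal.ofReal_mul hε.le]
  have hN : MeasurableSet N :=
    measurableSet_lt (Metric.continuous_infDist_pt _).measurable measurable_const
  have hsq : eLpNorm φ 2 (volume.restrict N) ^ 2 ≤
      (ENNReal.ofReal (ε * R) * eLpNorm (fderiv ℝ φ) 2 (volume.restrict C)) ^ 2 := by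
    rw [mul_pow, eLpNorm_two_sq, ← ENNReal.ofReal_pow (by positivity),
      eLpNorm_restrict_eq_of_support_subset (f := fderiv ℝ φ) hφ.support_fderiv_subset,
      eLpNorm_two_sq]
    have hmeas : Measurable (Function.uncurry fun (x : E3) (s : ℝ) =>
        ‖fderiv ℝ φ (x₀ + s • (x - x₀))‖ₑ ^ 2) := by
      have : Continuous (Function.uncurry fun (x : E3) (s : ℝ) =>
        fderiv ℝ φ (x₀ + s • (x - x₀))) := hD.comp (by fun_prop)
      exact (this.measurable.enorm).pow_const 2
    calc ∫⁻ x in N, ‖φ x‖ₑ ^ 2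
        ≤ ∫⁻ x in N, ENNReal.ofReal (ε * R ^ 2) *
          ∫⁻ s in Ioc 1 (1 + ε), ‖fderiv ℝ φ (x₀ + s • (x - x₀))‖ₑ ^ 2 :=
          setLIntegral_mono' hN hpt
      _ ≤ ∫⁻ x, ENNReal.ofReal (ε * R ^ 2) *
          ∫⁻ s in Ioc 1 (1 + ε), ‖fderiv ℝ φ (x₀ + s • (x - x₀))‖ₑ ^ 2 :=
          setLIntegral_le_lintegral _ _
      _ = ENNReal.ofReal (ε * R ^ 2) *
          ∫⁻ s in Ioc 1 (1 + ε), ∫⁻ x, ‖fderiv ℝ φ (x₀ + s • (x - x₀))‖ₑ ^ 2 := by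
          rw [lintegral_const_mul' _ _ ENNReal.ofReal_ne_top,
            lintegral_lintegral_swap hmeas.aemeasurable]
      _ ≤ ENNReal.ofReal (ε * R ^ 2) *
          ∫⁻ _ in Ioc 1 (1 + ε), ∫⁻ x, ‖fderiv ℝ φ x‖ₑ ^ 2 := by
          gcongr 1
          refine setLIntegral_mono' measurableSet_Ioc fun s hs => ?_
          exact lintegral_comp_homothety_le (g := fun x => ‖fderiv ℝ φ x‖ₑ ^ 2)
            ((hD.measurable.enorm).pow_const 2) x₀ hs.1.le
      _ = ENNReal.ofReal ((ε * R) ^ 2) * ∫⁻ x, ‖fderiv ℝ φ x‖ₑ ^ 2 := by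
          rw [setLIntegral_const, Real.volume_Ioc, add_sub_cancel_left, mul_comm _ (ENNReal.ofReal ε),
            ← mul_assoc, ← ENNReal.ofReal_mul (by positivity)]
          congr 2; ring
  exact (ENNReal.pow_le_pow_left_iff two_ne_zero).1 hsq

/-- A function in `W₀^{1,2}` of a bounded convex open set is small near the boundary, relative to the
distance from the boundary. -/
theorem IsSobolevZero.tendsto_boundary_layer (hC : IsOpen C) (hconv : Convex ℝ C)
    (hne : C.Nonempty) (hb : Bornology.IsBounded C) (h : IsSobolevZero C v Dv) :
    Tendsto (fun k : ℕ => ((k : ℝ≥0∞) + 1) *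
      eLpNorm v 2 (volume.restrict (C ∩ {x | Metric.infDist x Cᶜ ≤ 3 / ((k : ℝ) + 1)})))
      atTop (𝓝 0) := by
  obtain ⟨x₀, hx₀⟩ := hne
  obtain ⟨r, hr, hball⟩ := Metric.isOpen_iff.1 hC x₀ hx₀
  obtain ⟨R, hR⟩ := hb.exists_norm_le
  have hR' : ∀ x ∈ C, ‖x - x₀‖ ≤ R + ‖x₀‖ := fun x hx =>
    (norm_sub_le _ _).trans (by gcongr; exact hR x hx)
  obtain ⟨hv, hDv, φ, hφ, h2, hD⟩ := h
  let N : ℕ → Set E3 := fun k => C ∩ {x | Metric.infDist x Cᶜ ≤ 3 / ((k : ℝ) + 1)}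
  have hR0 : 0 ≤ R + ‖x₀‖ := (norm_nonneg _).trans (hR' x₀ hx₀)
  let A : ℝ := 8 / r * (R + ‖x₀‖)
  have hA : 0 ≤ A := by positivity
  have hmono : ∀ k, volume.restrict (N k) ≤ (volume.restrict C : Measure E3) := fun k =>
    Measure.restrict_mono inter_subset_left le_rfl
  -- the estimate for test fields
  have htest : ∀ᶠ k : ℕ in atTop, ∀ ψ : E3 → E3, IsTestField C ψ →
      eLpNorm ψ 2 (volume.restrict (N k)) ≤
        ENNReal.ofReal (A / (k + 1)) * eLpNorm (fderiv ℝ ψ) 2 (volume.restrict C) := by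
    obtain ⟨k₀, hk₀⟩ := exists_nat_gt (8 / r)
    filter_upwards [eventually_ge_atTop k₀] with k hk ψ hψ
    have hk' : 8 / r < (k : ℝ) + 1 := by
      have : (k₀ : ℝ) ≤ k := by exact_mod_cast hk
      linarith
    have hk1 : (0 : ℝ) < (k : ℝ) + 1 := by positivity
    -- For `ε = 8 / (r (k+1)) < 1` the depth `ε r / (1 + ε)` is at least `ε r / 2 = 4/(k+1)`, which
    -- exceeds the required `3/(k+1)`.
    have hε : 0 < 8 / r / ((k : ℝ) + 1) := by positivity
    have hε1 : 8 / r / ((k : ℝ) + 1) < 1 := by rw [div_lt_one hk1]; exact hk'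
    have hsub : N k ⊆ {x | Metric.infDist x Cᶜ <
        (8 / r / ((k : ℝ) + 1)) / (1 + 8 / r / ((k : ℝ) + 1)) * r} := by
      rintro x ⟨-, hx⟩
      refine lt_of_le_of_lt (show _ ≤ 3 / ((k : ℝ) + 1) from hx) ?_
      have e1 : 4 / ((k : ℝ) + 1) = (8 / r / ((k : ℝ) + 1)) / 2 * r := by field_simp; norm_num
      calc 3 / ((k : ℝ) + 1) < 4 / ((k : ℝ) + 1) := by gcongr; norm_num
        _ ≤ _ := by rw [e1]; gcongr; linarith
    refine (eLpNorm_mono_measure ψ (Measure.restrict_mono hsub le_rfl)).trans ?_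
    refine (hardy_test hconv hb hr hball hR' hε hψ).trans (le_of_eq ?_)
    congr 2
    simp only [A]; ring
  have hbound : ∀ᶠ k : ℕ in atTop, ∀ n, eLpNorm (fun x => v x - φ n x) 2 (volume.restrict (N k)) ≤
      ENNReal.ofReal (A / (k + 1)) *
        eLpNorm (fun x => fderiv ℝ (φ n) x - Dv x) 2 (volume.restrict C) := by
    filter_upwards [htest] with k hk n
    -- The layer estimate is applied to the test field `φ m - φ n`; letting `m → ∞` extends it to `v
    -- - φ n`.
    have hstep : ∀ m, eLpNorm (fun x => v x - φ n x) 2 (volume.restrict (N k)) ≤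
        eLpNorm (fun x => φ m x - v x) 2 (volume.restrict C) + ENNReal.ofReal (A / (k + 1)) *
        (eLpNorm (fun x => fderiv ℝ (φ m) x - Dv x) 2 (volume.restrict C) +
          eLpNorm (fun x => fderiv ℝ (φ n) x - Dv x) 2 (volume.restrict C)) := by
      intro m
      have e1 : (fun x => v x - φ n x) = (φ m - φ n) - fun x => φ m x - v x := by
        ext1 x; simp
      have hvk : AEStronglyMeasurable v (volume.restrict (N k)) := hv.1.mono_measure (hmono k)
      have hc : ∀ j, Continuous (φ j) := fun j => (hφ j).contDiff.continuous
      rw [e1]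
      refine (eLpNorm_sub_le ((hc m).sub (hc n)).aestronglyMeasurable
        ((hc m).aestronglyMeasurable.sub hvk) (by norm_num)).trans ?_
      rw [add_comm]
      refine add_le_add (eLpNorm_mono_measure _ (hmono k))
        ((hk _ ((hφ m).sub (hφ n))).trans ?_)
      gcongr
      have e2 : fderiv ℝ (φ m - φ n) =
          (fun x => fderiv ℝ (φ m) x - Dv x) - fun x => fderiv ℝ (φ n) x - Dv x := by
        ext1 x
        rw [fderiv_sub ((hφ m).differentiable x) ((hφ n).differentiable x)]
        simp
      rw [e2]
      exact eLpNorm_sub_le (((hφ m).continuous_fderiv.aestronglyMeasurable).sub hDv.1)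
        (((hφ n).continuous_fderiv.aestronglyMeasurable).sub hDv.1) (by norm_num)
    have hlim := h2.add (ENNReal.Tendsto.const_mul
      (hD.add (tendsto_const_nhds (x :=
        eLpNorm (fun x => fderiv ℝ (φ n) x - Dv x) 2 (volume.restrict C))))
      (Or.inr (ENNReal.ofReal_ne_top (r := A / (k + 1)))))
    rw [zero_add, zero_add] at hlim
    exact ge_of_tendsto' hlim hstep
  -- One test field `φ n`, close to `v` in gradient norm, is fixed. It vanishes in all thin layers,
  -- so only `v - φ n` contributes there.
  rw [ENNReal.tendsto_nhds_zero]
  intro δ hδ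
  have hA' : Tendsto (fun n => ENNReal.ofReal A *
      eLpNorm (fun x => fderiv ℝ (φ n) x - Dv x) 2 (volume.restrict C)) atTop (𝓝 0) := by
    simpa using ENNReal.Tendsto.const_mul hD (Or.inr (ENNReal.ofReal_ne_top (r := A)))
  obtain ⟨n, hn⟩ := (ENNReal.tendsto_nhds_zero.1 hA' δ hδ).exists
  -- near the boundary the test field vanishes
  obtain ⟨d, hd, hdC⟩ := (hφ n).2.1.exists_cthickening_subset_open hC (hφ n).2.2
  have hvanish : ∀ᶠ k : ℕ in atTop, ∀ x ∈ N k, φ n x = 0 := by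
    obtain ⟨k₀, hk₀⟩ := exists_nat_gt (3 / d)
    filter_upwards [eventually_ge_atTop k₀] with k hk x hx
    by_contra h0
    have hk1 : (0 : ℝ) < (k : ℝ) + 1 := by positivity
    have hlt : Metric.infDist x Cᶜ < d := by
      refine lt_of_le_of_lt hx.2 ?_
      rw [div_lt_iff₀ hd] at hk₀
      rw [div_lt_iff₀ hk1]
      have : (k₀ : ℝ) ≤ k := by exact_mod_cast hk
      nlinarith
    obtain ⟨y, hy, hxy⟩ := (Metric.infDist_lt_iff (nonempty_compl_of_isBounded hb)).1 hlt
    refine hy (hdC ?_)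
    rw [dist_comm] at hxy
    exact Metric.mem_cthickening_of_dist_le y x d _ (subset_tsupport _ h0) hxy.le
  filter_upwards [hbound, hvanish] with k hk hk0
  have hN : MeasurableSet (N k) := hC.measurableSet.inter
    (measurableSet_le (Metric.continuous_infDist_pt _).measurable measurable_const)
  have e1 : eLpNorm v 2 (volume.restrict (N k)) =
      eLpNorm (fun x => v x - φ n x) 2 (volume.restrict (N k)) := by
    refine eLpNorm_congr_ae ?_
    filter_upwards [ae_restrict_mem hN] with x hx
    simp [hk0 x hx]
  calc ((k : ℝ≥0∞) + 1) * eLpNorm v 2 (volume.restrict (N k))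
      ≤ ((k : ℝ≥0∞) + 1) * (ENNReal.ofReal (A / (k + 1)) *
        eLpNorm (fun x => fderiv ℝ (φ n) x - Dv x) 2 (volume.restrict C)) := by
        rw [e1]; gcongr; exact hk n
    _ = ENNReal.ofReal A *
        eLpNorm (fun x => fderiv ℝ (φ n) x - Dv x) 2 (volume.restrict C) := by
        have e2 : ((k : ℝ≥0∞) + 1) = ENNReal.ofReal ((k : ℝ) + 1) := by
          rw [ENNReal.ofReal_add (by positivity) zero_le_one]; simp
        rw [← mul_assoc, e2, ← ENNReal.ofReal_mul (by positivity)]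
        congr 2
        field_simp
    _ ≤ δ := hn

end Hardy

end Pendulum

namespace Pendulum

open scoped ENNReal NNReal Convolution

/-! ### The regularized gradient of the Newtonian potential. -/

section Kernel

/-- The regularized gradient kernel `x (|x|² + δ²)^{-3/2}`. -/
noncomputable def kern (δ : ℝ) (x : E3) : E3 := (‖x‖ ^ 2 + δ ^ 2) ^ (-(3 / 2) : ℝ) • x

/-- The derivative of the regularized gradient kernel. -/
noncomputable def kernDeriv (δ : ℝ) (x : E3) : E3 →L[ℝ] E3 :=
  (‖x‖ ^ 2 + δ ^ 2) ^ (-(3 / 2) : ℝ) • ContinuousLinearMap.id ℝ E3 +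
    ((-3 * (‖x‖ ^ 2 + δ ^ 2) ^ (-(5 / 2) : ℝ)) • innerSL ℝ x).smulRight x

variable {δ : ℝ}

theorem normSq_add_pos (hδ : 0 < δ) (x : E3) : 0 < ‖x‖ ^ 2 + δ ^ 2 := by positivity

theorem hasFDerivAt_kern (hδ : 0 < δ) (x : E3) : HasFDerivAt (kern δ) (kernDeriv δ x) x := by
  have h1 : HasFDerivAt (fun x : E3 => ‖x‖ ^ 2 + δ ^ 2) (2 • innerSL ℝ x) x :=
    ((hasStrictFDerivAt_norm_sq x).hasFDerivAt).add_const _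
  have h2 := h1.rpow_const (p := (-(3 / 2) : ℝ)) (Or.inl (normSq_add_pos hδ x).ne')
  have h3 := h2.smul (hasFDerivAt_id x)
  refine HasFDerivAt.congr_fderiv (show HasFDerivAt (kern δ) _ x from h3) ?_
  have e1 : (-(3 / 2) : ℝ) - 1 = -(5 / 2) := by norm_num
  rw [kernDeriv, e1]
  ext h i
  simp
  ring_nf
  exact Or.inl trivial

theorem contDiff_kern (hδ : 0 < δ) {n : WithTop ℕ∞} : ContDiff ℝ n (kern δ) := by
  have h : ContDiff ℝ n fun x : E3 => (‖x‖ ^ 2 + δ ^ 2) ^ (-(3 / 2) : ℝ) :=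
    ((contDiff_norm_sq ℝ (E := E3)).add contDiff_const).rpow_const_of_ne
      fun x => (normSq_add_pos hδ x).ne'
  exact h.smul contDiff_id

theorem continuous_kernDeriv (hδ : 0 < δ) : Continuous (kernDeriv δ) := by
  have h : kernDeriv δ = fderiv ℝ (kern δ) := by
    ext1 x; exact (hasFDerivAt_kern hδ x).fderiv.symm
  rw [h]
  exact (contDiff_kern hδ (n := 1)).continuous_fderiv (by simp)

/-- A crude bound degenerating as `δ → 0`; it only serves to differentiate under the integral sign.
-/
theorem norm_kernDeriv_le (hδ : 0 < δ) (x : E3) : ‖kernDeriv δ x‖ ≤ 4 * (δ ^ 2) ^ (-(3 / 2) : ℝ) := by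
  have hs := normSq_add_pos hδ x
  set s := ‖x‖ ^ 2 + δ ^ 2
  have h1 : s ^ (-(3 / 2) : ℝ) ≤ (δ ^ 2) ^ (-(3 / 2) : ℝ) :=
    Real.rpow_le_rpow_of_nonpos (by positivity) (by simp only [s]; nlinarith [sq_nonneg ‖x‖])
      (by norm_num)
  have h2 : s ^ (-(5 / 2) : ℝ) * ‖x‖ ^ 2 ≤ s ^ (-(3 / 2) : ℝ) := by
    have : s ^ (-(3 / 2) : ℝ) = s ^ (-(5 / 2) : ℝ) * s := by
      rw [← Real.rpow_add_one hs.ne']; norm_num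
    rw [this]
    gcongr
    simp only [s]; nlinarith [sq_nonneg δ]
  have h3 : ‖s ^ (-(3 / 2) : ℝ) • ContinuousLinearMap.id ℝ E3‖ ≤ s ^ (-(3 / 2) : ℝ) := by
    rw [norm_smul, Real.norm_of_nonneg (by positivity)]
    exact mul_le_of_le_one_right (by positivity) ContinuousLinearMap.norm_id_le
  have h4 : ‖((-3 * s ^ (-(5 / 2) : ℝ)) • innerSL ℝ x).smulRight x‖ ≤
      3 * (s ^ (-(5 / 2) : ℝ) * ‖x‖ ^ 2) := by
    rw [ContinuousLinearMap.norm_smulRight_apply, norm_smul, innerSL_apply_norm, norm_mul,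
      Real.norm_of_nonneg (show 0 ≤ s ^ (-(5 / 2) : ℝ) by positivity)]
    norm_num
    apply le_of_eq; ring
  calc ‖kernDeriv δ x‖ ≤ s ^ (-(3 / 2) : ℝ) + 3 * (s ^ (-(5 / 2) : ℝ) * ‖x‖ ^ 2) :=
        (norm_add_le _ _).trans (add_le_add h3 h4)
    _ ≤ _ := by linarith

/-- This bound is uniform in `δ`, and so survives the limit `δ → 0`. -/
theorem norm_kern_le (x : E3) {r : ℝ} (hr : 0 < r) (hx : r ≤ ‖x‖) :
    ‖kern δ x‖ ≤ 1 / r ^ 2 := by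
  have hx0 : 0 < ‖x‖ := hr.trans_le hx
  have h1 : (‖x‖ ^ 2 + δ ^ 2) ^ (-(3 / 2) : ℝ) ≤ (‖x‖ ^ 2) ^ (-(3 / 2) : ℝ) :=
    Real.rpow_le_rpow_of_nonpos (by positivity) (by nlinarith [sq_nonneg δ]) (by norm_num)
  have h2 : (‖x‖ ^ 2) ^ (-(3 / 2) : ℝ) = (‖x‖ ^ 3)⁻¹ := by
    rw [← Real.rpow_natCast, ← Real.rpow_mul hx0.le, ← Real.rpow_natCast, ← Real.rpow_neg hx0.le]
    norm_num
  rw [kern, norm_smul, Real.norm_of_nonneg (by positivity)]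
  calc _ ≤ (‖x‖ ^ 3)⁻¹ * ‖x‖ := by rw [← h2]; gcongr
    _ = 1 / ‖x‖ ^ 2 := by field_simp
    _ ≤ 1 / r ^ 2 := by gcongr

/-- The kernel is the gradient of `-(|x|² + δ²)^(-1/2)`, so its derivative is a Hessian. -/
theorem kernDeriv_symm (x : E3) (i j : Fin 3) : kernDeriv δ x (e j) i = kernDeriv δ x (e i) j := by
  fin_cases i <;> fin_cases j <;> simp [kernDeriv, e, EuclideanSpace.inner_single_right] <;> ring

/-- The right-hand side is `δ⁻³ Φ(x/δ)` with `Φ(z) = 3 (1 + |z|²)^(-5/2)`: an approximate identity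
up to a constant factor. -/
theorem divOf_kernDeriv (hδ : 0 < δ) (x : E3) :
    divOf (kernDeriv δ x) = 3 * δ ^ 2 * (‖x‖ ^ 2 + δ ^ 2) ^ (-(5 / 2) : ℝ) := by
  have hs := normSq_add_pos hδ x
  have h1 : (‖x‖ ^ 2 + δ ^ 2) ^ (-(3 / 2) : ℝ) =
      (‖x‖ ^ 2 + δ ^ 2) ^ (-(5 / 2) : ℝ) * (‖x‖ ^ 2 + δ ^ 2) := by
    rw [← Real.rpow_add_one hs.ne']; norm_num
  have h2 : ‖x‖ ^ 2 = x 0 ^ 2 + x 1 ^ 2 + x 2 ^ 2 := by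
    rw [EuclideanSpace.norm_sq_eq]; simp [Fin.sum_univ_three]
  have h3 : divOf (kernDeriv δ x) = 3 * (‖x‖ ^ 2 + δ ^ 2) ^ (-(3 / 2) : ℝ) -
      3 * (‖x‖ ^ 2 + δ ^ 2) ^ (-(5 / 2) : ℝ) * (x 0 ^ 2 + x 1 ^ 2 + x 2 ^ 2) := by
    rw [divOf_eq]
    simp [kernDeriv, e, EuclideanSpace.inner_single_right]
    ring
  rw [h3, h1, ← h2]; ring

/-- The regularized gradient of the Newtonian potential of `f`. -/
noncomputable def potGrad (δ : ℝ) (f : E3 → ℝ) (x : E3) : E3 := ∫ y, f y • kern δ (x - y)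

variable {f : E3 → ℝ}

theorem contDiff_potGrad (hδ : 0 < δ) (hf : ContDiff ℝ (⊤ : ℕ∞) f) (hfc : HasCompactSupport f) :
    ContDiff ℝ (⊤ : ℕ∞) (potGrad δ f) :=
  hfc.contDiff_convolution_left (ContinuousLinearMap.lsmul ℝ ℝ) hf
    (contDiff_kern hδ (n := 0)).continuous.locallyIntegrable

theorem integrable_smul_kernDeriv (hδ : 0 < δ) (hf : Continuous f) (hfc : HasCompactSupport f)
    (x : E3) : Integrable (fun y => f y • kernDeriv δ (x - y)) volume := by
  have h : Continuous fun y => kernDeriv δ (x - y) :=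
    (continuous_kernDeriv hδ).comp (continuous_const.sub continuous_id)
  have hs : HasCompactSupport fun y => f y • kernDeriv δ (x - y) :=
    HasCompactSupport.intro hfc fun y hy => by
      rw [image_eq_zero_of_notMem_tsupport hy]; 
      exact zero_smul ℝ (kernDeriv δ (x - y))
  exact (hf.smul h).integrable_of_hasCompactSupport hs

theorem hasFDerivAt_potGrad (hδ : 0 < δ) (hf : Continuous f) (hfc : HasCompactSupport f) (x : E3) :
    HasFDerivAt (potGrad δ f) (∫ y, f y • kernDeriv δ (x - y)) x := by
  have hc : ∀ x : E3, Continuous fun y => f y • kern δ (x - y) := fun x =>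
    hf.smul ((contDiff_kern hδ (n := 0)).continuous.comp (by fun_prop))
  refine hasFDerivAt_integral_of_dominated_of_fderiv_le (𝕜 := ℝ)
    (F := fun x y => f y • kern δ (x - y)) (F' := fun x y => f y • kernDeriv δ (x - y))
    (bound := fun y => |f y| * (4 * (δ ^ 2) ^ (-(3 / 2) : ℝ))) (s := univ) univ_mem
    (Eventually.of_forall fun x => (hc x).aestronglyMeasurable)
    ((hc x).integrable_of_hasCompactSupport hfc.smul_right)
    (integrable_smul_kernDeriv hδ hf hfc x).1 ?_ ?_ ?_
  · refine Eventually.of_forall fun y z _ => ?_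
    rw [norm_smul, Real.norm_eq_abs]
    gcongr
    exact norm_kernDeriv_le hδ _
  · exact ((hf.integrable_of_hasCompactSupport hfc).abs).mul_const _
  · refine Eventually.of_forall fun y z _ => ?_
    have := (hasFDerivAt_kern hδ (z - y)).comp z ((hasFDerivAt_id z).sub_const y)
    simpa using! this.const_smul (f y)

theorem fderiv_potGrad_symm (hδ : 0 < δ) (hf : Continuous f) (hfc : HasCompactSupport f) (x : E3)
    (i j : Fin 3) : fderiv ℝ (potGrad δ f) x (e j) i = fderiv ℝ (potGrad δ f) x (e i) j := by
  have hint := integrable_smul_kernDeriv hδ hf hfc x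
  rw [(hasFDerivAt_potGrad hδ hf hfc x).fderiv]
  have key : ∀ i j, (∫ y, f y • kernDeriv δ (x - y)) (e j) i =
      ∫ y, f y * kernDeriv δ (x - y) (e j) i := fun i j => by
    have := ((coordL i).comp (ContinuousLinearMap.apply ℝ E3 (e j))).integral_comp_comm hint
    simpa using! this.symm
  rw [key, key]
  simp_rw [kernDeriv_symm]

theorem divOf_fderiv_potGrad (hδ : 0 < δ) (hf : Continuous f) (hfc : HasCompactSupport f) (x : E3) :
    divOf (fderiv ℝ (potGrad δ f) x) =
      ∫ z, f (x - δ • z) * (3 * (1 + ‖z‖ ^ 2) ^ (-(5 : ℝ) / 2)) := by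
  have hint := integrable_smul_kernDeriv hδ hf hfc x
  rw [(hasFDerivAt_potGrad hδ hf hfc x).fderiv, ← divL_apply, ← divL.integral_comp_comm hint]
  simp only [map_smul, divL_apply, divOf_kernDeriv hδ, smul_eq_mul]
  rw [← integral_sub_left_eq_self _ volume x]
  simp only [sub_sub_cancel]
  have h := Measure.integral_comp_smul (volume : Measure E3)
    (fun u : E3 => f (x - u) * (3 * δ ^ 2 * (‖u‖ ^ 2 + δ ^ 2) ^ (-(5 / 2) : ℝ))) δ
  rw [finrank_euclideanSpace, Fintype.card_fin, abs_of_pos (by positivity), smul_eq_mul] at h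
  have h3 : δ ^ 3 * (δ ^ 3)⁻¹ = 1 := mul_inv_cancel₀ (by positivity)
  rw [← one_mul (∫ u, f (x - u) * (3 * δ ^ 2 * (‖u‖ ^ 2 + δ ^ 2) ^ (-(5 / 2) : ℝ))), ← h3,
    mul_assoc, ← h, ← integral_const_mul]
  refine integral_congr_ae (Eventually.of_forall fun z => ?_)
  have e1 : ‖δ • z‖ ^ 2 + δ ^ 2 = δ ^ 2 * (1 + ‖z‖ ^ 2) := by
    rw [norm_smul, Real.norm_of_nonneg hδ.le]; ring
  have e2 : (δ ^ 2) ^ (-(5 / 2) : ℝ) = (δ ^ 5)⁻¹ := by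
    rw [← Real.rpow_natCast, ← Real.rpow_mul hδ.le, ← Real.rpow_natCast, ← Real.rpow_neg hδ.le]
    norm_num
  simp only [e1]
  rw [Real.mul_rpow (by positivity) (by positivity), e2, neg_div]
  field_simp

end Kernel

end Pendulum

/-! ### Square integrability by duality. -/

namespace Pendulum

open scoped ENNReal NNReal ContDiff

/-- An integrable function that is bounded in the `L²` norm against test functions is square
integrable. -/
theorem memLp_two_of_integral_le {U : Set E3} (hU : IsOpen U) {p : E3 → ℝ} (hp : IntegrableOn p U)
    {B : ℝ} (hB : ∀ f : E3 → ℝ, ContDiff ℝ ∞ f → HasCompactSupport f → tsupport f ⊆ U →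
      |∫ x in U, p x * f x| ≤ B * (eLpNorm f 2 (volume.restrict U)).toReal) :
    MemLp p 2 (volume.restrict U) := by
  let ν : Measure E3 := volume.restrict U
  let IsT : (E3 → ℝ) → Prop := fun f => ContDiff ℝ ∞ f ∧ HasCompactSupport f ∧ tsupport f ⊆ U
  have hpint : ∀ f, IsT f → Integrable (fun x => p x * f x) ν := fun f hf => by
    obtain ⟨M, hM⟩ := hf.1.continuous.bounded_above_of_compact_support hf.2.1
    exact hp.mul_bdd hf.1.continuous.aestronglyMeasurable (Eventually.of_forall hM)
  let V : Submodule ℝ (Lp ℝ 2 ν) :=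
    { carrier := {g | ∃ f, IsT f ∧ g =ᵐ[ν] f}
      add_mem' := by
        rintro g g' ⟨f, hf, hg⟩ ⟨f', hf', hg'⟩
        refine ⟨f + f', ⟨hf.1.add hf'.1, hf.2.1.add hf'.2.1,
          (tsupport_add f f').trans (union_subset hf.2.2 hf'.2.2)⟩, ?_⟩
        filter_upwards [Lp.coeFn_add g g', hg, hg'] with x h1 h2 h3
        rw [h1]; simp [h2, h3]
      zero_mem' := ⟨0, ⟨contDiff_const, HasCompactSupport.zero, by simp⟩, Lp.coeFn_zero ..⟩
      smul_mem' := by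
        rintro c g ⟨f, hf, hg⟩
        refine ⟨c • f, ⟨contDiff_const.smul hf.1, hf.2.1.smul_left (f := fun _ => c),
          (tsupport_smul_subset_right (fun _ => c) f).trans hf.2.2⟩, ?_⟩
        filter_upwards [Lp.coeFn_smul c g, hg] with x h1 h2
        rw [h1]; simp [h2] }
  have hVint : ∀ g : V, Integrable (fun x => p x * (g : Lp ℝ 2 ν) x) ν := fun g => by
    obtain ⟨f, hf, hg⟩ := g.2
    refine (hpint f hf).congr ?_
    filter_upwards [hg] with x hx
    rw [hx]
  let ℓ₀ : V →ₗ[ℝ] ℝ :=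
    { toFun := fun g => ∫ x, p x * (g : Lp ℝ 2 ν) x ∂ν
      map_add' := fun g g' => by
        rw [← integral_add (hVint g) (hVint g')]
        refine integral_congr_ae ?_
        filter_upwards [Lp.coeFn_add (g : Lp ℝ 2 ν) g'] with x hx
        simp only [Submodule.coe_add, hx, Pi.add_apply]; ring
      map_smul' := fun c g => by
        rw [RingHom.id_apply, smul_eq_mul, ← integral_const_mul]
        refine integral_congr_ae ?_
        filter_upwards [Lp.coeFn_smul c (g : Lp ℝ 2 ν)] with x hx
        simp only [Submodule.coe_smul, hx, Pi.smul_apply, smul_eq_mul]; ring }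
  have hℓ₀ : ∀ g : V, ‖ℓ₀ g‖ ≤ B * ‖g‖ := fun g => by
    obtain ⟨f, hf, hg⟩ := g.2
    have e1 : ℓ₀ g = ∫ x in U, p x * f x := by
      refine integral_congr_ae ?_
      filter_upwards [hg] with x hx
      rw [hx]
    have e2 : ‖g‖ = (eLpNorm f 2 ν).toReal := by
      rw [Submodule.coe_norm, Lp.norm_def, eLpNorm_congr_ae hg]
    rw [e1, e2]
    exact hB f hf.1 hf.2.1 hf.2.2
  -- The pairing with `p` depends only on the `L²` class of the test function. It extends by
  -- Hahn–Banach and is represented by some `r` in `L²` by Riesz. As `p - r` annihilates all test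
  -- functions, it vanishes almost everywhere in `U`.
  obtain ⟨ℓ, hℓ, -⟩ := exists_extension_norm_eq V (ℓ₀.mkContinuous B hℓ₀)
  let r : Lp ℝ 2 ν := (InnerProductSpace.toDual ℝ (Lp ℝ 2 ν)).symm ℓ
  have hr : ∀ f, IsT f → ∫ x in U, p x * f x = ∫ x in U, r x * f x := by
    intro f hf
    have hfL : MemLp f 2 ν := hf.1.continuous.memLp_of_hasCompactSupport hf.2.1
    have hmem : hfL.toLp f ∈ V := ⟨f, hf, hfL.coeFn_toLp⟩
    have h1 : ℓ (hfL.toLp f) = ∫ x in U, p x * f x := by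
      have := hℓ ⟨_, hmem⟩
      rw [this]
      refine integral_congr_ae ?_
      filter_upwards [hfL.coeFn_toLp] with x hx
      simp only [hx]
    have h2 : ℓ (hfL.toLp f) = ∫ x in U, r x * f x := by
      rw [← InnerProductSpace.toDual_symm_apply, L2.inner_def]
      refine integral_congr_ae ?_
      filter_upwards [hfL.coeFn_toLp] with x hx
      rw [hx]; simp [r, mul_comm]
    rw [← h1, h2]
  have hrint : LocallyIntegrableOn r U volume := by
    rw [locallyIntegrableOn_iff hU.isLocallyClosed]
    intro K hK hKc
    have h1 : MemLp r 2 (volume.restrict K) :=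
      (Lp.memLp r).mono_measure (Measure.restrict_mono hK le_rfl)
    have : IsFiniteMeasure (volume.restrict K : Measure E3) :=
      ⟨by simpa using hKc.measure_lt_top⟩
    exact h1.integrable (by norm_num)
  have hae : ∀ᵐ x ∂(volume : Measure E3), x ∈ U → p x - r x = 0 := by
    refine hU.ae_eq_zero_of_integral_contDiff_smul_eq_zero
      ((hp.locallyIntegrableOn).sub hrint) fun g hg hgc hgU => ?_
    have hT : IsT g := ⟨hg, hgc, hgU⟩
    have hgL : MemLp g 2 ν := hg.continuous.memLp_of_hasCompactSupport hgc
    have hri : Integrable (fun x => r x * g x) ν := by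
      simpa using! (Lp.memLp r).integrable_mul hgL
    have e1 : ∫ x, g x • (p x - r x) = ∫ x in U, (p x * g x - r x * g x) := by
      rw [← setIntegral_eq_integral_of_forall_compl_eq_zero (s := U)]
      · refine integral_congr_ae (Eventually.of_forall fun x => ?_)
        simp only [smul_eq_mul]; ring
      · intro x hx
        rw [image_eq_zero_of_notMem_tsupport fun h => hx (hgU h), zero_smul]
    rw [e1, integral_sub (hpint g hT) hri, hr g hT, sub_self]
  refine (Lp.memLp r).ae_eq ?_
  filter_upwards [(ae_restrict_iff' hU.measurableSet).2 hae] with x hx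
  linarith

theorem toReal_eLpNorm_two_sq {α E : Type*} {m : MeasurableSpace α} [NormedAddCommGroup E]
    {ν : Measure α} {f : α → E} (hf : AEStronglyMeasurable f ν) :
    (eLpNorm f 2 ν).toReal ^ 2 = ∫ x, ‖f x‖ ^ 2 ∂ν := by
  rw [← ENNReal.toReal_pow, eLpNorm_two_sq, integral_eq_lintegral_of_nonneg_ae
    (Eventually.of_forall fun x => by positivity)
    (show AEStronglyMeasurable (fun x => ‖f x‖ ^ 2) ν from hf.norm.pow 2)]
  congr 1
  refine lintegral_congr fun x => ?_
  rw [ENNReal.ofReal_pow (norm_nonneg _), ofReal_norm]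

/-! ### Local square integrability of the pressure. -/

section Interior

/-- For a matrix `A`, the difference `A : A - A : Aᵀ` is the sum of `(A i j - A j i)²` over the
three pairs `i < j`. The symmetric `D` cancels in it, and each remaining square is at most `(2m)²`.
-/
theorem frobForm_le_transposeForm {D : E3 →L[ℝ] E3} (hD : ∀ i j, D (e j) i = D (e i) j) (r : ℝ)
    (l : E3 →L[ℝ] ℝ) (w : E3) {m : ℝ} (hm : ‖l‖ * ‖w‖ ≤ m) :
    frobForm (r • D + l.smulRight w) (r • D + l.smulRight w) ≤
      transposeForm (r • D + l.smulRight w) (r • D + l.smulRight w) + 12 * m ^ 2 := by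
  have hb : ∀ i j, |l (e j) * w i| ≤ m := fun i j => by
    rw [abs_mul]
    refine le_trans (mul_le_mul ?_ (PiLp.norm_apply_le w i) (abs_nonneg _) (norm_nonneg _)) hm
    simpa [norm_e] using l.le_opNorm (e j)
  have key : ∀ i j, (l (e j) * w i - l (e i) * w j) ^ 2 ≤ 4 * m ^ 2 := fun i j => by
    have h1 := abs_le.1 (hb i j)
    have h2 := abs_le.1 (hb j i)
    nlinarith
  have h01 := hD 0 1
  have h02 := hD 0 2
  have h12 := hD 1 2
  have k1 := key 0 1
  have k2 := key 0 2
  have k3 := key 1 2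
  rw [frobForm_self, transposeForm_self]
  simp only [Fin.sum_univ_three, _root_.add_apply, _root_.smul_apply,
    ContinuousLinearMap.smulRight_apply, PiLp.add_apply, PiLp.smul_apply, smul_eq_mul]
  rw [h01, h02, h12]
  nlinarith

/-- The mass of the approximate identity. -/
noncomputable def kernMass : ℝ := ∫ z : E3, 3 * (1 + ‖z‖ ^ 2) ^ (-(5 : ℝ) / 2)

theorem integrable_kernMass : Integrable fun z : E3 => 3 * (1 + ‖z‖ ^ 2) ^ (-(5 : ℝ) / 2) :=
  (integrable_rpow_neg_one_add_norm_sq (by rw [finrank_euclideanSpace]; norm_num)).const_mul 3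

/-- Only positivity of this constant matters, as it is divided out in the end. -/
theorem kernMass_pos : 0 < kernMass := by
  refine (integral_pos_iff_support_of_nonneg (fun z => by positivity) integrable_kernMass).2 ?_
  have : Function.support (fun z : E3 => 3 * (1 + ‖z‖ ^ 2) ^ (-(5 : ℝ) / 2)) = univ := by
    refine eq_univ_of_forall fun z => ?_
    have : 0 < 3 * (1 + ‖z‖ ^ 2) ^ (-(5 : ℝ) / 2) := by positivity
    exact this.ne'
  rw [this]
  simp

variable {f : E3 → ℝ}

theorem abs_divOf_potGrad_le {δ : ℝ} (hδ : 0 < δ) (hf : Continuous f) (hfc : HasCompactSupport f)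
    {M : ℝ} (hM : ∀ x, ‖f x‖ ≤ M) (x : E3) :
    ‖divOf (fderiv ℝ (potGrad δ f) x)‖ ≤ M * kernMass := by
  rw [divOf_fderiv_potGrad hδ hf hfc, kernMass, ← integral_const_mul]
  refine norm_integral_le_of_norm_le (integrable_kernMass.const_mul M)
    (Eventually.of_forall fun z => ?_)
  rw [norm_mul, Real.norm_of_nonneg (show 0 ≤ 3 * (1 + ‖z‖ ^ 2) ^ (-(5 : ℝ) / 2) by positivity)]
  gcongr
  exact hM _

theorem tendsto_divOf_potGrad (hf : Continuous f) (hfc : HasCompactSupport f) (x : E3) :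
    Tendsto (fun n : ℕ => divOf (fderiv ℝ (potGrad (1 / ((n : ℝ) + 1)) f) x)) atTop
      (𝓝 (f x * kernMass)) := by
  obtain ⟨M, hM⟩ := hf.bounded_above_of_compact_support hfc
  simp_rw [fun n : ℕ => divOf_fderiv_potGrad (Nat.one_div_pos_of_nat (α := ℝ) (n := n)) hf hfc x]
  rw [kernMass, ← integral_const_mul]
  refine tendsto_integral_of_dominated_convergence
    (fun z => M * (3 * (1 + ‖z‖ ^ 2) ^ (-(5 : ℝ) / 2))) (fun n => ?_)
    (integrable_kernMass.const_mul M) (fun n => Eventually.of_forall fun z => ?_)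
    (Eventually.of_forall fun z => ?_)
  · exact (hf.comp (by fun_prop)).aestronglyMeasurable.mul integrable_kernMass.1
  · rw [norm_mul, Real.norm_of_nonneg (show 0 ≤ 3 * (1 + ‖z‖ ^ 2) ^ (-(5 : ℝ) / 2) by positivity)]
    gcongr
    exact hM _
  · refine Tendsto.mul_const _ ?_
    have h0 := tendsto_one_div_add_atTop_nhds_zero_nat (𝕜 := ℝ)
    have h1 : Tendsto (fun n : ℕ => x - (1 / ((n : ℝ) + 1)) • z) atTop (𝓝 (x - (0 : ℝ) • z)) :=
      tendsto_const_nhds.sub (h0.smul_const z)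
    rw [zero_smul, sub_zero] at h1
    exact (hf.tendsto x).comp h1

variable {C : Set E3} {p : E3 → ℝ} {A k : ℝ}

/-- The basic estimate behind the local square integrability of the pressure, for the regularized
potential. -/
theorem abs_integral_mul_divOf_potGrad_le (hb : Bornology.IsBounded C)
    (hp : IntegrableOn p C) (hA : 0 ≤ A)
    (hΛ : ∀ φ, IsTestField C φ → |∫ x in C, p x * divOf (fderiv ℝ φ x)| ≤
      A * (eLpNorm (fderiv ℝ φ) 2 (volume.restrict C)).toReal) (hk : 0 < k)
    {η : E3 → ℝ} (hη : ContDiff ℝ (⊤ : ℕ∞) η) (hηc : HasCompactSupport η) (hηC : tsupport η ⊆ C)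
    (hη1 : ∀ x, 3 / k < Metric.infDist x Cᶜ → η x = 1) (hηd : ∀ x, ‖fderiv ℝ η x‖ ≤ k)
    (hf : ContDiff ℝ (⊤ : ℕ∞) f) (hfc : HasCompactSupport f)
    (hfk : ∀ x, f x ≠ 0 → 4 / k < Metric.infDist x Cᶜ) {δ : ℝ} (hδ : 0 < δ) :
    |∫ x in C, p x * (η x * divOf (fderiv ℝ (potGrad δ f) x))| ≤
      A * √(2 * (∫ x in C, (η x * divOf (fderiv ℝ (potGrad δ f) x)) ^ 2) +
        14 * (k ^ 3 * ∫ x, |f x|) ^ 2 * volume.real C) +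
      (k ^ 3 * ∫ x, |f x|) * ∫ x in C, |p x| := by
  set w := potGrad δ f
  set m := k ^ 3 * ∫ x, |f x|
  have hm0 : 0 ≤ m := mul_nonneg (by positivity) (integral_nonneg fun x => abs_nonneg _)
  have hw : ContDiff ℝ (⊤ : ℕ∞) w := contDiff_potGrad hδ hf hfc
  have hηD : Differentiable ℝ η := hη.differentiable (by simp)
  have hwD : Differentiable ℝ w := hw.differentiable (by simp)
  have hfder : ∀ x, fderiv ℝ (fun x => η x • w x) x =
      η x • fderiv ℝ w x + (fderiv ℝ η x).smulRight (w x) := fun x =>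
    fderiv_fun_smul (hηD x) (hwD x)
  -- The test field is the cut-off regularized potential gradient of `f`. Its divergence is `η div
  -- w`, which approximates `kernMass` times `f`, plus the commutator `∇η · w`.
  have hφ : IsTestField C fun x => η x • w x :=
    ⟨hη.smul hw, hηc.smul_right, (tsupport_smul_subset_left η w).trans hηC⟩
  -- where the cut-off varies, the potential is controlled
  have hmb : ∀ x, ‖fderiv ℝ η x‖ * ‖w x‖ ≤ m := by
    intro x
    by_cases hx : 3 / k < Metric.infDist x Cᶜ
    · have h0 : fderiv ℝ η x = 0 := by
        have : η =ᶠ[𝓝 x] fun _ => 1 := by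
          filter_upwards [(isOpen_lt continuous_const
            (Metric.continuous_infDist_pt Cᶜ)).mem_nhds hx] with y hy
          exact hη1 y hy
        rw [this.fderiv_eq]; simp
      rw [h0, norm_zero, zero_mul]; exact hm0
    · have hwx : ‖w x‖ ≤ k ^ 2 * ∫ x, |f x| := by
        rw [← integral_const_mul]
        refine norm_integral_le_of_norm_le
          (((hf.continuous.integrable_of_hasCompactSupport hfc).abs).const_mul _)
          (Eventually.of_forall fun y => ?_)
        rw [norm_smul, Real.norm_eq_abs, mul_comm]
        by_cases hy : f y = 0
        · simp [hy]
        · gcongr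
          have h1 := hfk y hy
          have h2 : Metric.infDist y Cᶜ ≤ Metric.infDist x Cᶜ + dist y x :=
            Metric.infDist_le_infDist_add_dist
          have h3 : 1 / k ≤ ‖x - y‖ := by
            rw [← dist_eq_norm, dist_comm]
            have : 4 / k = 3 / k + 1 / k := by ring
            linarith
          have := norm_kern_le (δ := δ) (x - y) (r := 1 / k) (by positivity) h3
          refine this.trans (le_of_eq ?_)
          field_simp
      calc ‖fderiv ℝ η x‖ * ‖w x‖ ≤ k * (k ^ 2 * ∫ x, |f x|) := by
            gcongr
            exact hηd x
        _ = m := by simp only [m]; ring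
  have hDw : ∀ x, |fderiv ℝ η x (w x)| ≤ m := fun x =>
    ((fderiv ℝ η x).le_opNorm (w x)).trans (hmb x)
  have hV : volume C ≠ ⊤ := hb.measure_lt_top.ne
  have : IsFiniteMeasure (volume.restrict C : Measure E3) := ⟨by simpa using hb.measure_lt_top⟩
  -- bound of the gradient
  have hTc : Continuous fun x => η x * divOf (fderiv ℝ w x) :=
    hη.continuous.mul (divL.continuous.comp (hw.continuous_fderiv (by simp)))
  have hTs : HasCompactSupport fun x => η x * divOf (fderiv ℝ w x) := hηc.mul_right
  have hTi : Integrable (fun x => (η x * divOf (fderiv ℝ w x)) ^ 2) (volume.restrict C) := by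
    simp_rw [sq]
    exact (hTc.mul hTc).integrable_of_hasCompactSupport hTs.mul_right
  have hrestr : ∀ {B : (E3 →L[ℝ] E3) → (E3 →L[ℝ] E3) → ℝ}, IsBilinearMap ℝ B →
      ∫ x in C, B (fderiv ℝ (fun x => η x • w x) x) (fderiv ℝ (fun x => η x • w x) x) =
        ∫ x, B (fderiv ℝ (fun x => η x • w x) x) (fderiv ℝ (fun x => η x • w x) x) :=
    fun {B} hB => by
      refine setIntegral_eq_integral_of_forall_compl_eq_zero fun x hx => ?_
      rw [hφ.fderiv_eq_zero hx]
      exact hB.toLinearMap.map_zero₂ 0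
  have i1 := integrable_bilin_fderiv hφ isBilinearMap_frobForm (volume.restrict C)
  have i2 := integrable_bilin_fderiv hφ isBilinearMap_transposeForm (volume.restrict C)
  have i3 := integrable_bilin_fderiv hφ isBilinearMap_divOf (volume.restrict C)
  have hgrad : (eLpNorm (fderiv ℝ fun x => η x • w x) 2 (volume.restrict C)).toReal ≤
      √(2 * (∫ x in C, (η x * divOf (fderiv ℝ w x)) ^ 2) + 14 * m ^ 2 * volume.real C) := by
    refine Real.le_sqrt_of_sq_le ?_
    have e1 : (eLpNorm (fderiv ℝ fun x => η x • w x) 2 (volume.restrict C)).toReal ^ 2 =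
        ∫ x in C, ‖fderiv ℝ (fun x => η x • w x) x‖ ^ 2 :=
      toReal_eLpNorm_two_sq hφ.continuous_fderiv.aestronglyMeasurable
    rw [e1]
    -- Apart from the antisymmetric part of `∇η ⊗ w`, which costs `12 m²`, the gradient is
    -- symmetric, so its square integral reduces to that of the divergence. Then `(a + b)² ≤ 2a² +
    -- 2b²` with `|b| ≤ m` adds `2 m²`, making `14 m²`.
    calc ∫ x in C, ‖fderiv ℝ (fun x => η x • w x) x‖ ^ 2
        ≤ ∫ x in C, (transposeForm (fderiv ℝ (fun x => η x • w x) x)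
            (fderiv ℝ (fun x => η x • w x) x) + 12 * m ^ 2) := by
          refine integral_mono_of_nonneg (Eventually.of_forall fun x => by positivity)
            (i2.add (integrable_const _)) (Eventually.of_forall fun x => ?_)
          refine (norm_sq_le_frobForm _).trans ?_
          simp only [hfder]
          exact frobForm_le_transposeForm (fderiv_potGrad_symm hδ hf.continuous hfc x) _ _ _ (hmb x)
      _ = ∫ x in C, (divOf (fderiv ℝ (fun x => η x • w x) x) *
            divOf (fderiv ℝ (fun x => η x • w x) x) + 12 * m ^ 2) := by
          rw [integral_add i2 (integrable_const _), integral_add i3 (integrable_const _),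
            hrestr isBilinearMap_transposeForm, hrestr isBilinearMap_divOf,
            integral_transposeForm_fderiv hφ]
      _ ≤ ∫ x in C, (2 * (η x * divOf (fderiv ℝ w x)) ^ 2 + 14 * m ^ 2) := by
          refine integral_mono (i3.add (integrable_const _))
            ((hTi.const_mul 2).add (integrable_const _)) fun x => ?_
          simp only [hfder]
          rw [divOf_smul_add_smulRight]
          have := sq_le_sq' (abs_le.1 (hDw x)).1 (abs_le.1 (hDw x)).2
          nlinarith [sq_nonneg (η x * divOf (fderiv ℝ w x) - fderiv ℝ η x (w x))]
      _ = 2 * (∫ x in C, (η x * divOf (fderiv ℝ w x)) ^ 2) + 14 * m ^ 2 * volume.real C := by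
          rw [integral_add (hTi.const_mul 2) (integrable_const _), integral_const_mul]
          simp [mul_comm]
  have hDwc : Continuous fun x => fderiv ℝ η x (w x) :=
    (hη.continuous_fderiv (by simp)).clm_apply hw.continuous
  obtain ⟨M, hM⟩ := hTc.bounded_above_of_compact_support hTs
  have j1 : Integrable (fun x => p x * (η x * divOf (fderiv ℝ w x))) (volume.restrict C) :=
    hp.mul_bdd hTc.aestronglyMeasurable (Eventually.of_forall hM)
  have j2 : Integrable (fun x => p x * fderiv ℝ η x (w x)) (volume.restrict C) :=
    hp.mul_bdd hDwc.aestronglyMeasurable (Eventually.of_forall hDw)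
  have hsplit : ∫ x in C, p x * (η x * divOf (fderiv ℝ w x)) =
      (∫ x in C, p x * divOf (fderiv ℝ (fun x => η x • w x) x)) -
        ∫ x in C, p x * fderiv ℝ η x (w x) := by
    have : ∀ x, p x * divOf (fderiv ℝ (fun x => η x • w x) x) =
        p x * (η x * divOf (fderiv ℝ w x)) + p x * fderiv ℝ η x (w x) := fun x => by
      rw [hfder, divOf_smul_add_smulRight, mul_add]
    simp_rw [this]
    rw [integral_add j1 j2, add_sub_cancel_right]
  have hlast : |∫ x in C, p x * fderiv ℝ η x (w x)| ≤ m * ∫ x in C, |p x| := by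
    rw [← integral_const_mul, ← Real.norm_eq_abs]
    refine norm_integral_le_of_norm_le (hp.abs.const_mul m) (Eventually.of_forall fun x => ?_)
    rw [norm_mul, Real.norm_eq_abs, Real.norm_eq_abs, mul_comm]
    gcongr
    exact hDw x
  rw [hsplit]
  refine (abs_sub _ _).trans (add_le_add ((hΛ _ hφ).trans ?_) hlast)
  gcongr

/-- A function whose distributional gradient is bounded on test fields in the `W^{1,2}` norm is
locally square integrable. -/
theorem memLp_two_interior (hb : Bornology.IsBounded C)
    (hp : IntegrableOn p C) (hA : 0 ≤ A)
    (hΛ : ∀ φ, IsTestField C φ → |∫ x in C, p x * divOf (fderiv ℝ φ x)| ≤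
      A * (eLpNorm (fderiv ℝ φ) 2 (volume.restrict C)).toReal) (hk : 0 < k) :
    MemLp p 2 (volume.restrict {x | 4 / k < Metric.infDist x Cᶜ}) := by
  obtain ⟨η, hη, hη0, hηle, hηc, hηs, hη1, hηd⟩ := exists_cutoff hb hk
  have hηC : tsupport η ⊆ C := fun x hx =>
    mem_of_infDist_pos (lt_of_lt_of_le (by positivity) (hηs hx))
  set U : Set E3 := {x | 4 / k < Metric.infDist x Cᶜ}
  have hU : IsOpen U := isOpen_lt continuous_const (Metric.continuous_infDist_pt Cᶜ)
  have hUC : U ⊆ C := fun x hx => mem_of_infDist_pos (lt_trans (by positivity) hx)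
  have : IsFiniteMeasure (volume.restrict C : Measure E3) := ⟨by simpa using hb.measure_lt_top⟩
  set P := ∫ x in C, |p x|
  have hP : 0 ≤ P := integral_nonneg fun x => abs_nonneg _
  set W := volume.real C
  have hκ := kernMass_pos
  -- The constant is what the regularized estimate leaves as `δ → 0`, after `‖f‖₁ ≤ √W ‖f‖₂` has
  -- been used in the commutator terms. The limit of the divergence supplies the factor `kernMass`.
  refine memLp_two_of_integral_le hU (hp.mono_set hUC)
    (B := (A * √(2 * kernMass ^ 2 + 14 * k ^ 6 * W ^ 2) + k ^ 3 * √W * P) / kernMass)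
    fun f hf hfc hfU => ?_
  have hfk : ∀ x, f x ≠ 0 → 4 / k < Metric.infDist x Cᶜ := fun x hx =>
    hfU (subset_tsupport f hx)
  have hest := fun n : ℕ => abs_integral_mul_divOf_potGrad_le hb hp hA hΛ hk hη hηc hηC hη1 hηd hf
    hfc hfk (Nat.one_div_pos_of_nat (α := ℝ) (n := n))
  obtain ⟨M, hM⟩ := hf.continuous.bounded_above_of_compact_support hfc
  have hηf : ∀ x, η x * (f x * kernMass) = f x * kernMass := fun x => by
    by_cases hx : f x = 0
    · simp [hx]
    · rw [hη1 x (lt_trans (by gcongr; norm_num) (hfk x hx)), one_mul]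
  have hTb : ∀ (n : ℕ) x, ‖η x * divOf (fderiv ℝ (potGrad (1 / ((n : ℝ) + 1)) f) x)‖ ≤
      M * kernMass := fun n x => by
    rw [norm_mul, Real.norm_of_nonneg (hη0 x)]
    exact (mul_le_of_le_one_left (norm_nonneg _) (hηle x)).trans
      (abs_divOf_potGrad_le Nat.one_div_pos_of_nat hf.continuous hfc hM x)
  have hTl : ∀ x, Tendsto (fun n : ℕ => η x * divOf (fderiv ℝ (potGrad (1 / ((n : ℝ) + 1)) f) x))
      atTop (𝓝 (f x * kernMass)) := fun x => by
    have := (tendsto_divOf_potGrad hf.continuous hfc x).const_mul (η x)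
    rwa [hηf] at this
  have hTm : ∀ n : ℕ, AEStronglyMeasurable
      (fun x => η x * divOf (fderiv ℝ (potGrad (1 / ((n : ℝ) + 1)) f) x))
      (volume.restrict C) := fun n =>
    (hη.continuous.mul (divL.continuous.comp ((contDiff_potGrad Nat.one_div_pos_of_nat hf
      hfc).continuous_fderiv (by simp)))).aestronglyMeasurable
  have l1 : Tendsto (fun n : ℕ => ∫ x in C, p x *
      (η x * divOf (fderiv ℝ (potGrad (1 / ((n : ℝ) + 1)) f) x))) atTop
      (𝓝 (∫ x in C, p x * (f x * kernMass))) := by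
    refine tendsto_integral_of_dominated_convergence (fun x => |p x| * (M * kernMass))
      (fun n => hp.1.mul (hTm n)) (hp.abs.mul_const _)
      (fun n => Eventually.of_forall fun x => ?_)
      (Eventually.of_forall fun x => (hTl x).const_mul _)
    rw [norm_mul, Real.norm_eq_abs]
    gcongr
    exact hTb n x
  have l2 : Tendsto (fun n : ℕ => ∫ x in C,
      (η x * divOf (fderiv ℝ (potGrad (1 / ((n : ℝ) + 1)) f) x)) ^ 2) atTop
      (𝓝 (∫ x in C, (f x * kernMass) ^ 2)) := by
    refine tendsto_integral_of_dominated_convergence (fun x => (M * kernMass) ^ 2)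
      (fun n => (hTm n).pow 2) (integrable_const _)
      (fun n => Eventually.of_forall fun x => ?_)
      (Eventually.of_forall fun x => (hTl x).pow 2)
    rw [norm_pow]
    gcongr
    exact hTb n x
  have hfi : Integrable (fun x => f x ^ 2) := by
    simp_rw [sq]
    exact (hf.continuous.mul hf.continuous).integrable_of_hasCompactSupport hfc.mul_right
  have hf0 : ∀ x, x ∉ U → f x = 0 := fun x hx =>
    image_eq_zero_of_notMem_tsupport fun h => hx (hfU h)
  have hf0C : ∀ x, x ∉ C → f x = 0 := fun x hx => hf0 x fun h => hx (hUC h)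
  set F := (eLpNorm f 2 (volume.restrict U)).toReal with hF
  have hFsq : F ^ 2 = ∫ x in C, f x ^ 2 := by
    rw [hF, toReal_eLpNorm_two_sq hf.continuous.aestronglyMeasurable,
      setIntegral_eq_integral_of_forall_compl_eq_zero (s := C) (fun x hx => by simp [hf0C x hx]),
      setIntegral_eq_integral_of_forall_compl_eq_zero (s := U) (fun x hx => by simp [hf0 x hx])]
    simp_rw [Real.norm_eq_abs, sq_abs]
  have hF0 : 0 ≤ F := ENNReal.toReal_nonneg
  have hfint : Integrable f := hf.continuous.integrable_of_hasCompactSupport hfc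
  have hf1 : ∫ x, |f x| ≤ √W * F := by
    rw [← setIntegral_eq_integral_of_forall_compl_eq_zero (s := C) (fun x hx => by simp [hf0C x hx])]
    refine le_of_sq_le_sq ?_ (by positivity)
    rw [mul_pow, Real.sq_sqrt measureReal_nonneg, hFsq]
    have hc := abs_integral_bilin_le (p := 2) (q := 2) (ν := volume.restrict C)
      (ContinuousLinearMap.mul ℝ ℝ) (memLp_const (1 : ℝ))
      (hf.continuous.abs.memLp_of_hasCompactSupport (p := 2) (μ := volume.restrict C)
        (hfc.comp_left (g := fun t : ℝ => |t|) abs_zero))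
    simp only [ContinuousLinearMap.mul_apply', one_mul] at hc
    have hn : ‖ContinuousLinearMap.mul ℝ ℝ‖ ≤ 1 := ContinuousLinearMap.opNorm_mul_le ℝ ℝ
    have q1 : (eLpNorm (fun _ : E3 => (1 : ℝ)) 2 (volume.restrict C)).toReal ^ 2 = W := by
      rw [← ENNReal.toReal_pow, eLpNorm_two_sq]
      simp [W, Measure.real]
    have q2 : (eLpNorm (fun x => |f x|) 2 (volume.restrict C)).toReal ^ 2 = ∫ x in C, f x ^ 2 := by
      rw [toReal_eLpNorm_two_sq hf.continuous.abs.aestronglyMeasurable]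
      simp_rw [Real.norm_eq_abs, sq_abs]
    change _ ≤ W * _
    rw [← q1, ← q2, ← mul_pow]
    refine pow_le_pow_left₀ (integral_nonneg fun x => abs_nonneg _) ?_ 2
    refine (le_abs_self _).trans (hc.trans ?_)
    refine mul_le_mul_of_nonneg_right ?_ ENNReal.toReal_nonneg
    exact mul_le_of_le_one_left ENNReal.toReal_nonneg hn
  have hI0 : 0 ≤ ∫ x, |f x| := integral_nonneg fun x => abs_nonneg _
  have hlim := le_of_tendsto_of_tendsto' l1.abs
    ((((l2.const_mul 2).add_const _).sqrt.const_mul A).add_const _) hest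
  have hW0 : 0 ≤ W := measureReal_nonneg
  have e1 : ∫ x in C, p x * (f x * kernMass) = (∫ x in U, p x * f x) * kernMass := by
    rw [setIntegral_eq_integral_of_forall_compl_eq_zero (s := C) (fun x hx => by simp [hf0C x hx]),
      setIntegral_eq_integral_of_forall_compl_eq_zero (s := U) (fun x hx => by simp [hf0 x hx]),
      ← integral_mul_const]
    simp_rw [mul_assoc]
  have e2 : ∫ x in C, (f x * kernMass) ^ 2 = F ^ 2 * kernMass ^ 2 := by
    simp_rw [mul_pow]
    rw [integral_mul_const, hFsq]
  rw [e1, e2, abs_mul, abs_of_pos hκ] at hlim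
  rw [div_mul_eq_mul_div, le_div_iff₀ hκ]
  refine hlim.trans ?_
  rw [add_mul]
  have hm : k ^ 3 * ∫ x, |f x| ≤ k ^ 3 * (√W * F) := by gcongr
  have hm0 : 0 ≤ k ^ 3 * ∫ x, |f x| := by positivity
  have hsq : (k ^ 3 * ∫ x, |f x|) ^ 2 ≤ k ^ 6 * W * F ^ 2 := by
    calc (k ^ 3 * ∫ x, |f x|) ^ 2 ≤ (k ^ 3 * (√W * F)) ^ 2 := by gcongr
      _ = k ^ 6 * (√W ^ 2) * F ^ 2 := by ring
      _ = _ := by rw [Real.sq_sqrt hW0]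
  refine add_le_add ?_ ?_
  · rw [mul_assoc A]
    refine mul_le_mul_of_nonneg_left ?_ hA
    rw [← Real.sqrt_sq hF0, ← Real.sqrt_mul (by positivity), Real.sqrt_sq hF0]
    refine Real.sqrt_le_sqrt ?_
    have := mul_le_mul_of_nonneg_right hsq hW0
    nlinarith
  · calc (k ^ 3 * ∫ x, |f x|) * P ≤ (k ^ 3 * (√W * F)) * P := by gcongr
      _ = _ := by ring

end Interior

end Pendulum

/-! ### The energy identity and the vanishing of the velocity. -/

namespace Pendulum

open scoped ENNReal NNReal ContDiff

set_option maxSynthPendingDepth 3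

instance holderTriple_fourThirds_four_one : (ENNReal.ofReal (4 / 3)).HolderTriple 4 1 :=
  ⟨by
    have h1 : (4 : ℝ≥0∞) = ENNReal.ofReal 4 := by simp
    rw [h1, ← ENNReal.ofReal_inv_of_pos (by norm_num), ← ENNReal.ofReal_inv_of_pos (by norm_num),
      ← ENNReal.ofReal_add (by norm_num) (by norm_num)]
    norm_num⟩

theorem isBilinearMap_evalForm : IsBilinearMap ℝ fun (a b : E3) =>
    (innerSL ℝ a).comp (ContinuousLinearMap.apply ℝ E3 b) where
  add_left _ _ _ := by ext; simp
  smul_left _ _ _ := by ext; simp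
  add_right _ _ _ := by ext; simp
  smul_right _ _ _ := by ext; simp

/-- The functional `L ↦ a · (L b)`, depending bilinearly on `a` and `b`. -/
noncomputable def evalForm : E3 →L[ℝ] E3 →L[ℝ] ((E3 →L[ℝ] E3) →L[ℝ] ℝ) :=
  isBilinearMap_evalForm.toContinuousBilinearMap

@[simp] theorem evalForm_apply (a b : E3) (L : E3 →L[ℝ] E3) : evalForm a b L = inner ℝ a (L b) := rfl

/-- The pairing `(r, y) ↦ r (g · y)`. -/
noncomputable def weightForm (g : E3) : ℝ →L[ℝ] E3 →L[ℝ] ℝ :=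
  (ContinuousLinearMap.mul ℝ ℝ).bilinearComp (ContinuousLinearMap.id ℝ ℝ) (innerSL ℝ g)

@[simp] theorem weightForm_apply (g : E3) (r : ℝ) (y : E3) : weightForm g r y = r * inner ℝ g y := by
  simp [weightForm]

/-- The functional of the viscous stress of a velocity gradient. -/
noncomputable def stressForm (μ lam : ℝ) : (E3 →L[ℝ] E3) →L[ℝ] (E3 →L[ℝ] E3) →L[ℝ] ℝ :=
  (isBilinearMap_stress μ lam).toContinuousBilinearMap

@[simp] theorem stressForm_apply (μ lam : ℝ) (L L' : E3 →L[ℝ] E3) :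
    stressForm μ lam L L' = contract (stress μ lam L) (gradMatrix L') := rfl

/-- Evaluation as a bilinear map. -/
noncomputable abbrev evalL : ((E3 →L[ℝ] E3) →L[ℝ] ℝ) →L[ℝ] (E3 →L[ℝ] E3) →L[ℝ] ℝ :=
  ContinuousLinearMap.id ℝ _

@[simp] theorem rigidGrad_zero : rigidGrad 0 = 0 := by
  ext x i
  simp [rigidGrad]

namespace System

variable (S : System)

theorem isBounded_C : Bornology.IsBounded S.C := S.isBounded_union.subset subset_union_left

theorem isFiniteMeasure_C : IsFiniteMeasure (volume.restrict S.C : Measure E3) :=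
  ⟨by simpa using S.isBounded_C.measure_lt_top⟩

theorem γ_gt_one : 1 < S.γ := by linarith [S.γ_gt]

theorem γ_pos : 0 < S.γ := by linarith [S.γ_gt]

variable {S} {ρ : E3 → ℝ} {u : E3 → E3} {g : E3} {Du : E3 → E3 →L[ℝ] E3}

theorem pressure_nonneg {r : ℝ} (hr : 0 ≤ r) : 0 ≤ S.pressure r :=
  mul_nonneg S.a_pos.le (Real.rpow_nonneg hr _)

theorem integrable_pressure (hρ : MemLp ρ (ENNReal.ofReal S.γ) (volume.restrict S.C))
    (h0 : ∀ᵐ x ∂volume.restrict S.C, 0 ≤ ρ x) :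
    IntegrableOn (fun x => S.pressure (ρ x)) S.C := by
  have h := hρ.integrable_norm_rpow (by simpa using S.γ_pos) ENNReal.ofReal_ne_top
  rw [ENNReal.toReal_ofReal S.γ_pos.le] at h
  refine (h.const_mul S.a).congr ?_
  filter_upwards [h0] with x hx
  rw [Real.norm_of_nonneg hx, pressure]

/-- The renormalized continuity equation for the primitive of the pressure. -/
theorem RenormalizedContinuity.pressure (h : S.RenormalizedContinuity ρ u Du)
    (h0 : ∀ᵐ x ∂volume.restrict S.C, 0 ≤ ρ x) :
    IntegrableOn (fun x => S.pressure (ρ x) • u x) S.C ∧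
    IntegrableOn (fun x => S.pressure (ρ x) * divOf (Du x)) S.C ∧
    ∀ ψ : E3 → ℝ, ContDiff ℝ (⊤ : ℕ∞) ψ →
      ∫ x in S.C, S.pressure (ρ x) * fderiv ℝ ψ x (u x) =
        (S.γ - 1) * ∫ x in S.C, S.pressure (ρ x) * divOf (Du x) * ψ x := by
  have hγ : 0 < S.γ - 1 := by linarith [S.γ_gt_one]
  -- For `z ≥ 0` this solves `z b'(z) - b(z) = p(z)`, and `b = p / (γ - 1)`.
  let b : ℝ → ℝ := fun z => S.a / (S.γ - 1) * z ^ S.γ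
  have hbc : ContDiff ℝ 1 b :=
    contDiff_const.mul (Real.contDiff_rpow_const_of_le (by simpa using S.γ_gt_one.le))
  obtain ⟨h1, h2, h3⟩ := h b hbc
  have hb : ∀ z, b z = S.pressure z / (S.γ - 1) := fun z => by simp only [b, System.pressure]; ring
  have hd : ∀ z, 0 ≤ z → z * deriv b z - b z = S.pressure z := fun z hz => by
    have hder : deriv b z = S.a / (S.γ - 1) * (S.γ * z ^ (S.γ - 1)) :=
      ((Real.hasDerivAt_rpow_const (Or.inr S.γ_gt_one.le)).const_mul _).deriv
    have hz' : z * z ^ (S.γ - 1) = z ^ S.γ := by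
      rw [mul_comm, ← Real.rpow_add_one' hz (by rw [sub_add_cancel]; exact S.γ_pos.ne'),
        sub_add_cancel]
    rw [hder]
    simp only [b, System.pressure]
    calc z * (S.a / (S.γ - 1) * (S.γ * z ^ (S.γ - 1))) - S.a / (S.γ - 1) * z ^ S.γ
        = S.a / (S.γ - 1) * S.γ * (z * z ^ (S.γ - 1)) - S.a / (S.γ - 1) * z ^ S.γ := by ring
      _ = _ := by rw [hz']; field_simp
  have hde : ∀ᵐ x ∂volume.restrict S.C, ρ x * deriv b (ρ x) - b (ρ x) = S.pressure (ρ x) := by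
    filter_upwards [h0] with x hx
    exact hd _ hx
  refine ⟨?_, ?_, fun ψ hψ => ?_⟩
  · refine (h1.smul (S.γ - 1)).congr (Eventually.of_forall fun x => ?_)
    simp only [Pi.smul_apply, smul_smul, hb]
    rw [mul_div_cancel₀ _ hγ.ne']
  · refine h2.congr ?_
    filter_upwards [hde] with x hx
    rw [hx]
  · have := sub_eq_zero.1 (h3 ψ hψ)
    have e1 : ∫ x in S.C, b (ρ x) * fderiv ℝ ψ x (u x) =
        (S.γ - 1)⁻¹ * ∫ x in S.C, S.pressure (ρ x) * fderiv ℝ ψ x (u x) := by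
      rw [← integral_const_mul]
      refine integral_congr_ae (Eventually.of_forall fun x => ?_)
      simp only [hb]; ring
    have e2 : ∫ x in S.C, (ρ x * deriv b (ρ x) - b (ρ x)) * divOf (Du x) * ψ x =
        ∫ x in S.C, S.pressure (ρ x) * divOf (Du x) * ψ x := by
      refine integral_congr_ae ?_
      filter_upwards [hde] with x hx
      rw [hx]
    rw [e1, e2] at this
    rw [← this, ← mul_assoc, mul_inv_cancel₀ hγ.ne', one_mul]

/-- The weak continuity equation. -/
theorem RenormalizedContinuity.continuity (h : S.RenormalizedContinuity ρ u Du)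
    {ψ : E3 → ℝ} (hψ : ContDiff ℝ (⊤ : ℕ∞) ψ) :
    ∫ x in S.C, ρ x * fderiv ℝ ψ x (u x) = 0 := by
  have := (h (fun z => z) contDiff_id).2.2 ψ hψ
  simpa using this

/-- The density is essentially bounded where the velocity does not vanish; the momentum density is
as integrable as the velocity. -/
theorem RenormalizedContinuity.memLp_smul (h : S.RenormalizedContinuity ρ u Du)
    (hρ : AEStronglyMeasurable ρ (volume.restrict S.C))
    (h0 : ∀ᵐ x ∂volume.restrict S.C, 0 ≤ ρ x) {q : ℝ≥0∞} (hu : MemLp u q (volume.restrict S.C)) :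
    MemLp (fun x => ρ x • u x) q (volume.restrict S.C) := by
  obtain ⟨K, hK, hb⟩ := exists_bound_of_integrable_smul hρ fun b hb => (h b hb).1
  refine (hu.const_smul K).of_le (hρ.smul hu.1) ?_
  filter_upwards [h0, hb] with x hx hbx
  rw [Pi.smul_apply, norm_smul, norm_smul, Real.norm_of_nonneg hx, Real.norm_of_nonneg hK.le]
  by_cases hux : u x = 0
  · simp [hux]
  · gcongr
    exact hbx hux

/-- The convective term vanishes when tested with the velocity itself. -/
theorem integral_convective_eq_zero (hbd : Bornology.IsBounded S.C)
    (hu : IsSobolevZero S.C u Du) (hren : S.RenormalizedContinuity ρ u Du)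
    (hρ : AEStronglyMeasurable ρ (volume.restrict S.C))
    (h0 : ∀ᵐ x ∂volume.restrict S.C, 0 ≤ ρ x) :
    ∫ x in S.C, evalForm (u x) (ρ x • u x) (Du x) = 0 := by
  obtain ⟨h4, φ, hφ, -, hφ4, hφD⟩ := hu.exists_approx hbd
  have hρu := hren.memLp_smul hρ h0 h4
  have hlim := tendsto_integral_bilin (p := 2) (q := 2) evalL
    (f := fun n x => evalForm (φ n x) (ρ x • u x)) (f₀ := fun x => evalForm (u x) (ρ x • u x))
    (g := fun n => fderiv ℝ (φ n)) (g₀ := Du)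
    (fun n => memLp_bilin (p := 4) (q := 4) evalForm ((hφ n).memLp 4 _) hρu)
    (fun n => (hφ n).fderiv_memLp 2 _) (memLp_bilin (p := 4) (q := 4) evalForm h4 hρu) hu.2.1
    (tendsto_eLpNorm_bilin (p := 4) (q := 4) (by norm_num) evalForm
      (fun n => ((hφ n).memLp 4 _).1) (fun _ => hρu.1) h4 hρu hφ4 (by simp)) hφD
  refine tendsto_nhds_unique hlim ?_
  -- For a test field the integrand is `ρ u · ∇(|φ|²/2)`, and `|φ|²/2` is a smooth test function for
  -- the continuity equation.
  have hz : ∀ n, ∫ x in S.C, evalL (evalForm (φ n x) (ρ x • u x)) (fderiv ℝ (φ n) x) = 0 := by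
    intro n
    have hψ : ContDiff ℝ (⊤ : ℕ∞) fun x => (1 / 2 : ℝ) * ‖φ n x‖ ^ 2 :=
      contDiff_const.mul ((hφ n).contDiff.norm_sq ℝ)
    rw [← hren.continuity hψ]
    refine integral_congr_ae (Eventually.of_forall fun x => ?_)
    have hder := (((hφ n).differentiable x).hasFDerivAt.norm_sq).const_mul (1 / 2 : ℝ)
    simp only [hder.fderiv]
    simp
  simp_rw [hz]
  exact tendsto_const_nhds

/-- The functional on velocity gradients in the momentum balance. -/
noncomputable def momentumForm (S : System) (ρ : E3 → ℝ) (u : E3 → E3) (Du : E3 → E3 →L[ℝ] E3)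
    (x : E3) : (E3 →L[ℝ] E3) →L[ℝ] ℝ :=
  stressForm S.μ S.lam (Du x) - evalForm (u x) (ρ x • u x)

/-- The stress is in `L²` with `Du`; the convective flux is a product of `u` and `ρ u`, both in
`L⁴`. -/
theorem memLp_momentumForm (hu : IsSobolevZero S.C u Du) (hren : S.RenormalizedContinuity ρ u Du)
    (hρ : AEStronglyMeasurable ρ (volume.restrict S.C))
    (h0 : ∀ᵐ x ∂volume.restrict S.C, 0 ≤ ρ x) :
    MemLp (momentumForm S ρ u Du) 2 (volume.restrict S.C) := by
  obtain ⟨h4, -⟩ := hu.exists_approx S.isBounded_C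
  exact ((stressForm S.μ S.lam).comp_memLp' hu.2.1).sub
    (memLp_bilin (p := 4) (q := 4) evalForm h4 (hren.memLp_smul hρ h0 h4))

/-- The exponent `4/3 < γ` is dual to 4, so gravity can be paired with fields in `L⁴`. -/
theorem memLp_fourThirds (hρ : MemLp ρ (ENNReal.ofReal S.γ) (volume.restrict S.C)) :
    MemLp ρ (ENNReal.ofReal (4 / 3)) (volume.restrict S.C) := by
  have := S.isFiniteMeasure_C
  exact hρ.mono_exponent (ENNReal.ofReal_le_ofReal (by linarith [S.γ_gt]))

/-- The momentum balance, solved for the pressure. -/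
theorem WeakMomentum.pressure_eq (h : S.WeakMomentum ρ u 0 g u Du)
    (hu : IsSobolevZero S.C u Du) (hren : S.RenormalizedContinuity ρ u Du)
    (hρ : AEStronglyMeasurable ρ (volume.restrict S.C))
    (h0 : ∀ᵐ x ∂volume.restrict S.C, 0 ≤ ρ x) {φ : E3 → E3} (hφ : IsTestField S.C φ) :
    ∫ x in S.C, S.pressure (ρ x) * divOf (fderiv ℝ φ x) =
      (∫ x in S.C, momentumForm S ρ u Du x (fderiv ℝ φ x)) -
        ∫ x in S.C, weightForm g (ρ x) (φ x) := by
  obtain ⟨h4, -⟩ := hu.exists_approx S.isBounded_C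
  have hm := h φ hφ
  have i1 : Integrable (fun x => stressForm S.μ S.lam (Du x) (fderiv ℝ φ x))
      (volume.restrict S.C) := memLp_one_iff_integrable.1
    (memLp_bilin (p := 2) (q := 2) _ hu.2.1 (hφ.fderiv_memLp 2 _))
  have i2 : Integrable (fun x => evalForm (u x) (ρ x • u x) (fderiv ℝ φ x))
      (volume.restrict S.C) := memLp_one_iff_integrable.1
    (memLp_bilin (p := 2) (q := 2) evalL
      (memLp_bilin (p := 4) (q := 4) evalForm h4 (hren.memLp_smul hρ h0 h4)) (hφ.fderiv_memLp 2 _))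
  have e1 : ∫ x in S.C, momentumForm S ρ u Du x (fderiv ℝ φ x) =
      (∫ x in S.C, contract (stress S.μ S.lam (Du x)) (gradMatrix (fderiv ℝ φ x))) -
        ∫ x in S.C, ρ x * inner ℝ (u x) (fderiv ℝ φ x (u x)) := by
    have : ∀ x, momentumForm S ρ u Du x (fderiv ℝ φ x) =
        stressForm S.μ S.lam (Du x) (fderiv ℝ φ x) -
          evalForm (u x) (ρ x • u x) (fderiv ℝ φ x) := fun x => rfl
    simp_rw [this]
    rw [integral_sub i1 i2]
    simp
  simp only [rigidGrad_zero, add_zero, zero_smul, inner_zero_left, mul_zero, integral_zero,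
    sub_zero] at hm
  rw [e1]
  simp only [weightForm_apply]
  linarith

/-- The pressure gradient is bounded in the dual of `W₀^{1,2}`, which is the hypothesis of
`memLp_two_interior`. The gravity term is absorbed by the Sobolev inequality. -/
theorem WeakMomentum.exists_bound (h : S.WeakMomentum ρ u 0 g u Du)
    (hu : IsSobolevZero S.C u Du) (hren : S.RenormalizedContinuity ρ u Du)
    (hρ : MemLp ρ (ENNReal.ofReal S.γ) (volume.restrict S.C))
    (h0 : ∀ᵐ x ∂volume.restrict S.C, 0 ≤ ρ x) :
    ∃ A : ℝ, 0 ≤ A ∧ ∀ φ, IsTestField S.C φ →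
      |∫ x in S.C, S.pressure (ρ x) * divOf (fderiv ℝ φ x)| ≤
        A * (eLpNorm (fderiv ℝ φ) 2 (volume.restrict S.C)).toReal := by
  obtain ⟨K, hK⟩ := sobolev_test S.isBounded_C (q := 4) (by norm_num)
  have hΘ := memLp_momentumForm hu hren hρ.1 h0
  have hρ' := memLp_fourThirds hρ
  refine ⟨‖evalL‖ * (eLpNorm (momentumForm S ρ u Du) 2 (volume.restrict S.C)).toReal +
    ‖weightForm g‖ * (eLpNorm ρ (ENNReal.ofReal (4 / 3)) (volume.restrict S.C)).toReal * K,
    by positivity, fun φ hφ => ?_⟩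
  rw [h.pressure_eq hu hren hρ.1 h0 hφ, add_mul]
  refine (abs_sub _ _).trans (add_le_add ?_ ?_)
  · exact abs_integral_bilin_le (p := 2) (q := 2) evalL hΘ (hφ.fderiv_memLp 2 _)
  · refine (abs_integral_bilin_le (p := ENNReal.ofReal (4 / 3)) (q := 4) (weightForm g) hρ'
      (hφ.memLp 4 _)).trans ?_
    rw [mul_assoc _ (K : ℝ)]
    gcongr
    have := ENNReal.toReal_mono (ENNReal.mul_ne_top ENNReal.coe_ne_top
      (hφ.fderiv_memLp 2 (volume.restrict S.C)).2.ne) (hK φ hφ)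
    simpa using this

/-- Testing the momentum equation with the velocity, cut off near the boundary. -/
theorem WeakMomentum.cutoff_eq (h : S.WeakMomentum ρ u 0 g u Du)
    (hu : IsSobolevZero S.C u Du) (hren : S.RenormalizedContinuity ρ u Du)
    (hρ : MemLp ρ (ENNReal.ofReal S.γ) (volume.restrict S.C))
    (h0 : ∀ᵐ x ∂volume.restrict S.C, 0 ≤ ρ x) {k : ℝ} (hk : 0 < k) {η : E3 → ℝ}
    (hη : ContDiff ℝ (⊤ : ℕ∞) η) (hη0 : ∀ x, 0 ≤ η x) (hη1 : ∀ x, η x ≤ 1)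
    (hηc : HasCompactSupport η)
    (hηs : tsupport η ⊆ {x | 1 / (2 * k) ≤ Metric.infDist x S.Cᶜ})
    (hηd : ∀ x, ‖fderiv ℝ η x‖ ≤ k) :
    (∫ x in S.C, momentumForm S ρ u Du x (η x • Du x + (fderiv ℝ η x).smulRight (u x))) -
        (∫ x in S.C, weightForm g (ρ x) (η x • u x)) =
      S.γ * ∫ x in S.C, S.pressure (ρ x) * divOf (Du x) * η x := by
  obtain ⟨h4, φ, hφ, hφ2, hφ4, hφD⟩ := hu.exists_approx S.isBounded_C
  obtain ⟨A, hA, hΛ⟩ := h.exists_bound hu hren hρ h0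
  have hΘ := memLp_momentumForm hu hren hρ.1 h0
  have hp := integrable_pressure hρ h0
  have hηC : tsupport η ⊆ S.C := fun x hx =>
    mem_of_infDist_pos (lt_of_lt_of_le (by positivity) (hηs hx))
  have hηn : ∀ x, ‖η x‖ ≤ 1 := fun x => by rw [Real.norm_of_nonneg (hη0 x)]; exact hη1 x
  have hηm : AEStronglyMeasurable η (volume.restrict S.C) := hη.continuous.aestronglyMeasurable
  have hηdm : AEStronglyMeasurable (fderiv ℝ η) (volume.restrict S.C) :=
    (hη.continuous_fderiv (by simp)).aestronglyMeasurable
  -- The Leibniz formula for `∇(η w)`. Written in terms of the pair `(w, D)`, it also makes sense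
  -- for `u` with its weak derivative, and it is continuous in `L²`.
  let P : E3 → E3 → (E3 →L[ℝ] E3) → (E3 →L[ℝ] E3) := fun x w D =>
    η x • D + (fderiv ℝ η x).smulRight w
  have hPle : ∀ x w D, ‖P x w D‖ ≤ ‖‖D‖ + k * ‖w‖‖ := fun x w D => by
    rw [Real.norm_of_nonneg (by positivity)]
    refine (norm_add_le _ _).trans (add_le_add ?_ ?_)
    · rw [norm_smul]; exact mul_le_of_le_one_left (norm_nonneg _) (hηn x)
    · rw [ContinuousLinearMap.norm_smulRight_apply]
      gcongr
      exact hηd x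
  have hPm : ∀ {w : E3 → E3} {D : E3 → E3 →L[ℝ] E3}, AEStronglyMeasurable w (volume.restrict S.C) →
      AEStronglyMeasurable D (volume.restrict S.C) →
      AEStronglyMeasurable (fun x => P x (w x) (D x)) (volume.restrict S.C) := fun hw hD =>
    (hηm.smul hD).add ((ContinuousLinearMap.smulRightL ℝ E3 E3).aestronglyMeasurable_comp₂ hηdm hw)
  have hPmem : ∀ {w : E3 → E3} {D : E3 → E3 →L[ℝ] E3}, MemLp w 2 (volume.restrict S.C) →
      MemLp D 2 (volume.restrict S.C) →
      MemLp (fun x => P x (w x) (D x)) 2 (volume.restrict S.C) := fun hw hD =>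
    MemLp.of_le (hD.norm.add (hw.norm.const_mul k)) (hPm hw.1 hD.1)
      (Eventually.of_forall fun x => hPle x _ _)
  have hPlim : Tendsto (fun n => eLpNorm (fun x => P x (φ n x) (fderiv ℝ (φ n) x) - P x (u x) (Du x))
      2 (volume.restrict S.C)) atTop (𝓝 0) := by
    have hle : ∀ n, eLpNorm (fun x => P x (φ n x) (fderiv ℝ (φ n) x) - P x (u x) (Du x))
        2 (volume.restrict S.C) ≤ eLpNorm (fun x => fderiv ℝ (φ n) x - Du x) 2 (volume.restrict S.C)
          + ‖k‖ₑ * eLpNorm (fun x => φ n x - u x) 2 (volume.restrict S.C) := fun n => by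
      have m1 : AEStronglyMeasurable (fun x => fderiv ℝ (φ n) x - Du x) (volume.restrict S.C) :=
        (hφ n).continuous_fderiv.aestronglyMeasurable.sub hu.2.1.1
      have m2 : AEStronglyMeasurable (fun x => φ n x - u x) (volume.restrict S.C) :=
        (hφ n).contDiff.continuous.aestronglyMeasurable.sub hu.1.1
      calc eLpNorm (fun x => P x (φ n x) (fderiv ℝ (φ n) x) - P x (u x) (Du x))
            2 (volume.restrict S.C)
          ≤ eLpNorm ((fun x => ‖fderiv ℝ (φ n) x - Du x‖) + k • fun x => ‖φ n x - u x‖) 2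
              (volume.restrict S.C) := by
            refine eLpNorm_mono fun x => ?_
            have e1 : P x (φ n x) (fderiv ℝ (φ n) x) - P x (u x) (Du x) =
                P x (φ n x - u x) (fderiv ℝ (φ n) x - Du x) := by
              ext; simp [P]; ring
            rw [e1]
            exact hPle _ _ _
        _ ≤ _ := by
            refine (eLpNorm_add_le m1.norm (m2.norm.const_smul k) (by norm_num)).trans ?_
            rw [eLpNorm_const_smul, eLpNorm_norm, eLpNorm_norm]
    refine tendsto_of_tendsto_of_tendsto_of_le_of_le tendsto_const_nhds ?_ (fun _ => zero_le) hle
    simpa using hφD.add (ENNReal.Tendsto.const_mul hφ2 (Or.inr (enorm_ne_top (x := k))))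
  have hφη : ∀ n, IsTestField S.C fun x => η x • φ n x := fun n =>
    ⟨hη.smul (hφ n).contDiff, hηc.smul_right, (tsupport_smul_subset_left η (φ n)).trans hηC⟩
  have hfd : ∀ n x, fderiv ℝ (fun x => η x • φ n x) x = P x (φ n x) (fderiv ℝ (φ n) x) := fun n x =>
    fderiv_fun_smul (hη.differentiable (by simp) x) ((hφ n).differentiable x)
  have h4le : Tendsto (fun n => eLpNorm (fun x => η x • φ n x - η x • u x) 4 (volume.restrict S.C))
      atTop (𝓝 0) := by
    refine tendsto_of_tendsto_of_tendsto_of_le_of_le tendsto_const_nhds hφ4 (fun _ => zero_le)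
      fun n => eLpNorm_mono fun x => ?_
    rw [← smul_sub, norm_smul]
    exact mul_le_of_le_one_left (norm_nonneg _) (hηn x)
  have hηu : MemLp (fun x => η x • u x) 4 (volume.restrict S.C) :=
    h4.of_le (hηm.smul h4.1) (Eventually.of_forall fun x => by
      rw [norm_smul]; exact mul_le_of_le_one_left (norm_nonneg _) (hηn x))
  -- the limit of the right-hand sides
  have lim1 : Tendsto (fun n => ∫ x in S.C, S.pressure (ρ x) *
      divOf (fderiv ℝ (fun x => η x • φ n x) x)) atTop
      (𝓝 ((∫ x in S.C, momentumForm S ρ u Du x (P x (u x) (Du x))) -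
        ∫ x in S.C, weightForm g (ρ x) (η x • u x))) := by
    simp_rw [fun n => h.pressure_eq hu hren hρ.1 h0 (hφη n)]
    refine Tendsto.sub ?_ ?_
    · refine tendsto_integral_bilin_left (p := 2) (q := 2) evalL
        (fun n => (hφη n).fderiv_memLp 2 _) hΘ (hPmem hu.1 hu.2.1) ?_
      simp_rw [hfd]
      exact hPlim
    · exact tendsto_integral_bilin_left (p := ENNReal.ofReal (4 / 3)) (q := 4) (weightForm g)
        (fun n => (hφη n).memLp 4 _) (memLp_fourThirds hρ) hηu h4le
  -- the limit of the pressure terms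
  set U : Set E3 := {x | 4 / (9 * k) < Metric.infDist x S.Cᶜ}
  have hU : MeasurableSet U :=
    measurableSet_lt measurable_const (Metric.continuous_infDist_pt _).measurable
  have hUC : U ⊆ S.C := fun x hx => mem_of_infDist_pos (lt_trans (by positivity) hx)
  have hηU : ∀ x, x ∉ U → x ∉ tsupport η := fun x hx hx' => hx <| by
    refine lt_of_lt_of_le ?_ (show 1 / (2 * k) ≤ Metric.infDist x S.Cᶜ from hηs hx')
    rw [div_lt_div_iff₀ (by positivity) (by positivity)]
    linarith
  -- Interior integrability is used with `9k` in place of `k`: as `4/(9k) < 1/(2k)`, the set `U`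
  -- contains the support of `η`. There the pressure pairs with divergences converging in `L²`.
  have hp2 : MemLp (fun x => S.pressure (ρ x)) 2 (volume.restrict U) :=
    memLp_two_interior S.isBounded_C hp hA hΛ (by positivity)
  have hP0 : ∀ x, x ∉ U → ∀ w D, P x w D = 0 := fun x hx w D => by
    have hx' := hηU x hx
    have hd : fderiv ℝ η x = 0 := image_eq_zero_of_notMem_tsupport
      fun hm => hx' (tsupport_fderiv_subset ℝ hm)
    ext; simp [P, image_eq_zero_of_notMem_tsupport hx', hd]
  have hUrestr : ∀ (w : E3 → E3) (D : E3 → E3 →L[ℝ] E3),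
      ∫ x in S.C, S.pressure (ρ x) * divOf (P x (w x) (D x)) =
        ∫ x in U, S.pressure (ρ x) * divOf (P x (w x) (D x)) := fun w D => by
    refine setIntegral_eq_of_subset_of_forall_sdiff_eq_zero S.isOpen_C.measurableSet hUC
      fun x hx => ?_
    rw [hP0 x hx.2, ← divL_apply, map_zero, mul_zero]
  have hmonoU : volume.restrict U ≤ (volume.restrict S.C : Measure E3) :=
    Measure.restrict_mono hUC le_rfl
  have lim2 : Tendsto (fun n => ∫ x in S.C, S.pressure (ρ x) *
      divOf (fderiv ℝ (fun x => η x • φ n x) x)) atTop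
      (𝓝 (∫ x in S.C, S.pressure (ρ x) * divOf (P x (u x) (Du x)))) := by
    simp_rw [hfd, hUrestr]
    refine tendsto_integral_bilin_left (p := 2) (q := 2)
      ((ContinuousLinearMap.mul ℝ ℝ).bilinearComp (ContinuousLinearMap.id ℝ ℝ) divL)
      (fun n => (hPmem ((hφ n).memLp 2 _) ((hφ n).fderiv_memLp 2 _)).mono_measure hmonoU) hp2
      ((hPmem hu.1 hu.2.1).mono_measure hmonoU) ?_
    exact tendsto_of_tendsto_of_tendsto_of_le_of_le tendsto_const_nhds hPlim (fun _ => zero_le)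
      fun n => eLpNorm_mono_measure _ hmonoU
  rw [tendsto_nhds_unique lim1 lim2]
  -- The renormalized equation turns `∫ p u · ∇η` into `(γ - 1) ∫ p (div u) η`, whence the factor
  -- `γ` in total.
  obtain ⟨r1, r2, r3⟩ := RenormalizedContinuity.pressure hren h0
  have e1 : ∀ x, S.pressure (ρ x) * divOf (P x (u x) (Du x)) =
      S.pressure (ρ x) * divOf (Du x) * η x + S.pressure (ρ x) * fderiv ℝ η x (u x) := fun x => by
    simp only [P]
    rw [divOf_smul_add_smulRight]; ring
  have i1 : Integrable (fun x => S.pressure (ρ x) * divOf (Du x) * η x) (volume.restrict S.C) :=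
    r2.mul_bdd hηm (Eventually.of_forall hηn)
  have i2 : Integrable (fun x => S.pressure (ρ x) * fderiv ℝ η x (u x)) (volume.restrict S.C) := by
    refine (r1.norm.const_mul k).mono' (hp.1.mul ?_) (Eventually.of_forall fun x => ?_)
    · exact isBoundedBilinearMap_apply.continuous.comp_aestronglyMeasurable₂ hηdm hu.1.1
    · rw [norm_mul, norm_smul, mul_left_comm]
      gcongr
      exact ((fderiv ℝ η x).le_opNorm _).trans (by gcongr; exact hηd x)
  simp_rw [e1]
  rw [integral_add i1 i2, r3 η hη]
  ring

/-- In a steady state without rotation the fluid is at rest. -/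
theorem velocity_eq_zero (h : S.WeakMomentum ρ u 0 g u Du)
    (hu : IsSobolevZero S.C u Du) (hren : S.RenormalizedContinuity ρ u Du)
    (hρ : MemLp ρ (ENNReal.ofReal S.γ) (volume.restrict S.C))
    (h0 : ∀ᵐ x ∂volume.restrict S.C, 0 ≤ ρ x) :
    Du =ᵐ[volume.restrict S.C] 0 ∧ u =ᵐ[volume.restrict S.C] 0 := by
  have hfin := S.isFiniteMeasure_C
  suffices hD : Du =ᵐ[volume.restrict S.C] 0 from ⟨hD, hu.eq_zero S.isBounded_C hD⟩
  obtain ⟨h4, -⟩ := hu.exists_approx S.isBounded_C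
  have hΘ := memLp_momentumForm hu hren hρ.1 h0
  have hρu := hren.memLp_smul hρ.1 h0 h4
  obtain ⟨r1, r2, r3⟩ := RenormalizedContinuity.pressure hren h0
  have hk : ∀ k : ℕ, (0 : ℝ) < (k : ℝ) + 1 := fun k => by positivity
  choose η hη hη0 hη1 hηc hηs hηone hηd using fun k : ℕ => exists_cutoff S.isBounded_C (hk k)
  have hηn : ∀ k x, ‖η k x‖ ≤ 1 := fun k x => by
    rw [Real.norm_of_nonneg (hη0 k x)]; exact hη1 k x
  have hηlim : ∀ᵐ x ∂volume.restrict S.C, Tendsto (fun k => η k x) atTop (𝓝 1) := by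
    filter_upwards [ae_restrict_mem S.isOpen_C.measurableSet] with x hx
    have hd := infDist_pos_of_mem S.isOpen_C S.isBounded_C hx
    obtain ⟨k₀, hk₀⟩ := exists_nat_gt (3 / Metric.infDist x S.Cᶜ)
    refine tendsto_const_nhds.congr' ?_
    filter_upwards [eventually_ge_atTop k₀] with k hkk
    refine (hηone k x ?_).symm
    have : (k₀ : ℝ) ≤ k := by exact_mod_cast hkk
    rw [div_lt_iff₀ hd] at hk₀
    rw [div_lt_iff₀ (hk k)]
    nlinarith
  have hηm : ∀ k, AEStronglyMeasurable (η k) (volume.restrict S.C) := fun k =>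
    (hη k).continuous.aestronglyMeasurable
  have hdct : ∀ {f : E3 → ℝ}, Integrable f (volume.restrict S.C) →
      Tendsto (fun k => ∫ x in S.C, f x * η k x) atTop (𝓝 (∫ x in S.C, f x)) := fun {f} hf => by
    refine tendsto_integral_of_dominated_convergence (fun x => ‖f x‖)
      (fun k => hf.1.mul (hηm k)) hf.norm (fun k => Eventually.of_forall fun x => ?_) ?_
    · rw [norm_mul]; exact mul_le_of_le_one_right (norm_nonneg _) (hηn k x)
    · filter_upwards [hηlim] with x hx
      simpa using hx.const_mul (f x)
  have iΘ : Integrable (fun x => momentumForm S ρ u Du x (Du x)) (volume.restrict S.C) :=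
    memLp_one_iff_integrable.1 (memLp_bilin (p := 2) (q := 2) evalL hΘ hu.2.1)
  have iw : Integrable (fun x => weightForm g (ρ x) (u x)) (volume.restrict S.C) :=
    memLp_one_iff_integrable.1 (memLp_bilin (p := ENNReal.ofReal (4 / 3)) (q := 4) (weightForm g)
      (memLp_fourThirds hρ) h4)
  -- the error produced by the cut-off
  let Z : ℕ → E3 → E3 →L[ℝ] E3 := fun k x => (fderiv ℝ (η k) x).smulRight (u x)
  have hZm : ∀ k, AEStronglyMeasurable (Z k) (volume.restrict S.C) := fun k =>
    (ContinuousLinearMap.smulRightL ℝ E3 E3).aestronglyMeasurable_comp₂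
      ((hη k).continuous_fderiv (by simp)).aestronglyMeasurable hu.1.1
  have hZmem : ∀ k, MemLp (Z k) 2 (volume.restrict S.C) := fun k => by
    refine MemLp.of_le (hu.1.norm.const_mul ((k : ℝ) + 1)) (hZm k) (Eventually.of_forall fun x => ?_)
    rw [ContinuousLinearMap.norm_smulRight_apply,
      Real.norm_of_nonneg (mul_nonneg (hk k).le (norm_nonneg _))]
    gcongr
    exact hηd k x
  -- `Z k` vanishes outside the layer of depth `3/(k+1)` and is at most `(k+1) ‖u‖` inside it, so
  -- the Hardy-type estimate applies.
  have hZlim : Tendsto (fun k => eLpNorm (fun x => Z k x - (fun _ => 0) x) 2 (volume.restrict S.C))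
      atTop (𝓝 0) := by
    have hlayer := hu.tendsto_boundary_layer S.isOpen_C S.convex_C S.nonempty_C S.isBounded_C
    refine tendsto_of_tendsto_of_tendsto_of_le_of_le tendsto_const_nhds hlayer (fun _ => zero_le)
      fun k => ?_
    set N : Set E3 := {x | Metric.infDist x S.Cᶜ ≤ 3 / ((k : ℝ) + 1)}
    have hN : MeasurableSet N :=
      measurableSet_le (Metric.continuous_infDist_pt _).measurable measurable_const
    have hsub : ∀ x, ‖Z k x - (fun _ => 0) x‖ ≤ ‖N.indicator (fun x => ((k : ℝ) + 1) • u x) x‖ := by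
      intro x
      by_cases hx : x ∈ N
      · rw [indicator_of_mem hx, norm_smul, Real.norm_of_nonneg (hk k).le, sub_zero,
          ContinuousLinearMap.norm_smulRight_apply]
        gcongr
        exact hηd k x
      · have hd : fderiv ℝ (η k) x = 0 := by
          have hx' : 3 / ((k : ℝ) + 1) < Metric.infDist x S.Cᶜ := not_le.1 fun h => hx h
          have : η k =ᶠ[𝓝 x] fun _ => 1 := by
            filter_upwards [(isOpen_lt continuous_const
              (Metric.continuous_infDist_pt S.Cᶜ)).mem_nhds hx'] with y hy
            exact hηone k y hy
          rw [this.fderiv_eq]; simp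
        have hZ0 : Z k x = 0 := by ext; simp [Z, hd]
        rw [hZ0]; simp
    refine (eLpNorm_mono hsub).trans (le_of_eq ?_)
    rw [eLpNorm_indicator_eq_eLpNorm_restrict hN, Measure.restrict_restrict hN, inter_comm]
    have e1 : (fun x => ((k : ℝ) + 1) • u x) = ((k : ℝ) + 1) • u := rfl
    rw [e1, eLpNorm_const_smul, Real.enorm_eq_ofReal (hk k).le,
      ENNReal.ofReal_add (by positivity) zero_le_one]
    simp [N]
  have hZint : Tendsto (fun k => ∫ x in S.C, momentumForm S ρ u Du x (Z k x)) atTop (𝓝 0) := by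
    have := tendsto_integral_bilin_left (p := 2) (q := 2) (ν := volume.restrict S.C) evalL
      (g₀ := fun _ => (0 : E3 →L[ℝ] E3)) hZmem hΘ (MemLp.zero' ) hZlim
    simpa using! this
  -- pass to the limit
  have hid : ∀ k, (∫ x in S.C, momentumForm S ρ u Du x (Du x) * η k x) +
      (∫ x in S.C, momentumForm S ρ u Du x (Z k x)) -
      (∫ x in S.C, weightForm g (ρ x) (u x) * η k x) =
        S.γ * ∫ x in S.C, S.pressure (ρ x) * divOf (Du x) * η k x := fun k => by
    rw [← h.cutoff_eq hu hren hρ h0 (hk k) (hη k) (hη0 k) (hη1 k) (hηc k) (hηs k) (hηd k)]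
    congr 1
    · have iZ : Integrable (fun x => momentumForm S ρ u Du x (Z k x)) (volume.restrict S.C) :=
        memLp_one_iff_integrable.1 (memLp_bilin (p := 2) (q := 2) evalL hΘ (hZmem k))
      rw [← integral_add (iΘ.mul_bdd (hηm k) (Eventually.of_forall (hηn k))) iZ]
      refine integral_congr_ae (Eventually.of_forall fun x => ?_)
      simp only [map_add, map_smul, smul_eq_mul]
      rw [mul_comm (η k x)]
    · refine integral_congr_ae (Eventually.of_forall fun x => ?_)
      simp only [map_smul, smul_eq_mul]
      ring
  have hl := ((hdct iΘ).add hZint).sub (hdct iw)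
  simp_rw [hid] at hl
  have hfinal := tendsto_nhds_unique hl ((hdct r2).const_mul S.γ)
  -- In the limit identity all terms but the dissipation vanish: the pressure by testing with `ψ =
  -- 1`, gravity by testing with `ψ(x) = g · x`, and convection by `integral_convective_eq_zero`.
  have hdiv : ∫ x in S.C, S.pressure (ρ x) * divOf (Du x) = 0 := by
    have h1 := r3 (fun _ => 1) contDiff_const
    have h2 : S.γ - 1 ≠ 0 := by linarith [S.γ_gt_one]
    simpa [h2] using h1
  have hgrav : ∫ x in S.C, weightForm g (ρ x) (u x) = 0 := by
    have := hren.continuity (innerSL ℝ g).contDiff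
    simp only [ContinuousLinearMap.fderiv] at this
    simpa using this
  have hconv := integral_convective_eq_zero S.isBounded_C hu hren hρ.1 h0
  have i1 : Integrable (fun x => stressForm S.μ S.lam (Du x) (Du x))
      (volume.restrict S.C) := memLp_one_iff_integrable.1
    (memLp_bilin (p := 2) (q := 2) _ hu.2.1 hu.2.1)
  have i2 : Integrable (fun x => evalForm (u x) (ρ x • u x) (Du x))
      (volume.restrict S.C) := memLp_one_iff_integrable.1
    (memLp_bilin (p := 2) (q := 2) evalL
      (memLp_bilin (p := 4) (q := 4) evalForm h4 hρu) hu.2.1)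
  have hstress : ∫ x in S.C, contract (stress S.μ S.lam (Du x)) (gradMatrix (Du x)) = 0 := by
    have e1 : ∫ x in S.C, momentumForm S ρ u Du x (Du x) =
        (∫ x in S.C, stressForm S.μ S.lam (Du x) (Du x)) -
          ∫ x in S.C, evalForm (u x) (ρ x • u x) (Du x) := integral_sub i1 i2
    rw [e1, hconv, hgrav, hdiv] at hfinal
    simpa using hfinal
  have hkorn := hu.integral_stress_ge S.μ_pos S.lam_nonneg
  rw [hstress] at hkorn
  have ifrob : Integrable (fun x => frobForm (Du x) (Du x)) (volume.restrict S.C) :=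
    memLp_one_iff_integrable.1 (memLp_bilin (p := 2) (q := 2)
      isBilinearMap_frobForm.toContinuousBilinearMap hu.2.1 hu.2.1)
  have hnn : 0 ≤ᵐ[volume.restrict S.C] fun x => frobForm (Du x) (Du x) :=
    Eventually.of_forall fun x => frobForm_self_nonneg _
  have hzero : ∫ x in S.C, frobForm (Du x) (Du x) = 0 := by
    refine le_antisymm ?_ (integral_nonneg_of_ae hnn)
    by_contra! hpos
    linarith [mul_pos S.μ_pos hpos]
  filter_upwards [(integral_eq_zero_iff_of_nonneg_ae hnn ifrob).1 hzero] with x hx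
  have h1 := norm_sq_le_frobForm (Du x)
  rw [hx] at h1
  exact norm_eq_zero.1 (pow_eq_zero_iff two_ne_zero |>.1 (le_antisymm h1 (sq_nonneg _)))

end System

end Pendulum

/-! ### Mollification inside the cavity. -/

namespace Pendulum

open scoped ENNReal NNReal ContDiff Convolution

section Mollify

/-- A sequence of mollifiers. -/
noncomputable def bump (n : ℕ) : ContDiffBump (0 : E3) where
  rIn := 1 / (2 * ((n : ℝ) + 1))
  rOut := 1 / ((n : ℝ) + 1)
  rIn_pos := by positivity
  rIn_lt_rOut := by
    rw [div_lt_div_iff₀ (by positivity) (by positivity)]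
    have : (0 : ℝ) < (n : ℝ) + 1 := by positivity
    linarith

theorem bump_rOut (n : ℕ) : (bump n).rOut = 1 / ((n : ℝ) + 1) := rfl

theorem tendsto_bump_rOut : Tendsto (fun n => (bump n).rOut) atTop (𝓝 0) :=
  tendsto_one_div_add_atTop_nhds_zero_nat

/-- The mollification of a function on `C`, extended by zero. -/
noncomputable def moll (C : Set E3) (f : E3 → ℝ) (n : ℕ) : E3 → ℝ :=
  (bump n).normed volume ⋆[ContinuousLinearMap.lsmul ℝ ℝ, volume] C.indicator f

variable {C : Set E3} {f : E3 → ℝ} {n : ℕ}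

theorem moll_eq (hC : MeasurableSet C) (x : E3) :
    moll C f n x = ∫ y in C, f y * (bump n).normed volume (x - y) := by
  rw [moll, convolution_eq_swap, ← integral_indicator hC]
  refine integral_congr_ae (Eventually.of_forall fun y => ?_)
  by_cases hy : y ∈ C <;> simp [hy, mul_comm]

theorem ae_tendsto_moll (hC : MeasurableSet C) (hf : IntegrableOn f C) :
    ∀ᵐ x ∂volume.restrict C, Tendsto (fun n => moll C f n x) atTop (𝓝 (f x)) := by
  have h := ContDiffBump.ae_convolution_tendsto_right_of_locallyIntegrable (μ := volume)
    (φ := bump) (K := 2) tendsto_bump_rOut (Eventually.of_forall fun n => by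
      simp only [bump]; apply le_of_eq; field_simp)
    ((integrable_indicator_iff hC).2 hf).locallyIntegrable
  filter_upwards [ae_restrict_of_ae h, ae_restrict_mem hC] with x hx hxC
  rwa [indicator_of_mem hxC] at hx

theorem moll_nonneg (hC : MeasurableSet C) (h0 : ∀ᵐ x ∂volume.restrict C, 0 ≤ f x) (x : E3) :
    0 ≤ moll C f n x := by
  rw [moll_eq hC]
  refine integral_nonneg_of_ae ?_
  filter_upwards [h0] with y hy
  exact mul_nonneg hy ((bump n).nonneg_normed _)

theorem dist_moll_le (hC : MeasurableSet C) (hf : IntegrableOn f C) {x : E3} {z ε : ℝ} (hε : 0 ≤ ε)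
    (h : ∀ y ∈ Metric.ball x (1 / ((n : ℝ) + 1)), y ∈ C ∧ dist (f y) z ≤ ε) :
    dist (moll C f n x) z ≤ ε := by
  refine dist_convolution_le hε (bump n).support_normed_eq.subset (bump n).nonneg_normed
    (bump n).integral_normed ((integrable_indicator_iff hC).2 hf).1 fun y hy => ?_
  rw [indicator_of_mem (h y hy).1]
  exact (h y hy).2

/-- The condition `0 ≤ B` accounts for the mass of the mollifier falling outside `C`, where the
extension is zero. -/
theorem moll_le (hC : MeasurableSet C) (hf : IntegrableOn f C) {x : E3} {B : ℝ} {N : Set E3}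
    (hN : Metric.ball x (1 / ((n : ℝ) + 1)) ⊆ N)
    (hB : ∀ᵐ y ∂volume.restrict C, y ∈ N → f y ≤ B) (hB0 : 0 ≤ B) : moll C f n x ≤ B := by
  rw [moll_eq hC]
  have hc : Continuous fun y => (bump n).normed volume (x - y) :=
    (bump n).continuous_normed.comp (by fun_prop)
  have hi : Integrable fun y => (bump n).normed volume (x - y) :=
    ((bump n).integrable_normed (μ := volume)).comp_sub_left x
  obtain ⟨M, hM⟩ := (bump n).continuous_normed.bounded_above_of_compact_support
    ((bump n).hasCompactSupport_normed (μ := volume))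
  calc ∫ y in C, f y * (bump n).normed volume (x - y)
      ≤ ∫ y in C, B * (bump n).normed volume (x - y) := by
        refine integral_mono_ae
          (hf.mul_bdd hc.aestronglyMeasurable (Eventually.of_forall fun y => hM _))
          ((hi.const_mul B).integrableOn) ?_
        filter_upwards [hB] with y hy
        by_cases hyb : y ∈ Metric.ball x (1 / ((n : ℝ) + 1))
        · exact mul_le_mul_of_nonneg_right (hy (hN hyb)) ((bump n).nonneg_normed _)
        · have : (bump n).normed volume (x - y) = 0 := by
            by_contra h0
            have hmem : x - y ∈ Function.support ((bump n).normed (volume : Measure E3)) := h0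
            rw [(bump n).support_normed_eq, mem_ball_zero_iff, bump_rOut, ← dist_eq_norm,
              dist_comm] at hmem
            exact hyb hmem
          simp [this]
    _ ≤ ∫ y, B * (bump n).normed volume (x - y) :=
        setIntegral_le_integral (hi.const_mul B)
          (Eventually.of_forall fun y => mul_nonneg hB0 ((bump n).nonneg_normed _))
    _ = B := by
        rw [integral_const_mul, integral_sub_left_eq_self (fun y => (bump n).normed volume y),
          (bump n).integral_normed, mul_one]

theorem hasFDerivAt_moll (hC : MeasurableSet C) (hf : IntegrableOn f C) (x : E3) :
    HasFDerivAt (moll C f n)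
      (∫ y in C, f y • fderiv ℝ ((bump n).normed (volume : Measure E3)) (x - y)) x := by
  set ζ := (bump n).normed (volume : Measure E3)
  have hζ : ContDiff ℝ ∞ ζ := (bump n).contDiff_normed
  have hζc : HasCompactSupport ζ := (bump n).hasCompactSupport_normed
  have hζd : Continuous (fderiv ℝ ζ) := hζ.continuous_fderiv (by simp)
  obtain ⟨M, hM⟩ := hζ.continuous.bounded_above_of_compact_support hζc
  obtain ⟨M', hM'⟩ := hζd.bounded_above_of_compact_support (hζc.fderiv (𝕜 := ℝ))
  have e1 : moll C f n = fun x => ∫ y in C, f y * ζ (x - y) := funext fun x => moll_eq hC x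
  have hc : ∀ x : E3, AEStronglyMeasurable (fun y => ζ (x - y)) (volume.restrict C) := fun x =>
    (hζ.continuous.comp (by fun_prop)).aestronglyMeasurable
  rw [e1]
  refine hasFDerivAt_integral_of_dominated_of_fderiv_le (𝕜 := ℝ)
    (F := fun x y => f y * ζ (x - y)) (F' := fun x y => f y • fderiv ℝ ζ (x - y))
    (bound := fun y => |f y| * M') (s := univ) univ_mem
    (Eventually.of_forall fun x => hf.1.mul (hc x))
    (hf.mul_bdd (hc x) (Eventually.of_forall fun y => hM _)) ?_ ?_ (hf.abs.mul_const _) ?_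
  · have h1 : Continuous fun y => fderiv ℝ ζ (x - y) :=
      hζd.comp (continuous_const.sub continuous_id)
    exact hf.1.smul h1.aestronglyMeasurable
  · refine Eventually.of_forall fun y z _ => ?_
    rw [norm_smul, Real.norm_eq_abs]
    gcongr
    exact hM' _
  · refine Eventually.of_forall fun y z _ => ?_
    have := (hζ.differentiable (by simp) (z - y)).hasFDerivAt.comp z
      ((hasFDerivAt_id z).sub_const y)
    simpa using! this.const_mul (f y)

end Mollify

/-! ### Regularity of hydrostatic pressures. -/

section Hydrostatics

variable {C : Set E3} {p ρ : E3 → ℝ} {g : E3}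

/-- The weak form of `∇ p = ρ g`. -/
def IsHydrostatic (C : Set E3) (p ρ : E3 → ℝ) (g : E3) : Prop :=
  ∀ φ : E3 → E3, IsTestField C φ →
    ∫ x in C, p x * divOf (fderiv ℝ φ x) = -∫ x in C, ρ x * inner ℝ g (φ x)

theorem ball_subset_of_le_infDist {x : E3} {r : ℝ} (h : r ≤ Metric.infDist x Cᶜ) :
    Metric.ball x r ⊆ C := fun y hy => by
  by_contra hyC
  have := Metric.infDist_le_dist_of_mem (x := x) (show y ∈ Cᶜ from hyC)
  rw [Metric.mem_ball, dist_comm] at hy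
  linarith

theorem divOf_smulRight (l : E3 →L[ℝ] ℝ) (w : E3) : divOf (l.smulRight w) = l w := by
  have h := divOf_smul_add_smulRight 0 0 l w
  have h0 : (0 : ℝ) • (0 : E3 →L[ℝ] E3) + l.smulRight w = l.smulRight w := by ext; simp
  rwa [h0, zero_mul, zero_add] at h

/-- The weak equation is tested with `y ↦ ζ(x - y) k`, which is supported in `C` as long as `x` is
farther from the complement than the mollification radius. Thus `∇p = ρ g` holds classically for the
mollified functions. -/
theorem IsHydrostatic.hasFDerivAt_moll (h : IsHydrostatic C p ρ g) (hC : IsOpen C)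
    (hp : IntegrableOn p C) {n : ℕ} {x : E3}
    (hx : 1 / ((n : ℝ) + 1) < Metric.infDist x Cᶜ) :
    HasFDerivAt (moll C p n) (moll C ρ n x • innerSL ℝ g) x := by
  refine (Pendulum.hasFDerivAt_moll hC.measurableSet hp x).congr_fderiv ?_
  set ζ := (bump n).normed (volume : Measure E3)
  have hζ : ContDiff ℝ ∞ ζ := (bump n).contDiff_normed
  have hζc : HasCompactSupport ζ := (bump n).hasCompactSupport_normed
  have hζd : Continuous (fderiv ℝ ζ) := hζ.continuous_fderiv (by simp)
  obtain ⟨M', hM'⟩ := hζd.bounded_above_of_compact_support (hζc.fderiv (𝕜 := ℝ))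
  have hint : Integrable (fun y => p y • fderiv ℝ ζ (x - y)) (volume.restrict C) := by
    have h1 : Continuous fun y => fderiv ℝ ζ (x - y) :=
      hζd.comp (continuous_const.sub continuous_id)
    refine (hp.abs.mul_const M').mono' (hp.1.smul h1.aestronglyMeasurable)
      (Eventually.of_forall fun y => ?_)
    rw [norm_smul, Real.norm_eq_abs]
    gcongr
    exact hM' _
  ext1 k
  rw [ContinuousLinearMap.integral_apply hint]
  have hts : tsupport (fun y => ζ (x - y) • k) ⊆ Metric.closedBall x (1 / ((n : ℝ) + 1)) := by
    refine closure_minimal (fun y hy => ?_) Metric.isClosed_closedBall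
    have hy' : x - y ∈ Function.support ζ := fun h0 => hy (by simp [h0])
    rw [(bump n).support_normed_eq, mem_ball_zero_iff, bump_rOut, ← dist_eq_norm, dist_comm] at hy'
    exact hy'.le
  have htest : IsTestField C fun y => ζ (x - y) • k := by
    refine ⟨(hζ.comp (contDiff_const.sub contDiff_id)).smul contDiff_const, ?_, ?_⟩
    · exact IsCompact.of_isClosed_subset (isCompact_closedBall _ _) (isClosed_tsupport _) hts
    · refine hts.trans fun y hy => ?_
      exact ball_subset_of_le_infDist le_rfl (lt_of_le_of_lt hy hx)
  have hfd : ∀ y, fderiv ℝ (fun y => ζ (x - y) • k) y =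
      (-fderiv ℝ ζ (x - y)).smulRight k := fun y => by
    have h1 := (hζ.differentiable (by simp) (x - y)).hasFDerivAt.comp y
      ((hasFDerivAt_id y).const_sub x)
    have h2 := h1.smul_const k
    refine h2.fderiv.trans ?_
    ext; simp
  have hh := h _ htest
  simp_rw [hfd, divOf_smulRight] at hh
  simp only [neg_apply, mul_neg, integral_neg, neg_inj] at hh
  simp only [smul_apply, smul_eq_mul]
  rw [hh, moll_eq hC.measurableSet, innerSL_apply_apply, ← integral_mul_const]
  refine integral_congr_ae (Eventually.of_forall fun y => ?_)
  simp only [inner_smul_right]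
  ring

/-- Were some `w ∉ C` too close to `z`, the translates of `x` and `y` by `w - z` would still lie in
`C`, and `w` is on the segment between them. -/
theorem lt_infDist_of_segment (hconv : Convex ℝ C) (hb : Bornology.IsBounded C) {x y z : E3} {δ : ℝ}
    (hx : δ < Metric.infDist x Cᶜ) (hy : δ < Metric.infDist y Cᶜ) (hz : z ∈ segment ℝ x y) :
    δ < Metric.infDist z Cᶜ := by
  set r := min (Metric.infDist x Cᶜ) (Metric.infDist y Cᶜ)
  refine lt_of_lt_of_le (lt_min hx hy) ((Metric.le_infDist (nonempty_compl_of_isBounded hb)).2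
    fun w hw => ?_)
  by_contra! hlt
  obtain ⟨a, b, ha, hb', hab, rfl⟩ := hz
  refine hw ?_
  have h1 : x + (w - (a • x + b • y)) ∈ C := by
    refine ball_subset_of_le_infDist (x := x) (r := r) (min_le_left _ _) ?_
    rwa [mem_ball_iff_norm, add_sub_cancel_left, ← dist_eq_norm, dist_comm]
  have h2 : y + (w - (a • x + b • y)) ∈ C := by
    refine ball_subset_of_le_infDist (x := y) (r := r) (min_le_right _ _) ?_
    rwa [mem_ball_iff_norm, add_sub_cancel_left, ← dist_eq_norm, dist_comm]
  have h3 := hconv h1 h2 ha hb' hab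
  convert h3 using 1
  rw [smul_add, smul_add, show a • x + a • (w - (a • x + b • y)) +
    (b • y + b • (w - (a • x + b • y))) = a • x + b • y + (a • (w - (a • x + b • y)) +
      b • (w - (a • x + b • y))) by abel, ← add_smul, hab, one_smul]
  abel

/-- Along a segment in a region where the derivative is `r g` with `r ≥ 0`, a function is monotone in
the direction of `g`. -/
theorem le_of_hasFDerivAt_smul {f r : E3 → ℝ} {x y : E3}
    (hf : ∀ z ∈ segment ℝ x y, HasFDerivAt f (r z • innerSL ℝ g) z)
    (hr : ∀ z ∈ segment ℝ x y, 0 ≤ r z) (hxy : inner ℝ g x ≤ inner ℝ g y) : f x ≤ f y := by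
  have hseg : ∀ t ∈ Icc (0 : ℝ) 1, x + t • (y - x) ∈ segment ℝ x y := fun t ht => by
    rw [segment_eq_image']; exact ⟨t, ht, rfl⟩
  have hder : ∀ t ∈ Icc (0 : ℝ) 1, HasDerivAt (fun t : ℝ => f (x + t • (y - x)))
      (r (x + t • (y - x)) * inner ℝ g (y - x)) t := fun t ht => by
    have h1 : HasDerivAt (fun t : ℝ => x + t • (y - x)) (y - x) t := by
      simpa using ((hasDerivAt_id t).smul_const (y - x)).const_add x
    exact (hf _ (hseg t ht)).comp_hasDerivAt t h1
  have hm : MonotoneOn (fun t : ℝ => f (x + t • (y - x))) (Icc 0 1) := by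
    refine monotoneOn_of_deriv_nonneg (convex_Icc 0 1)
      (fun t ht => (hder t ht).continuousAt.continuousWithinAt)
      (fun t ht => (hder t (interior_subset ht)).differentiableAt.differentiableWithinAt)
      fun t ht => ?_
    rw [(hder t (interior_subset ht)).deriv, inner_sub_right]
    exact mul_nonneg (hr _ (hseg t (interior_subset ht))) (by linarith)
  simpa using hm (left_mem_Icc.2 zero_le_one) (right_mem_Icc.2 zero_le_one) zero_le_one

theorem exists_ae_of_ball {C : Set E3} {Q : E3 → Prop} (h : ∀ᵐ x ∂volume.restrict C, Q x) {z : E3}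
    {r : ℝ} (hr : 0 < r) (hball : Metric.ball z r ⊆ C) : ∃ y ∈ Metric.ball z r, Q y := by
  have h1 : ∀ᵐ x ∂volume.restrict (Metric.ball z r), Q x :=
    ae_mono (Measure.restrict_mono hball le_rfl) h
  have : NeBot (ae (volume.restrict (Metric.ball z r) : Measure E3)) := by
    rw [ae_neBot, Ne, Measure.restrict_eq_zero]
    exact (Metric.measure_ball_pos volume z hr).ne'
  obtain ⟨y, hy, hyQ⟩ := ((ae_restrict_mem Metric.isOpen_ball.measurableSet).and h1).exists
  exact ⟨y, hy, hyQ⟩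

/-- A hydrostatic pressure is locally essentially bounded. -/
theorem IsHydrostatic.exists_local_bound (h : IsHydrostatic C p ρ g) (hC : IsOpen C)
    (hconv : Convex ℝ C) (hb : Bornology.IsBounded C) (hp : IntegrableOn p C)
    (hρ0 : ∀ᵐ x ∂volume.restrict C, 0 ≤ ρ x) {x₀ : E3} (hx₀ : x₀ ∈ C) :
    ∃ B, ∀ᵐ x ∂volume.restrict C,
      x ∈ Metric.ball x₀ (Metric.infDist x₀ Cᶜ / 4) → p x ≤ B := by
  set d := Metric.infDist x₀ Cᶜ
  have hd : 0 < d := infDist_pos_of_mem hC hb hx₀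
  -- Shifting by `(d/2) w` gains `(d/2) ‖g‖` in the direction of `g`, and the two radii `d/4` lose
  -- at most as much. So every point of the shifted ball lies at least as far along `g` as any point
  -- of the original ball, and a single value of the pressure there is an upper bound.
  obtain ⟨w, hw1, hw2⟩ : ∃ w : E3, ‖w‖ ≤ 1 ∧ inner ℝ g w = ‖g‖ := by
    by_cases hg : g = 0
    · exact ⟨0, by simp, by simp [hg]⟩
    · refine ⟨‖g‖⁻¹ • g, ?_, ?_⟩
      · rw [norm_smul, norm_inv, norm_norm, inv_mul_cancel₀ (norm_ne_zero_iff.2 hg)]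
      · rw [inner_smul_right, real_inner_self_eq_norm_sq]
        have := norm_ne_zero_iff.2 hg
        field_simp
  have hinf : ∀ x, dist x x₀ < 3 / 4 * d → d / 4 < Metric.infDist x Cᶜ := fun x hx => by
    have : d ≤ Metric.infDist x Cᶜ + dist x₀ x := Metric.infDist_le_infDist_add_dist
    rw [dist_comm] at this
    linarith
  have hN' : ∀ y ∈ Metric.ball (x₀ + (d / 2) • w) (d / 4), dist y x₀ < 3 / 4 * d := fun y hy => by
    have h1 : dist (x₀ + (d / 2) • w) x₀ ≤ d / 2 := by
      rw [dist_eq_norm, add_sub_cancel_left, norm_smul, Real.norm_of_nonneg (by positivity)]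
      exact mul_le_of_le_one_right (by positivity) hw1
    have := dist_triangle y (x₀ + (d / 2) • w) x₀
    rw [Metric.mem_ball] at hy
    linarith
  have hae := ae_tendsto_moll hC.measurableSet hp
  obtain ⟨y, hy, hylim⟩ := exists_ae_of_ball hae (z := x₀ + (d / 2) • w) (r := d / 4) (by positivity)
    fun y hy => mem_of_infDist_pos (lt_trans (by positivity) (hinf y (hN' y hy)))
  refine ⟨p y, ?_⟩
  filter_upwards [hae] with x hxlim hx
  rw [Metric.mem_ball] at hx
  have hxi := hinf x (by linarith)
  have hyi := hinf y (hN' y hy)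
  have hxy : inner ℝ g x ≤ inner ℝ g y := by
    have e1 : y - x = (d / 2) • w + ((y - (x₀ + (d / 2) • w)) - (x - x₀)) := by abel
    have e2 : |inner ℝ g ((y - (x₀ + (d / 2) • w)) - (x - x₀))| ≤ ‖g‖ * (d / 4 + d / 4) := by
      refine (abs_real_inner_le_norm _ _).trans ?_
      gcongr
      refine (norm_sub_le _ _).trans (add_le_add ?_ ?_)
      · rw [← dist_eq_norm]; exact hy.le
      · rw [← dist_eq_norm]; exact hx.le
    have e3 : inner ℝ g (y - x) = d / 2 * ‖g‖ +
        inner ℝ g ((y - (x₀ + (d / 2) • w)) - (x - x₀)) := by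
      rw [e1, inner_add_right, inner_smul_right, hw2]
    rw [inner_sub_right] at e3
    have := (abs_le.1 e2).1
    nlinarith
  refine le_of_tendsto_of_tendsto hxlim hylim ?_
  filter_upwards [tendsto_bump_rOut.eventually (gt_mem_nhds (show 0 < d / 4 by positivity))]
    with n hn
  rw [bump_rOut] at hn
  have hseg : ∀ z ∈ segment ℝ x y, 1 / ((n : ℝ) + 1) < Metric.infDist z Cᶜ := fun z hz =>
    hn.trans (lt_infDist_of_segment hconv hb hxi hyi hz)
  exact le_of_hasFDerivAt_smul (fun z hz => h.hasFDerivAt_moll hC hp (hseg z hz))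
    (fun z _ => moll_nonneg hC.measurableSet hρ0 z) hxy

/-- If the density is a continuous function of the pressure, a hydrostatic pressure has a
differentiable representative. -/
theorem IsHydrostatic.exists_regular (h : IsHydrostatic C p ρ g) (hC : IsOpen C)
    (hconv : Convex ℝ C) (hb : Bornology.IsBounded C) (hp : IntegrableOn p C)
    (hρ : IntegrableOn ρ C) (hρ0 : ∀ᵐ x ∂volume.restrict C, 0 ≤ ρ x)
    {F : ℝ → ℝ} (hF : Continuous F) (hFm : Monotone F) (hρF : ∀ᵐ x ∂volume.restrict C, ρ x = F (p x)) :
    ∃ q : E3 → ℝ, (∀ᵐ x ∂volume.restrict C, p x = q x) ∧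
      ∀ x ∈ C, HasFDerivAt q (F (q x) • innerSL ℝ g) x := by
  have hae := ae_tendsto_moll hC.measurableSet hp
  have hn : ∀ δ : ℝ, 0 < δ → ∀ᶠ n : ℕ in atTop, 1 / ((n : ℝ) + 1) < δ := fun δ hδ =>
    tendsto_bump_rOut.eventually (gt_mem_nhds hδ)
  -- uniform Lipschitz bounds
  have hlip : ∀ x₀ ∈ C, ∃ r > 0, ∃ L, 0 ≤ L ∧ Metric.ball x₀ r ⊆ C ∧ ∀ᶠ n in atTop,
      ∀ x ∈ Metric.ball x₀ r, ∀ y ∈ Metric.ball x₀ r,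
        ‖moll C p n y - moll C p n x‖ ≤ L * ‖y - x‖ := by
    intro x₀ hx₀
    have hd : 0 < Metric.infDist x₀ Cᶜ := infDist_pos_of_mem hC hb hx₀
    set d := Metric.infDist x₀ Cᶜ
    -- A bound on `p` bounds `ρ = F(p)`, hence the gradients of the mollified pressures, uniformly
    -- in `n`. Points within `d/8` of `x₀`, mollified at radius below `d/8`, only see the ball of
    -- radius `d/4` where `B` is valid.
    obtain ⟨B, hB⟩ := h.exists_local_bound hC hconv hb hp hρ0 hx₀
    refine ⟨d / 8, by positivity, max (F B) 0 * ‖g‖, by positivity,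
      ball_subset_of_le_infDist (by linarith), ?_⟩
    filter_upwards [hn (d / 8) (by positivity)] with n hnd x hx y hy
    have hder : ∀ z ∈ Metric.ball x₀ (d / 8), HasFDerivWithinAt (moll C p n)
        (moll C ρ n z • innerSL ℝ g) (Metric.ball x₀ (d / 8)) z := fun z hz => by
      refine (h.hasFDerivAt_moll hC hp ?_).hasFDerivWithinAt
      have : d ≤ Metric.infDist z Cᶜ + dist x₀ z := Metric.infDist_le_infDist_add_dist
      rw [Metric.mem_ball, dist_comm] at hz
      linarith
    refine (convex_ball x₀ (d / 8)).norm_image_sub_le_of_norm_hasFDerivWithin_le hder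
      (fun z hz => ?_) hx hy
    rw [norm_smul, innerSL_apply_norm, Real.norm_of_nonneg (moll_nonneg hC.measurableSet hρ0 z)]
    gcongr
    refine moll_le hC.measurableSet hρ (N := Metric.ball x₀ (d / 4)) ?_ ?_ (le_max_right _ _)
    · refine Metric.ball_subset_ball' ?_
      rw [Metric.mem_ball] at hz
      linarith
    · filter_upwards [hB, hρF] with w hw hw' hwN
      rw [hw']
      exact (hFm (hw hwN)).trans (le_max_left _ _)
  -- convergence everywhere
  have hconv' : ∀ x ∈ C, ∃ z, Tendsto (fun n => moll C p n x) atTop (𝓝 z) := by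
    intro x hx
    obtain ⟨r, hr, L, hL, hrC, hl⟩ := hlip x hx
    -- Uniform Lipschitz bounds carry the Cauchy property from nearby points of almost everywhere
    -- convergence to `x`.
    refine cauchySeq_tendsto_of_complete (Metric.cauchySeq_iff'.2 fun ε hε => ?_)
    have hr' : 0 < min r (ε / (4 * (L + 1))) := lt_min hr (by positivity)
    obtain ⟨y, hy, hylim⟩ := exists_ae_of_ball hae hr'
      ((Metric.ball_subset_ball (min_le_left _ _)).trans hrC)
    have hyr : y ∈ Metric.ball x r := Metric.ball_subset_ball (min_le_left _ _) hy
    have hyε : L * dist y x ≤ ε / 4 := by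
      have h1 : dist y x < ε / (4 * (L + 1)) := lt_of_lt_of_le hy (min_le_right _ _)
      calc L * dist y x ≤ (L + 1) * (ε / (4 * (L + 1))) := by gcongr; linarith
        _ = ε / 4 := by field_simp
    obtain ⟨N₀, hN₀⟩ := eventually_atTop.1 hl
    obtain ⟨N₂, hN₂⟩ := Metric.cauchySeq_iff.1 hylim.cauchySeq (ε / 4) (by positivity)
    refine ⟨max N₀ N₂, fun n hnN => ?_⟩
    have a1 := hN₀ n (le_trans (le_max_left _ _) hnN) x (Metric.mem_ball_self hr) y hyr
    have a2 := hN₀ (max N₀ N₂) (le_max_left _ _) x (Metric.mem_ball_self hr) y hyr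
    have a3 := hN₂ n (le_trans (le_max_right _ _) hnN) (max N₀ N₂) (le_max_right _ _)
    rw [← dist_eq_norm, ← dist_eq_norm] at a1 a2
    have t1 := dist_triangle4 (moll C p n x) (moll C p n y) (moll C p (max N₀ N₂) y)
      (moll C p (max N₀ N₂) x)
    rw [dist_comm (moll C p n y)] at a1
    linarith
  choose! q hq using hconv'
  have hpq : ∀ᵐ x ∂volume.restrict C, p x = q x := by
    filter_upwards [hae, ae_restrict_mem hC.measurableSet] with x hx hxC
    exact tendsto_nhds_unique hx (hq x hxC)
  have hqc : ∀ x ∈ C, ContinuousAt q x := by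
    intro x hx
    obtain ⟨r, hr, L, hL, hrC, hl⟩ := hlip x hx
    have hle : ∀ y ∈ Metric.ball x r, dist (q y) (q x) ≤ L * dist y x := fun y hy => by
      rw [dist_eq_norm, dist_eq_norm]
      refine le_of_tendsto (((hq y (hrC hy)).sub (hq x hx)).norm) ?_
      filter_upwards [hl] with n hn
      exact hn x (Metric.mem_ball_self hr) y hy
    refine tendsto_iff_dist_tendsto_zero.2 ?_
    refine squeeze_zero' (Eventually.of_forall fun y => dist_nonneg)
      (by filter_upwards [Metric.ball_mem_nhds x hr] with y hy using hle y hy) ?_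
    have : Tendsto (fun y => L * dist y x) (𝓝 x) (𝓝 (L * dist x x)) :=
      (continuous_const.mul (continuous_id.dist continuous_const)).tendsto x
    simpa using this
  refine ⟨q, hpq, fun x hx => ?_⟩
  -- the derivative
  have hρq : ∀ᵐ y ∂volume.restrict C, ρ y = F (q y) := by
    filter_upwards [hpq, hρF] with y h1 h2
    rw [h2, h1]
  have hmollρ : ∀ n, moll C ρ n = moll C (fun y => F (q y)) n := fun n => by
    ext z
    rw [moll_eq hC.measurableSet, moll_eq hC.measurableSet]
    refine integral_congr_ae ?_
    filter_upwards [hρq] with y hy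
    rw [hy]
  have hFq : IntegrableOn (fun y => F (q y)) C := hρ.congr hρq
  -- Near `x` the mollified density stays within `ε'` of `F (q x)` for large `n`, by continuity of
  -- `F ∘ q`. The mean value inequality bounds the error of the linear approximation uniformly in
  -- `n` and passes to the limit.
  rw [hasFDerivAt_iff_isLittleO, Asymptotics.isLittleO_iff]
  intro ε hε
  set ε' := ε / (‖g‖ + 1)
  have hε' : 0 < ε' := by positivity
  have hcont : ContinuousAt (fun y => F (q y)) x := hF.continuousAt.comp (hqc x hx)
  obtain ⟨δ, hδ, hδF⟩ := Metric.continuousAt_iff.1 hcont ε' hε'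
  have hd : 0 < Metric.infDist x Cᶜ := infDist_pos_of_mem hC hb hx
  set r := min δ (Metric.infDist x Cᶜ) / 2
  have hr : 0 < r := half_pos (lt_min hδ hd)
  have hrC : Metric.ball x r ⊆ C :=
    ball_subset_of_le_infDist ((half_le_self (lt_min hδ hd).le).trans (min_le_right _ _))
  filter_upwards [Metric.ball_mem_nhds x hr] with y hy
  refine le_of_tendsto ((((hq y (hrC hy)).sub (hq x hx)).sub_const _).norm) ?_
  filter_upwards [hn r hr] with n hnr
  have hder : ∀ z ∈ Metric.ball x r, HasFDerivWithinAt (moll C p n)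
      (moll C ρ n z • innerSL ℝ g) (Metric.ball x r) z := fun z hz => by
    refine (h.hasFDerivAt_moll hC hp ?_).hasFDerivWithinAt
    have h1 : Metric.infDist x Cᶜ ≤ Metric.infDist z Cᶜ + dist x z :=
      Metric.infDist_le_infDist_add_dist
    have h2 : min δ (Metric.infDist x Cᶜ) ≤ Metric.infDist x Cᶜ := min_le_right _ _
    rw [Metric.mem_ball, dist_comm] at hz
    simp only [r] at hz hnr
    linarith
  have hbound := (convex_ball x r).norm_image_sub_le_of_norm_hasFDerivWithin_le' hder
    (φ := F (q x) • innerSL ℝ g) (C := ε) (fun z hz => ?_) (Metric.mem_ball_self hr) hy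
  · exact hbound
  · rw [← sub_smul, norm_smul, innerSL_apply_norm, hmollρ, ← dist_eq_norm]
    have h3 : dist (moll C (fun y => F (q y)) n z) (F (q x)) ≤ ε' := by
      refine dist_moll_le hC.measurableSet hFq hε'.le fun w hw => ?_
      have h4 : dist w x < min δ (Metric.infDist x Cᶜ) := by
        have := dist_triangle w z x
        rw [Metric.mem_ball] at hw hz
        simp only [r] at hz hnr
        linarith
      exact ⟨ball_subset_of_le_infDist (min_le_right _ _) h4,
        (hδF (lt_of_lt_of_le h4 (min_le_left _ _))).le⟩
    calc _ ≤ ε' * (‖g‖ + 1) := by gcongr; linarith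
      _ = ε := by simp only [ε']; field_simp

end Hydrostatics

end Pendulum

namespace Pendulum

/-! ### Positive parts of affine functions. -/

section Profile

/-- A nonnegative function which is affine with slope `m` where it is positive stays affine as long
as the affine function is positive. -/
theorem eq_add_of_hasDerivAt_of_pos {f : ℝ → ℝ} {m : ℝ} (hc : ContinuousOn f (Icc 0 1))
    (hd : ∀ t ∈ Icc (0 : ℝ) 1, 0 < f t → HasDerivAt f m t) (h0 : 0 < f 0) (h1 : 0 < f 0 + m) :
    f 1 = f 0 + m := by
  have hpos : ∀ t ∈ Icc (0 : ℝ) 1, 0 < f 0 + m * t := fun t ht => by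
    rcases le_total 0 m with hm | hm
    · have := mul_nonneg hm ht.1
      linarith
    · have := mul_le_mul_of_nonpos_left ht.2 hm
      linarith
  have hcl : IsClosed ({t | f t = f 0 + m * t} ∩ Icc 0 1) := by
    have : {t | f t = f 0 + m * t} ∩ Icc 0 1 =
        Icc 0 1 ∩ (fun t => f t - (f 0 + m * t)) ⁻¹' {0} := by
      ext t
      simp [sub_eq_zero, and_comm]
    rw [this]
    exact (hc.sub (by fun_prop)).preimage_isClosed_of_isClosed isClosed_Icc isClosed_singleton
  -- Continuous induction: the set of agreement is closed, and at each of its points `f` is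
  -- positive, so the derivative is known and agreement extends to the right.
  have := hcl.Icc_subset_of_forall_mem_nhdsWithin (by simp) fun t ht => ?_
  · simpa using this (right_mem_Icc.2 zero_le_one)
  obtain ⟨hft, ht⟩ := ht
  change f t = f 0 + m * t at hft
  have ht' : t ∈ Icc (0 : ℝ) 1 := Ico_subset_Icc_self ht
  have hft' : 0 < f t := by rw [hft]; exact hpos t ht'
  obtain ⟨δ, hδ, hball⟩ := Metric.eventually_nhds_iff.1
    ((hd t ht' hft').continuousAt.eventually (lt_mem_nhds hft'))
  have hb : t < min 1 (t + δ / 2) := lt_min ht.2 (by linarith)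
  have hpos' : ∀ s ∈ Icc t (min 1 (t + δ / 2)), 0 < f s := fun s hs => by
    refine hball ?_
    rw [Real.dist_eq, abs_of_nonneg (by linarith [hs.1])]
    linarith [hs.2.trans (min_le_right _ _)]
  have hin : ∀ s ∈ Icc t (min 1 (t + δ / 2)), s ∈ Icc (0 : ℝ) 1 := fun s hs =>
    ⟨ht.1.trans hs.1, hs.2.trans (min_le_left _ _)⟩
  have hder : ∀ s ∈ Icc t (min 1 (t + δ / 2)),
      HasDerivAt (fun s => f s - (f 0 + m * s)) 0 s := fun s hs => by
    have h2 : HasDerivAt (fun s => f 0 + m * s) m s := by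
      simpa using ((hasDerivAt_id s).const_mul m).const_add (f 0)
    simpa using! (hd s (hin s hs) (hpos' s hs)).sub h2
  have hconst := constant_of_has_deriv_right_zero
    (fun s hs => (hder s hs).continuousAt.continuousWithinAt)
    fun s hs => (hder s (Ico_subset_Icc_self hs)).hasDerivWithinAt
  filter_upwards [Ioo_mem_nhdsGT hb] with s hs
  have := hconst s (Ioo_subset_Icc_self hs)
  change f s = f 0 + m * s
  linarith

/-- Once at zero, `f` cannot become positive again: if `f 0 + m ≤ 0 < f 1`, running the segment
backwards from 1 keeps `f` affine down to 0 and gives `f 1 = f 0 + m`, a contradiction. -/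
theorem eq_max_of_hasDerivAt {f : ℝ → ℝ} {m : ℝ} (hc : ContinuousOn f (Icc 0 1))
    (hd : ∀ t ∈ Icc (0 : ℝ) 1, 0 < f t → HasDerivAt f m t) (hn : 0 ≤ f 1) (h0 : 0 < f 0) :
    f 1 = max (f 0 + m) 0 := by
  rcases le_or_gt (f 0 + m) 0 with h1 | h1
  · rw [max_eq_right h1]
    refine (hn.eq_or_lt).elim Eq.symm fun hp => ?_
    have hm : MapsTo (fun t : ℝ => 1 - t) (Icc 0 1) (Icc 0 1) := fun t ht =>
      ⟨by linarith [ht.2], by linarith [ht.1]⟩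
    have := eq_add_of_hasDerivAt_of_pos (f := fun t => f (1 - t)) (m := -m)
      (hc.comp (by fun_prop) hm)
      (fun t ht hft => by
        have h2 : HasDerivAt (fun t : ℝ => 1 - t) (-1) t := by
          simpa using (hasDerivAt_id t).const_sub 1
        simpa using! (hd _ (hm ht) hft).comp t h2) (by simpa using hp)
      (by simp only [sub_zero]; linarith)
    simp only [sub_self, sub_zero] at this
    linarith
  · rw [max_eq_left h1.le]
    exact eq_add_of_hasDerivAt_of_pos hc hd h0 h1

/-- Every point is joined to `x₀` by a segment in `C`, along which the one-dimensional statement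
applies. Convexity is what excludes different constants on separate components of `{W > 0}`. -/
theorem exists_eq_max_inner {C : Set E3} (hconv : Convex ℝ C) {W : E3 → ℝ} {v : E3}
    (hc : ContinuousOn W C) (hn : ∀ x ∈ C, 0 ≤ W x)
    (hd : ∀ x ∈ C, 0 < W x → HasFDerivAt W (innerSL ℝ v) x) {x₀ : E3} (hx₀ : x₀ ∈ C)
    (hW : 0 < W x₀) : ∃ c : ℝ, ∀ x ∈ C, W x = max (inner ℝ v x + c) 0 := by
  refine ⟨W x₀ - inner ℝ v x₀, fun x hx => ?_⟩
  have hseg : ∀ t ∈ Icc (0 : ℝ) 1, x₀ + t • (x - x₀) ∈ C := fun t ht =>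
    hconv.add_smul_sub_mem hx₀ hx ht
  have := eq_max_of_hasDerivAt (f := fun t => W (x₀ + t • (x - x₀))) (m := inner ℝ v (x - x₀))
    (hc.comp (by fun_prop) hseg)
    (fun t ht hft => by
      have h1 : HasDerivAt (fun t : ℝ => x₀ + t • (x - x₀)) (x - x₀) t := by
        simpa using ((hasDerivAt_id t).smul_const (x - x₀)).const_add x₀
      exact (hd _ (hseg t ht) hft).comp_hasDerivAt t h1)
    (hn _ (hseg 1 (right_mem_Icc.2 zero_le_one))) (by simpa using hW)
  simp only [one_smul, add_sub_cancel, zero_smul, add_zero] at this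
  rw [this, inner_sub_right]
  congr 1
  ring

end Profile

/-! ### The hydrostatic density. -/

namespace System

variable {S : System} {ρ : E3 → ℝ} {g : E3}

/-- A hydrostatic density is the positive part of an affine function, raised to the power
`1 / (γ - 1)`. -/
theorem exists_eq_of_isHydrostatic
    (hρ : MemLp ρ (ENNReal.ofReal S.γ) (volume.restrict S.C))
    (h0 : ∀ᵐ x ∂volume.restrict S.C, 0 ≤ ρ x) (hM : ∫ x in S.C, ρ x = S.M)
    (h : IsHydrostatic S.C (fun x => S.pressure (ρ x)) ρ g) :
    ∃ c : ℝ, ∀ᵐ x ∂volume.restrict S.C,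
      ρ x = (max ((S.γ - 1) / (S.a * S.γ) * inner ℝ g x + c) 0) ^ (1 / (S.γ - 1)) := by
  have hfin := S.isFiniteMeasure_C
  have hγ := S.γ_pos
  have hγ1 : 0 < S.γ - 1 := by linarith [S.γ_gt_one]
  have ha := S.a_pos
  -- `F` inverts the pressure law, and `G = F^(γ-1)` is `ρ^(γ-1)` as a function of the pressure, a
  -- multiple of the enthalpy.
  set F : ℝ → ℝ := fun s => (max s 0 / S.a) ^ (1 / S.γ)
  set G : ℝ → ℝ := fun s => (max s 0 / S.a) ^ ((S.γ - 1) / S.γ)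
  have hFc : Continuous F := by
    refine Continuous.rpow_const (by fun_prop) fun _ => Or.inr (by positivity)
  have hGc : Continuous G := by
    refine Continuous.rpow_const (by fun_prop) fun _ => Or.inr (by positivity)
  have hFm : Monotone F := fun s t hst => by
    simp only [F]
    gcongr
  have hρF : ∀ᵐ x ∂volume.restrict S.C, ρ x = F (S.pressure (ρ x)) := by
    filter_upwards [h0] with x hx
    simp only [F]
    rw [max_eq_left (S.pressure_nonneg hx), pressure, mul_div_cancel_left₀ _ ha.ne',
      ← Real.rpow_mul hx, mul_one_div_cancel hγ.ne', Real.rpow_one]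
  obtain ⟨q, hq, hqd⟩ := h.exists_regular S.isOpen_C S.convex_C S.isBounded_C
    (integrable_pressure hρ h0) (hρ.integrable (by simpa using S.γ_gt_one.le)) h0 hFc hFm hρF
  have hρq : ∀ᵐ x ∂volume.restrict S.C, ρ x = F (q x) := by
    filter_upwards [hρF, hq] with x h1 h2
    rw [h1, h2]
  -- The mass `M > 0` excludes a vacuum everywhere and provides the starting point of the segments.
  obtain ⟨x₀, hx₀, hqx₀⟩ : ∃ x ∈ S.C, 0 < q x := by
    by_contra! hneg
    have hz : ∀ᵐ x ∂volume.restrict S.C, ρ x = 0 := by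
      filter_upwards [hρq, ae_restrict_mem S.isOpen_C.measurableSet] with x h1 h2
      rw [h1]
      simp only [F]
      rw [max_eq_right (hneg x h2), zero_div, Real.zero_rpow (by positivity)]
    have := S.M_pos
    rw [← hM, integral_congr_ae hz] at this
    simp at this
  have hGpos : ∀ s, 0 < G s → 0 < s := fun s hs => by
    by_contra! hneg
    simp only [G] at hs
    rw [max_eq_right hneg, zero_div, Real.zero_rpow (by positivity)] at hs
    exact hs.false
  obtain ⟨c, hc⟩ := exists_eq_max_inner (C := S.C) S.convex_C (W := fun x => G (q x))
    (v := ((S.γ - 1) / (S.a * S.γ)) • g)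
    (fun x hx => (hGc.continuousAt.comp (hqd x hx).continuousAt).continuousWithinAt)
    (fun x _ => by simp only [G]; positivity)
    (fun x hx hW => by
      have hs := hGpos _ hW
      have hG : HasDerivAt G ((S.γ - 1) / S.γ * (q x / S.a) ^ ((S.γ - 1) / S.γ - 1) * S.a⁻¹)
          (q x) := by
        have h1 : HasDerivAt (fun s => s / S.a) S.a⁻¹ (q x) := by
          simpa using (hasDerivAt_id (q x)).div_const S.a
        have h2 := h1.rpow_const (p := (S.γ - 1) / S.γ) (Or.inl (by positivity))
        refine (h2.congr_deriv (by ring)).congr_of_eventuallyEq ?_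
        filter_upwards [lt_mem_nhds hs] with s hs'
        simp only [G]
        rw [max_eq_left hs'.le]
      refine (hG.comp_hasFDerivAt x (hqd x hx)).congr_fderiv ?_
      -- In `G'(q) ∇q = G'(q) F(q) g` the powers of `q` cancel, so the gradient is constant.
      have e1 : (S.γ - 1) / S.γ * (q x / S.a) ^ ((S.γ - 1) / S.γ - 1) * S.a⁻¹ * F (q x) =
          (S.γ - 1) / (S.a * S.γ) := by
        simp only [F]
        rw [max_eq_left hs.le, mul_right_comm, mul_assoc ((S.γ - 1) / S.γ),
          ← Real.rpow_add (by positivity),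
          show (S.γ - 1) / S.γ - 1 + 1 / S.γ = 0 by field_simp; ring, Real.rpow_zero]
        field_simp
      rw [smul_smul, e1]
      ext k
      simp)
    hx₀ (by simp only [G]; rw [max_eq_left hqx₀.le]; positivity)
  refine ⟨c, ?_⟩
  filter_upwards [hρq, ae_restrict_mem S.isOpen_C.measurableSet] with x h1 h2
  have h3 := hc x h2
  rw [real_inner_smul_left] at h3
  rw [← h3, h1]
  simp only [F, G]
  rw [← Real.rpow_mul (by positivity), div_mul_div_comm, mul_one, mul_comm S.γ,
    ← div_div, div_self hγ1.ne']

end System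

end Pendulum

/-! ### Rotations about the axis. -/

namespace Pendulum

theorem ext_coord {x y : E3} (h0 : x 0 = y 0) (h1 : x 1 = y 1) (h2 : x 2 = y 2) : x = y := by
  ext i
  fin_cases i
  exacts [h0, h1, h2]

section Rotation

variable (θ : ℝ)

theorem act_rotation_apply (x : E3) :
    (act (rotation θ) x) 0 = Real.cos θ * x 0 - Real.sin θ * x 1 ∧
    (act (rotation θ) x) 1 = Real.sin θ * x 0 + Real.cos θ * x 1 ∧
    (act (rotation θ) x) 2 = x 2 := by
  simp [act, rotation, dotProduct, Fin.sum_univ_three, sub_eq_add_neg]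

theorem act_rotation_transpose_apply (x : E3) :
    (act (rotation θ)ᵀ x) 0 = Real.cos θ * x 0 + Real.sin θ * x 1 ∧
    (act (rotation θ)ᵀ x) 1 = -Real.sin θ * x 0 + Real.cos θ * x 1 ∧
    (act (rotation θ)ᵀ x) 2 = x 2 := by
  simp [act, rotation, Matrix.mulVec, dotProduct, Fin.sum_univ_three]

theorem act_transpose_act (x : E3) : act (rotation θ)ᵀ (act (rotation θ) x) = x := by
  obtain ⟨a0, a1, a2⟩ := act_rotation_apply θ x
  obtain ⟨b0, b1, b2⟩ := act_rotation_transpose_apply θ (act (rotation θ) x)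
  have := Real.sin_sq_add_cos_sq θ
  refine ext_coord ?_ ?_ ?_
  · refine b0.trans ?_
    rw [a0, a1]
    linear_combination x 0 * this
  · refine b1.trans ?_
    rw [a0, a1]
    linear_combination x 1 * this
  · exact b2.trans a2

theorem act_act_transpose (x : E3) : act (rotation θ) (act (rotation θ)ᵀ x) = x := by
  obtain ⟨b0, b1, b2⟩ := act_rotation_transpose_apply θ x
  obtain ⟨a0, a1, a2⟩ := act_rotation_apply θ (act (rotation θ)ᵀ x)
  have := Real.sin_sq_add_cos_sq θ
  refine ext_coord ?_ ?_ ?_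
  · refine a0.trans ?_
    rw [b0, b1]
    linear_combination x 0 * this
  · refine a1.trans ?_
    rw [b0, b1]
    linear_combination x 1 * this
  · exact a2.trans b2

theorem inner_eq_sum (x y : E3) : inner ℝ x y = x 0 * y 0 + x 1 * y 1 + x 2 * y 2 := by
  rw [PiLp.inner_apply, Fin.sum_univ_three]
  simp [mul_comm]

theorem inner_act_act (x y : E3) :
    inner ℝ (act (rotation θ) x) (act (rotation θ) y) = inner ℝ x y := by
  obtain ⟨a0, a1, a2⟩ := act_rotation_apply θ x
  obtain ⟨b0, b1, b2⟩ := act_rotation_apply θ y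
  have := Real.sin_sq_add_cos_sq θ
  rw [inner_eq_sum, inner_eq_sum, a0, a1, a2, b0, b1, b2]
  linear_combination (x 0 * y 0 + x 1 * y 1) * this

/-- The rotation by the angle `θ` about the third axis, as an isometry. -/
noncomputable def rotationIso : E3 ≃ₗᵢ[ℝ] E3 where
  toFun := act (rotation θ)
  invFun := act (rotation θ)ᵀ
  left_inv := act_transpose_act θ
  right_inv := act_act_transpose θ
  map_add' x y := by
    ext i
    simp [act, Matrix.mulVec_add]
  map_smul' r x := by
    ext i
    simp [act, Matrix.mulVec_smul]
  norm_map' x := by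
    change ‖act (rotation θ) x‖ = ‖x‖
    rw [← sq_eq_sq₀ (norm_nonneg _) (norm_nonneg _), ← real_inner_self_eq_norm_sq,
      ← real_inner_self_eq_norm_sq, inner_act_act]

theorem coe_rotationIso : ⇑(rotationIso θ) = act (rotation θ) := rfl

theorem continuous_act_rotation : Continuous (act (rotation θ)) := (rotationIso θ).continuous

theorem setIntegral_image_act {F : Type*} [NormedAddCommGroup F] [NormedSpace ℝ F] (f : E3 → F)
    (s : Set E3) :
    ∫ y in act (rotation θ) '' s, f y = ∫ x in s, f (act (rotation θ) x) :=
  (rotationIso θ).measurePreserving.setIntegral_image_emb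
    (rotationIso θ).toHomeomorph.measurableEmbedding f s

theorem exists_act_rotation_eq {g : E3} {r : ℝ} (hr : ‖g‖ = r) (hg : inner ℝ g (e 2) = 0) :
    ∃ θ ∈ Ico (0 : ℝ) (2 * Real.pi), act (rotation θ) g = r • e 0 := by
  set z : ℂ := ⟨g 0, g 1⟩
  have hg2 : g 2 = 0 := by simpa [inner_eq_sum, e] using hg
  have hz : ‖z‖ = r := by
    rw [← hr, Complex.norm_def, Complex.normSq_apply, ← Real.sqrt_sq (norm_nonneg g),
      ← real_inner_self_eq_norm_sq, inner_eq_sum, hg2]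
    simp [z]
  have h0 : g 0 = r * Real.cos z.arg := by rw [← hz, Complex.norm_mul_cos_arg]
  have h1 : g 1 = r * Real.sin z.arg := by rw [← hz, Complex.norm_mul_sin_arg]
  have hp : (0 : ℝ) < 2 * Real.pi := Real.two_pi_pos
  -- The angle turns the planar vector `g 0 + i g 1` onto the positive real axis, and is reduced
  -- modulo `2π`.
  refine ⟨toIcoMod hp 0 (-z.arg), by simpa using toIcoMod_mem_Ico hp 0 (-z.arg), ?_⟩
  have hθ : toIcoMod hp 0 (-z.arg) = -z.arg - toIcoDiv hp 0 (-z.arg) * (2 * Real.pi) := by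
    rw [toIcoMod, zsmul_eq_mul]
  have hcos : Real.cos (toIcoMod hp 0 (-z.arg)) = Real.cos z.arg := by
    rw [hθ, Real.cos_sub_int_mul_two_pi, Real.cos_neg]
  have hsin : Real.sin (toIcoMod hp 0 (-z.arg)) = -Real.sin z.arg := by
    rw [hθ, Real.sin_sub_int_mul_two_pi, Real.sin_neg]
  obtain ⟨a0, a1, a2⟩ := act_rotation_apply (toIcoMod hp 0 (-z.arg)) g
  have := Real.sin_sq_add_cos_sq z.arg
  refine ext_coord ?_ ?_ ?_
  · refine a0.trans ?_
    rw [hcos, hsin, h0, h1]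
    simp [e]
    linear_combination r * this
  · refine a1.trans ?_
    rw [hcos, hsin, h0, h1]
    simp [e]
    ring
  · refine a2.trans ?_
    rw [hg2]
    simp [e]

variable {θ}

theorem eq_of_act_rotation_eq {g : E3} {r : ℝ} (h : act (rotation θ) g = r • e 0) :
    g 0 = r * Real.cos θ ∧ g 1 = -(r * Real.sin θ) ∧ g 2 = 0 := by
  rw [← act_transpose_act θ g, h]
  obtain ⟨a0, a1, a2⟩ := act_rotation_transpose_apply θ (r • e 0)
  rw [a0, a1, a2]
  simp [e, mul_comm]

theorem inner_eq_of_act_rotation_eq {g : E3} {r : ℝ} (h : act (rotation θ) g = r • e 0) (x : E3) :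
    inner ℝ g x = r * (act (rotation θ) x) 0 := by
  rw [← inner_act_act θ, h, inner_eq_sum]
  simp [e]

/-- The axial torque of gravity sees only the horizontal lever arm, which is the second coordinate
in the inertial frame. -/
theorem inner_cross_eq_of_act_rotation_eq {g : E3} {r : ℝ} (h : act (rotation θ) g = r • e 0)
    (x : E3) : inner ℝ (e 2) (cross x g) = -r * (act (rotation θ) x) 1 := by
  obtain ⟨h0, h1, -⟩ := eq_of_act_rotation_eq h
  rw [(act_rotation_apply θ x).2.1, inner_eq_sum]
  simp [e, cross, crossProduct, h0, h1]
  ring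

end Rotation

/-- A nonzero vector orthogonal to `e₃` has a nonzero vector product with it. -/
theorem smul_cross_axis_eq_zero {ω r : ℝ} {g : E3} (hr : 0 < r) (hn : ‖g‖ = r)
    (hg : inner ℝ g (e 2) = 0) (h : ω • cross (e 2) g = 0) : ω = 0 := by
  refine (smul_eq_zero.1 h).resolve_right fun hc => ?_
  have hg2 : g 2 = 0 := by simpa [inner_eq_sum, e] using hg
  have h0 := congrArg (fun y : E3 => y 0) hc
  have h1 := congrArg (fun y : E3 => y 1) hc
  simp [cross, crossProduct, e] at h0 h1
  have : g = 0 := by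
    ext i
    fin_cases i
    · simpa using h1
    · simpa using h0
    · simpa using hg2
  rw [this, norm_zero] at hn
  exact hr.ne hn

/-! ### Center of mass and torque. -/

namespace System

variable (S : System) {ρ : E3 → ℝ} {θ : ℝ}

/-- Measurability of the body comes from writing it as the difference of the open sets `C ∪ B` and
`C`. -/
theorem measurableSet_B : MeasurableSet S.B := by
  have : S.B = (S.C ∪ S.B) \ S.C := by
    rw [union_sdiff_left, S.disjoint.symm.sdiff_eq_left]
  rw [this]
  exact S.isOpen_union.measurableSet.diff S.isOpen_C.measurableSet

theorem bodyMass_nonneg : 0 ≤ S.bodyMass :=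
  setIntegral_nonneg S.measurableSet_B S.ρB_nonneg

theorem totalMass_pos : 0 < S.M + S.bodyMass := add_pos_of_pos_of_nonneg S.M_pos S.bodyMass_nonneg

variable {S}

theorem integrableOn_smul_id {f : E3 → ℝ} {s : Set E3} (hs : Bornology.IsBounded s)
    (hm : MeasurableSet s) (hf : IntegrableOn f s) : IntegrableOn (fun x => f x • x) s := by
  obtain ⟨R, hR⟩ := hs.exists_norm_le
  refine (hf.norm.mul_const R).mono' (hf.1.smul aestronglyMeasurable_id) ?_
  filter_upwards [ae_restrict_mem hm] with x hx
  rw [norm_smul]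
  gcongr
  exact hR x hx

theorem integral_totalDensity (hρ : IntegrableOn ρ S.C) :
    ∫ x in S.C ∪ S.B, S.totalDensity ρ x • x =
      (∫ x in S.C, ρ x • x) + ∫ x in S.B, S.ρB x • x := by
  have e1 : EqOn (fun x => S.totalDensity ρ x • x) (fun x => ρ x • x) S.C := fun x hx => by
    simp [totalDensity, hx]
  have e2 : EqOn (fun x => S.totalDensity ρ x • x) (fun x => S.ρB x • x) S.B := fun x hx => by
    simp [totalDensity, disjoint_right.1 S.disjoint hx]
  have hB := integrableOn_smul_id (S.isBounded_union.subset subset_union_right) S.measurableSet_B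
    S.ρB_integrable
  have hC := integrableOn_smul_id S.isBounded_C S.isOpen_C.measurableSet hρ
  rw [setIntegral_union S.disjoint S.measurableSet_B (hC.congr_fun e1.symm S.isOpen_C.measurableSet)
    (hB.congr_fun e2.symm S.measurableSet_B), setIntegral_congr_fun S.isOpen_C.measurableSet e1,
    setIntegral_congr_fun S.measurableSet_B e2]

theorem centerOfMass_eq (hρ : IntegrableOn ρ S.C) :
    S.centerOfMass θ ρ =
      (S.M + S.bodyMass)⁻¹ • act (rotation θ) (∫ x in S.C ∪ S.B, S.totalDensity ρ x • x) := by
  have key : ∀ (f : E3 → ℝ) (s : Set E3),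
      ∫ y in act (rotation θ) '' s, f (act (rotation θ)ᵀ y) • y =
        act (rotation θ) (∫ x in s, f x • x) := fun f s => by
    rw [setIntegral_image_act, ← coe_rotationIso]
    have := (rotationIso θ).toContinuousLinearEquiv.integral_comp_comm (μ := volume.restrict s)
      fun x => f x • x
    refine Eq.trans ?_ this
    refine integral_congr_ae (Eventually.of_forall fun x => ?_)
    simp only [coe_rotationIso, act_transpose_act]
    exact ((rotationIso θ).map_smul (f x) x).symm
  rw [integral_totalDensity hρ, centerOfMass, cavityEq, bodyEq, key]
  simp only [bodyDensityEq]
  rw [key, ← coe_rotationIso, map_add]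

theorem centerOfMass_eq_equilibriumPoint (hρ : IntegrableOn ρ S.C) {c : ℝ}
    (h : ∀ᵐ x ∂volume.restrict S.C, ρ x = S.profile c ((act (rotation θ) x) 0))
    (h1 : (S.centerOfMass θ ρ) 1 = 0) : S.centerOfMass θ ρ = S.equilibriumPoint θ c := by
  have key : ∀ (f : E3 → ℝ) (s : Set E3), IntegrableOn (fun x => f x • x) s → ∀ i : Fin 3,
      (act (rotation θ) (∫ x in s, f x • x)) i =
        ∫ x in s, f x * (act (rotation θ) x) i := fun f s hf i => by
    have h2 := ((EuclideanSpace.proj (𝕜 := ℝ) i).comp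
      ((rotationIso θ).toContinuousLinearEquiv : E3 →L[ℝ] E3)).integral_comp_comm hf
    refine h2.symm.trans (integral_congr_ae (Eventually.of_forall fun x => ?_))
    change (rotationIso θ (f x • x)) i = _
    rw [map_smul]
    rfl
  have hB := integrableOn_smul_id (S.isBounded_union.subset subset_union_right) S.measurableSet_B
    S.ρB_integrable
  have hC := integrableOn_smul_id S.isBounded_C S.isOpen_C.measurableSet hρ
  have kC : ∀ i : Fin 3, (act (rotation θ) (∫ x in S.C, ρ x • x)) i =
      ∫ y in S.cavityEq θ, S.profile c (y 0) * y i := fun i => by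
    rw [key _ _ hC, cavityEq, setIntegral_image_act]
    refine integral_congr_ae ?_
    filter_upwards [h] with x hx
    rw [hx]
  have kB : ∀ i : Fin 3, (act (rotation θ) (∫ x in S.B, S.ρB x • x)) i =
      ∫ y in S.bodyEq θ, S.bodyDensityEq θ y * y i := fun i => by
    rw [key _ _ hB, bodyEq, setIntegral_image_act]
    simp only [bodyDensityEq, act_transpose_act]
  -- The choice of the origin makes the axial moment of the body vanish, and the rotation leaves the
  -- third coordinate unchanged.
  have kB2 : (act (rotation θ) (∫ x in S.B, S.ρB x • x)) 2 = 0 := by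
    rw [key _ _ hB, ← S.axial_moment]
    simp only [(act_rotation_apply θ _).2.2]
  have hsum : S.centerOfMass θ ρ = (S.M + S.bodyMass)⁻¹ •
      (act (rotation θ) (∫ x in S.C, ρ x • x) + act (rotation θ) (∫ x in S.B, S.ρB x • x)) := by
    rw [centerOfMass_eq hρ, integral_totalDensity hρ, ← coe_rotationIso, map_add]
  rw [hsum] at h1 ⊢
  ext i
  rw [equilibriumPoint, ← kC, ← kC, ← kB]
  fin_cases i
  · simp [e, mul_add]
  · simpa [e] using h1
  · simp [e, kB2]

/-- The torque is `-grav` times the total mass times the second coordinate of the center of mass,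
and the first two factors are nonzero. -/
theorem torque_iff (hρ : IntegrableOn ρ S.C) {g : E3} (hg : act (rotation θ) g = S.grav • e 0) :
    inner ℝ (e 2) (cross (∫ x in S.C ∪ S.B, S.totalDensity ρ x • x) g) = 0 ↔
      (S.centerOfMass θ ρ) 1 = 0 := by
  rw [inner_cross_eq_of_act_rotation_eq hg, centerOfMass_eq hρ]
  have := S.grav_pos.ne'
  have := S.totalMass_pos.ne'
  simp [*]

end System

end Pendulum

/-! ### The profile: mass condition, hydrostatic balance and the equivalence. -/

namespace Pendulum

/-- For `r > 1` both one-sided derivatives at the edge of the vacuum are zero, so the pressure of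
the profile is differentiable across it. -/
theorem hasDerivAt_max_rpow {r : ℝ} (hr : 1 < r) (s : ℝ) :
    HasDerivAt (fun s : ℝ => (max s 0) ^ r) (r * (max s 0) ^ (r - 1)) s := by
  have hr0 : r ≠ 0 := by linarith
  have hr1 : r - 1 ≠ 0 := by linarith
  rcases lt_trichotomy s 0 with h | rfl | h
  · rw [max_eq_right h.le, Real.zero_rpow hr1, mul_zero]
    refine (hasDerivAt_const s (0 : ℝ)).congr_of_eventuallyEq ?_
    filter_upwards [gt_mem_nhds h] with t ht
    rw [max_eq_right ht.le, Real.zero_rpow hr0]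
  · rw [← hasDerivWithinAt_univ, ← Iic_union_Ici (a := (0 : ℝ))]
    refine HasDerivWithinAt.union ?_ ?_
    · rw [max_self, Real.zero_rpow hr1, mul_zero]
      refine (hasDerivWithinAt_const (0 : ℝ) _ (0 : ℝ)).congr (fun t ht => ?_) ?_
      · rw [max_eq_right ht, Real.zero_rpow hr0]
      · rw [max_self, Real.zero_rpow hr0]
    · rw [max_self]
      refine (Real.hasDerivAt_rpow_const (Or.inr hr.le)).hasDerivWithinAt.congr
        (fun t ht => ?_) ?_
      · rw [max_eq_left ht]
      · rw [max_self]
  · rw [max_eq_left h.le]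
    refine (Real.hasDerivAt_rpow_const (Or.inr hr.le)).congr_of_eventuallyEq ?_
    filter_upwards [lt_mem_nhds h] with t ht
    rw [max_eq_left ht.le]

/-- A classical solution of `∇ P = r g` is a weak one. -/
theorem isHydrostatic_of_hasFDerivAt {C : Set E3} {P r : E3 → ℝ} {g : E3} (hr : Continuous r)
    (hP : ∀ x, HasFDerivAt P (r x • innerSL ℝ g) x) : IsHydrostatic C P r g := by
  intro φ hφ
  have hPc : Continuous P := continuous_iff_continuousAt.2 fun x => (hP x).continuousAt
  have hcomp : ∀ i, Continuous fun x => φ x i := fun i =>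
    (coordL i).continuous.comp hφ.contDiff.continuous
  have hcomps : ∀ i, HasCompactSupport fun x => φ x i := fun i =>
    hφ.hasCompactSupport.comp_left (g := fun z : E3 => z i) rfl
  have hd : ∀ i, Continuous fun x => fderiv ℝ φ x (e i) i := fun i =>
    (coordL i).continuous.comp (hφ.continuous_fderiv.clm_apply continuous_const)
  have hds : ∀ i, HasCompactSupport fun x => fderiv ℝ φ x (e i) i := fun i =>
    (hφ.hasCompactSupport.fderiv_apply (𝕜 := ℝ) (e i)).comp_left (g := fun z : E3 => z i) rfl
  have hfP : ∀ x i, fderiv ℝ P x (e i) = r x * g i := fun x i => by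
    rw [(hP x).fderiv]
    change r x * inner ℝ g (e i) = _
    rw [e, EuclideanSpace.inner_single_right]
    simp
  have i1 : ∀ i, Integrable fun x => P x * fderiv ℝ φ x (e i) i := fun i =>
    (hPc.mul (hd i)).integrable_of_hasCompactSupport (hds i).mul_left
  have i2 : ∀ i, Integrable fun x => r x * g i * φ x i := fun i =>
    ((hr.mul_const (g i)).mul (hcomp i)).integrable_of_hasCompactSupport (hcomps i).mul_left
  have ibp : ∀ i, ∫ x, P x * fderiv ℝ φ x (e i) i = -∫ x, r x * g i * φ x i := fun i => by
    have := integral_mul_fderiv_eq_neg_fderiv_mul_of_integrable (μ := (volume : Measure E3))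
      (f := P) (g := fun x => φ x i) (v := e i)
      (by simpa only [hfP] using i2 i)
      (by simpa only [fderiv_component hφ.differentiable] using i1 i)
      ((hPc.mul (hcomp i)).integrable_of_hasCompactSupport (hcomps i).mul_left)
      (fun x _ => (hP x).differentiableAt)
      (fun x _ => ((coordL i).differentiableAt).comp x (hφ.differentiable x))
    simpa only [hfP, fderiv_component hφ.differentiable] using this
  rw [setIntegral_eq_integral_of_forall_compl_eq_zero fun x hx => by
      rw [hφ.fderiv_eq_zero hx]; simp [divOf_eq],
    setIntegral_eq_integral_of_forall_compl_eq_zero fun x hx => by rw [hφ.eq_zero hx]; simp]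
  have e1 : ∀ x, P x * divOf (fderiv ℝ φ x) = ∑ i, P x * fderiv ℝ φ x (e i) i := fun x => by
    rw [divOf_eq, Fin.sum_univ_three]; ring
  have e2 : ∀ x, r x * inner ℝ g (φ x) = ∑ i, r x * g i * φ x i := fun x => by
    rw [inner_eq_sum, Fin.sum_univ_three]; ring
  simp_rw [e1, e2]
  rw [integral_finsetSum _ fun i _ => i1 i, integral_finsetSum _ fun i _ => i2 i,
    ← Finset.sum_neg_distrib]
  exact Finset.sum_congr rfl fun i _ => ibp i

theorem IsHydrostatic.congr {C : Set E3} {p p' r r' : E3 → ℝ} {g : E3} (h : IsHydrostatic C p r g)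
    (hp : p =ᵐ[volume.restrict C] p') (hr : r =ᵐ[volume.restrict C] r') :
    IsHydrostatic C p' r' g := fun φ hφ => by
  have e1 : ∫ x in C, p' x * divOf (fderiv ℝ φ x) = ∫ x in C, p x * divOf (fderiv ℝ φ x) :=
    integral_congr_ae (hp.mono fun x hx => by simp only [hx])
  have e2 : ∫ x in C, r' x * inner ℝ g (φ x) = ∫ x in C, r x * inner ℝ g (φ x) :=
    integral_congr_ae (hr.mono fun x hx => by simp only [hx])
  rw [e1, e2]
  exact h φ hφ

theorem divOf_zero : divOf 0 = 0 := by simp [divOf_eq]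

theorem contract_stress_zero (μ lam : ℝ) (A : Matrix (Fin 3) (Fin 3) ℝ) :
    contract (stress μ lam 0) A = 0 := by
  rw [stress, divOf_zero]
  simp [contract, gradMatrix]

namespace System

variable (S : System) {θ : ℝ}

theorem exponent_pos : 0 < 1 / (S.γ - 1) := one_div_pos.2 (by linarith [S.γ_gt_one])

theorem profile_nonneg (c s : ℝ) : 0 ≤ S.profile c s := Real.rpow_nonneg (le_max_right _ _) _

theorem profile_mono_of_le {c c' s s' : ℝ}
    (h : (S.γ - 1) / (S.a * S.γ) * S.grav * s + c ≤ (S.γ - 1) / (S.a * S.γ) * S.grav * s' + c') :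
    S.profile c s ≤ S.profile c' s' :=
  Real.rpow_le_rpow (le_max_right _ _) (max_le_max_right _ h) S.exponent_pos.le

theorem continuous_profile : Continuous fun z : ℝ × ℝ => S.profile z.1 z.2 := by
  unfold profile
  exact Continuous.rpow_const (by fun_prop) fun _ => Or.inr S.exponent_pos.le

theorem continuous_profile_act (θ c : ℝ) :
    Continuous fun x : E3 => S.profile c ((act (rotation θ) x) 0) :=
  S.continuous_profile.comp (continuous_const.prodMk
    ((coordL 0).continuous.comp (continuous_act_rotation θ)))

theorem exists_bound_act (θ : ℝ) : ∃ K, 0 ≤ K ∧ ∀ x ∈ S.C,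
    |(S.γ - 1) / (S.a * S.γ) * S.grav * (act (rotation θ) x) 0| ≤ K := by
  have hc : Continuous fun x : E3 =>
      (S.γ - 1) / (S.a * S.γ) * S.grav * (act (rotation θ) x) 0 :=
    continuous_const.mul ((coordL 0).continuous.comp (continuous_act_rotation θ))
  obtain ⟨K, hK⟩ := S.isBounded_C.isCompact_closure.exists_bound_of_continuousOn hc.continuousOn
  exact ⟨max K 0, le_max_right _ _, fun x hx => (hK x (subset_closure hx)).trans (le_max_left _ _)⟩

theorem profile_act_le {θ c K : ℝ} {x : E3}
    (hx : |(S.γ - 1) / (S.a * S.γ) * S.grav * (act (rotation θ) x) 0| ≤ K) :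
    S.profile c ((act (rotation θ) x) 0) ≤ S.profile (K + c) 0 := by
  refine S.profile_mono_of_le ?_
  have := (abs_le.1 hx).2
  linarith

theorem memLp_profile_act (θ c : ℝ) (p : ENNReal) :
    MemLp (fun x => S.profile c ((act (rotation θ) x) 0)) p (volume.restrict S.C) := by
  have := S.isFiniteMeasure_C
  obtain ⟨K, -, hK⟩ := S.exists_bound_act θ
  refine MemLp.of_bound (S.continuous_profile_act θ c).aestronglyMeasurable (S.profile (K + c) 0) ?_
  filter_upwards [ae_restrict_mem S.isOpen_C.measurableSet] with x hx
  rw [Real.norm_of_nonneg (S.profile_nonneg _ _)]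
  exact S.profile_act_le (hK x hx)

theorem integrable_profile_act (θ c : ℝ) :
    IntegrableOn (fun x => S.profile c ((act (rotation θ) x) 0)) S.C :=
  memLp_one_iff_integrable.1 (S.memLp_profile_act θ c 1)

theorem setIntegral_profile (θ c : ℝ) : ∫ y in S.cavityEq θ, S.profile c (y 0) =
    ∫ x in S.C, S.profile c ((act (rotation θ) x) 0) :=
  setIntegral_image_act θ _ _

theorem continuous_integral_profile (θ : ℝ) :
    Continuous fun c => ∫ x in S.C, S.profile c ((act (rotation θ) x) 0) := by
  have := S.isFiniteMeasure_C
  obtain ⟨K, -, hK⟩ := S.exists_bound_act θ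
  refine continuous_iff_continuousAt.2 fun c₀ => ?_
  refine continuousAt_of_dominated (bound := fun _ => S.profile (K + (c₀ + 1)) 0)
    (Eventually.of_forall fun c => (S.continuous_profile_act θ c).aestronglyMeasurable) ?_
    (integrable_const _) (Eventually.of_forall fun x => ?_)
  · filter_upwards [gt_mem_nhds (lt_add_one c₀)] with c hc
    filter_upwards [ae_restrict_mem S.isOpen_C.measurableSet] with x hx
    rw [Real.norm_of_nonneg (S.profile_nonneg _ _)]
    refine (S.profile_act_le (hK x hx)).trans (S.profile_mono_of_le ?_)
    linarith
  · exact (S.continuous_profile.comp (continuous_id.prodMk continuous_const)).continuousAt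

theorem volume_C_pos : 0 < volume.real S.C :=
  ENNReal.toReal_pos (S.isOpen_C.measure_pos volume S.nonempty_C).ne' S.isBounded_C.measure_lt_top.ne

/-- Intermediate value theorem: for `c = -K` the cavity is empty, and for `c = K + t` the density is
at least `M / |C|` everywhere. -/
theorem exists_integral_profile_eq (θ : ℝ) :
    ∃ c, ∫ x in S.C, S.profile c ((act (rotation θ) x) 0) = S.M := by
  have := S.isFiniteMeasure_C
  have hγ : S.γ - 1 ≠ 0 := by linarith [S.γ_gt_one]
  have hV := S.volume_C_pos
  have hM := S.M_pos
  obtain ⟨K, -, hK⟩ := S.exists_bound_act θ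
  have h1 : ∫ x in S.C, S.profile (-K) ((act (rotation θ) x) 0) ≤ S.M := by
    refine le_of_eq_of_le (setIntegral_eq_zero_of_forall_eq_zero fun x hx => ?_) hM.le
    have := (abs_le.1 (hK x hx)).2
    rw [profile, max_eq_right (by linarith), Real.zero_rpow S.exponent_pos.ne']
  set t : ℝ := (S.M / volume.real S.C) ^ (S.γ - 1)
  have ht : S.profile t 0 = S.M / volume.real S.C := by
    have ht0 : 0 ≤ t := by positivity
    rw [profile, mul_zero, zero_add, max_eq_left ht0, ← Real.rpow_mul (by positivity),
      mul_one_div_cancel hγ, Real.rpow_one]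
  have h2 : S.M ≤ ∫ x in S.C, S.profile (K + t) ((act (rotation θ) x) 0) := by
    calc S.M = ∫ _ in S.C, S.profile t 0 := by
          rw [setIntegral_const, ht, smul_eq_mul, mul_div_cancel₀ _ hV.ne']
      _ ≤ _ := by
          refine setIntegral_mono_on (integrable_const _) (S.integrable_profile_act θ _)
            S.isOpen_C.measurableSet fun x hx => S.profile_mono_of_le ?_
          have := (abs_le.1 (hK x hx)).1
          linarith
  exact mem_range_of_exists_le_of_exists_ge (S.continuous_integral_profile θ) ⟨_, h1⟩ ⟨_, h2⟩

/-- Equal masses would force equal profiles almost everywhere, but they differ wherever the larger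
one is positive. Positivity is needed because all sufficiently small `c` give mass zero. -/
theorem integral_profile_lt (θ : ℝ) {c c' : ℝ} (h : c < c')
    (hc : 0 < ∫ x in S.C, S.profile c' ((act (rotation θ) x) 0)) :
    ∫ x in S.C, S.profile c ((act (rotation θ) x) 0) <
      ∫ x in S.C, S.profile c' ((act (rotation θ) x) 0) := by
  refine lt_of_le_of_ne (setIntegral_mono_on (S.integrable_profile_act θ _)
    (S.integrable_profile_act θ _) S.isOpen_C.measurableSet fun x _ =>
      S.profile_mono_of_le (by linarith)) fun heq => ?_
  have h0 := (integral_sub (S.integrable_profile_act θ c') (S.integrable_profile_act θ c)).trans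
    (sub_eq_zero.2 heq.symm)
  rw [integral_eq_zero_iff_of_nonneg
    (fun x => sub_nonneg.2 (S.profile_mono_of_le (by linarith)))
    ((S.integrable_profile_act θ c').sub (S.integrable_profile_act θ c))] at h0
  have hz : ∀ᵐ x ∂volume.restrict S.C, S.profile c' ((act (rotation θ) x) 0) = 0 := by
    filter_upwards [h0] with x hx
    by_contra hne
    have hx' : S.profile c ((act (rotation θ) x) 0) = S.profile c' ((act (rotation θ) x) 0) :=
      (sub_eq_zero.1 hx).symm
    set s := (act (rotation θ) x) 0
    have hpos : 0 < (S.γ - 1) / (S.a * S.γ) * S.grav * s + c' := by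
      by_contra! hle
      refine hne ?_
      rw [profile, max_eq_right hle, Real.zero_rpow S.exponent_pos.ne']
    refine hx'.not_lt (Real.rpow_lt_rpow (le_max_right _ _) ?_ S.exponent_pos)
    rw [max_eq_left hpos.le]
    exact max_lt (by linarith) hpos
  rw [integral_congr_ae hz] at hc
  simp at hc

theorem existsUnique_mass (θ : ℝ) : ∃! c : ℝ, ∫ y in S.cavityEq θ, S.profile c (y 0) = S.M := by
  simp_rw [setIntegral_profile]
  obtain ⟨c, hc⟩ := S.exists_integral_profile_eq θ
  have hM := S.M_pos
  refine ⟨c, hc, fun c' hc' => ?_⟩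
  rcases lt_trichotomy c' c with h | h | h
  · exact absurd (hc'.trans hc.symm) (S.integral_profile_lt θ h (by rwa [hc])).ne
  · exact h
  · exact absurd (hc.trans hc'.symm) (S.integral_profile_lt θ h (by rwa [hc'])).ne

variable {S} {ρ : E3 → ℝ} {g : E3}

/-- The pressure is `a` times the power `γ/(γ-1)` of the positive part of `κ g · x + c`. Its
gradient is `ρ g` because `a κ γ/(γ-1) = 1`. -/
theorem isHydrostatic_profile (hg : act (rotation θ) g = S.grav • e 0) (c : ℝ) :
    IsHydrostatic S.C (fun x => S.pressure (S.profile c ((act (rotation θ) x) 0)))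
      (fun x => S.profile c ((act (rotation θ) x) 0)) g := by
  have ha := S.a_pos
  have hγ := S.γ_pos
  have hγ1 : 0 < S.γ - 1 := by linarith [S.γ_gt_one]
  refine isHydrostatic_of_hasFDerivAt (S.continuous_profile_act θ c) fun x => ?_
  set κ := (S.γ - 1) / (S.a * S.γ)
  have hprof : ∀ x, S.profile c ((act (rotation θ) x) 0) =
      (max (κ * inner ℝ g x + c) 0) ^ (1 / (S.γ - 1)) := fun x => by
    rw [profile, inner_eq_of_act_rotation_eq hg, mul_assoc]
  have hpres : (fun x => S.pressure (S.profile c ((act (rotation θ) x) 0))) =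
      fun x => S.a * (max (κ * inner ℝ g x + c) 0) ^ (S.γ / (S.γ - 1)) := funext fun x => by
    rw [hprof, pressure, ← Real.rpow_mul (le_max_right _ _), one_div_mul_eq_div]
  have hlin : HasFDerivAt (fun x => κ * inner ℝ g x + c) (κ • innerSL ℝ g) x :=
    (((innerSL ℝ g).hasFDerivAt).const_mul κ).add_const c
  have hr : 1 < S.γ / (S.γ - 1) := by rw [one_lt_div hγ1]; linarith
  rw [hpres, hprof]
  refine (((hasDerivAt_max_rpow hr _).comp_hasFDerivAt x hlin).const_mul S.a).congr_fderiv ?_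
  rw [smul_smul, smul_smul]
  congr 1
  rw [show S.γ / (S.γ - 1) - 1 = 1 / (S.γ - 1) by field_simp; ring]
  simp only [κ]
  field_simp

/-- For a fluid at rest, the momentum equation is the hydrostatic equation. -/
theorem weakMomentum_iff {u : E3 → E3} {Du : E3 → E3 →L[ℝ] E3}
    (hu : ∀ᵐ x ∂volume.restrict S.C, u x = 0) (hD : ∀ᵐ x ∂volume.restrict S.C, Du x = 0) :
    S.WeakMomentum ρ u 0 g u Du ↔ IsHydrostatic S.C (fun x => S.pressure (ρ x)) ρ g := by
  refine forall₂_congr fun φ _ => ?_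
  have h1 : ∫ x in S.C, ρ x * inner ℝ (u x) (fderiv ℝ φ x (u x)) = 0 :=
    integral_eq_zero_of_ae (hu.mono fun x hx => by simp [hx])
  have h2 : ∫ x in S.C, contract (stress S.μ S.lam (Du x + rigidGrad 0))
      (gradMatrix (fderiv ℝ φ x)) = 0 :=
    integral_eq_zero_of_ae (hD.mono fun x hx => by
      simp [hx, rigidGrad_zero, contract_stress_zero])
  rw [h1, h2]
  simp

theorem isSobolevZero_zero {C : Set E3} {u : E3 → E3} (hu : ∀ᵐ x ∂volume.restrict C, u x = 0) :
    IsSobolevZero C u fun _ => 0 := by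
  have key : ∀ {F : Type} [NormedAddCommGroup F] {f : E3 → F},
      (∀ᵐ x ∂volume.restrict C, f x = 0) → MemLp f 2 (volume.restrict C) ∧
        eLpNorm f 2 (volume.restrict C) = 0 := fun {F} _ {f} hf => by
    have hf' : f =ᵐ[volume.restrict C] 0 := hf
    exact ⟨MemLp.zero.ae_eq hf'.symm, by rw [eLpNorm_congr_ae hf', eLpNorm_zero]⟩
  have hts : tsupport (fun _ : E3 => (0 : E3)) ⊆ C := by
    rw [tsupport, Function.support_fun_zero, closure_empty]
    exact empty_subset C
  refine ⟨(key hu).1, (key (Eventually.of_forall fun _ => rfl)).1, fun _ _ => 0,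
    fun _ => ⟨contDiff_const, HasCompactSupport.zero, hts⟩,
    tendsto_const_nhds.congr fun _ => (key (hu.mono fun x hx => ?_)).2.symm,
    tendsto_const_nhds.congr fun _ => (key (Eventually.of_forall fun x => ?_)).2.symm⟩
  · simp [hx]
  · rw [fderiv_fun_const, Pi.zero_apply, sub_zero]

theorem renormalizedContinuity_zero {u : E3 → E3} (hu : ∀ᵐ x ∂volume.restrict S.C, u x = 0) :
    S.RenormalizedContinuity ρ u fun _ => 0 := by
  intro b _
  refine ⟨?_, ?_, fun ψ _ => ?_⟩
  · exact (integrable_zero _ _ _).congr (hu.mono fun x hx => by simp [hx])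
  · simp only [divOf_zero, mul_zero]
    exact integrable_zero _ _ _
  · rw [integral_eq_zero_of_ae (hu.mono fun x hx => by simp [hx])]
    simp [divOf_zero]

theorem relative_velocity_zero (u : E3 → E3) : (fun x => u x - (0 : ℝ) • cross (e 2) x) = u := by
  funext x
  simp

/-- The order is essential: `ω = 0` identifies the relative velocity with `u`, this gives rest, and
only at rest is the momentum equation hydrostatic. -/
theorem IsSteadySolution.exists_equilibrium {u : E3 → E3} {ω : ℝ}
    (h : S.IsSteadySolution ρ u ω g) :
    (ω = 0 ∧ ∀ᵐ x ∂volume.restrict S.C, u x = 0) ∧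
      ∃ θ ∈ Ico (0 : ℝ) (2 * Real.pi), ∃ c : ℝ,
        (act (rotation θ) g = S.grav • e 0 ∧
          ∀ᵐ x ∂volume.restrict S.C, ρ x = S.profile c ((act (rotation θ) x) 0)) ∧
        ((S.centerOfMass θ ρ) 1 = 0 ∧ S.centerOfMass θ ρ = S.equilibriumPoint θ c) ∧
        ∫ y in S.cavityEq θ, S.profile c (y 0) = S.M := by
  have := S.isFiniteMeasure_C
  obtain rfl := smul_cross_axis_eq_zero S.grav_pos h.gravity_norm h.gravity_horizontal_axis
    h.gravity_steady
  obtain ⟨Du, hu, hmom, hren⟩ := h.equations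
  rw [relative_velocity_zero] at hu hmom hren
  obtain ⟨hD0, hu0⟩ := velocity_eq_zero hmom hu hren h.density_memLp h.density_nonneg
  have hρ : IntegrableOn ρ S.C := h.density_memLp.integrable (by simpa using S.γ_gt_one.le)
  obtain ⟨θ, hθ, hθg⟩ := exists_act_rotation_eq h.gravity_norm h.gravity_horizontal_axis
  obtain ⟨c, hc⟩ := exists_eq_of_isHydrostatic h.density_memLp h.density_nonneg h.mass
    ((weakMomentum_iff hu0 hD0).1 hmom)
  have hprof : ∀ᵐ x ∂volume.restrict S.C, ρ x = S.profile c ((act (rotation θ) x) 0) := by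
    filter_upwards [hc] with x hx
    rw [hx, profile, inner_eq_of_act_rotation_eq hθg, mul_assoc]
  have h1 := (torque_iff hρ hθg).1 h.torque
  refine ⟨⟨rfl, hu0⟩, θ, hθ, c, ⟨hθg, hprof⟩,
    ⟨h1, centerOfMass_eq_equilibriumPoint hρ hprof h1⟩, ?_⟩
  rw [setIntegral_profile, ← h.mass]
  exact (integral_congr_ae hprof).symm

theorem isSteadySolution_of_equilibrium {u : E3 → E3} {c : ℝ}
    (hu : ∀ᵐ x ∂volume.restrict S.C, u x = 0) (hg : act (rotation θ) g = S.grav • e 0)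
    (hρ : ∀ᵐ x ∂volume.restrict S.C, ρ x = S.profile c ((act (rotation θ) x) 0))
    (hcm : (S.centerOfMass θ ρ) 1 = 0) (hM : ∫ y in S.cavityEq θ, S.profile c (y 0) = S.M) :
    S.IsSteadySolution ρ u 0 g where
  density_memLp := (S.memLp_profile_act θ c _).ae_eq (ae_eq_symm hρ)
  density_nonneg := hρ.mono fun x hx => by rw [hx]; exact S.profile_nonneg _ _
  equations := by
    refine ⟨fun _ => 0, ?_⟩
    rw [relative_velocity_zero]
    refine ⟨isSobolevZero_zero hu, (weakMomentum_iff hu (Eventually.of_forall fun _ => rfl)).2 ?_,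
      renormalizedContinuity_zero hu⟩
    refine (isHydrostatic_profile hg c).congr ?_ (ae_eq_symm hρ)
    exact hρ.mono fun x hx => by simp only [hx]
  torque := (torque_iff ((S.integrable_profile_act θ c).congr (ae_eq_symm hρ)) hg).2 hcm
  gravity_steady := zero_smul _ _
  mass := by rw [integral_congr_ae hρ, ← setIntegral_profile, hM]
  gravity_norm := by
    rw [← (rotationIso θ).norm_map g, coe_rotationIso, hg, norm_smul, norm_e, mul_one,
      Real.norm_of_nonneg S.grav_pos.le]
  gravity_horizontal_axis := by
    rw [inner_eq_of_act_rotation_eq hg, (act_rotation_apply θ _).1]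
    simp [e]

end System

end Pendulum

theorem theorem3p1 (S : Pendulum.System) :
    (∀ (ρ : Pendulum.E3 → ℝ) (u : Pendulum.E3 → Pendulum.E3) (ω : ℝ) (g : Pendulum.E3),
      S.IsSteadySolution ρ u ω g ↔
        (ω = 0 ∧ ∀ᵐ x ∂volume.restrict S.C, u x = 0) ∧
        ∃ θ ∈ Set.Ico (0 : ℝ) (2 * Real.pi), ∃ c : ℝ,
          (Pendulum.act (Pendulum.rotation θ) g = S.grav • Pendulum.e 0 ∧
            ∀ᵐ x ∂volume.restrict S.C,
              ρ x = S.profile c ((Pendulum.act (Pendulum.rotation θ) x) 0)) ∧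
          ((S.centerOfMass θ ρ) 1 = 0 ∧ S.centerOfMass θ ρ = S.equilibriumPoint θ c) ∧
          ∫ y in S.cavityEq θ, S.profile c (y 0) = S.M) ∧
    ∀ θ : ℝ, ∃! c : ℝ, ∫ y in S.cavityEq θ, S.profile c (y 0) = S.M := by
  refine ⟨fun ρ u ω g => ⟨fun h => h.exists_equilibrium, ?_⟩, S.existsUnique_mass⟩
  rintro ⟨⟨rfl, hu⟩, θ, -, c, ⟨hg, hρ⟩, ⟨hcm, -⟩, hM⟩
  exact Pendulum.System.isSteadySolution_of_equilibrium hu hg hρ hcm hM
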